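/- **Definitions.** Let $q$ be a prime power and $V$ a $v$-dimensional vector space over $\mathrm{GF}(q)$. Write $\binom{V}{k}_q$ for the set of $k$-dimensional subspaces of $V$. A $t$-$(v,k,\lambda)_q$ *subspace design* is a pair $(V,\mathcal B)$ with $\mathcal B\subseteq\binom{V}{k}_q$ such that every $T\in\binom{V}{t}_q$ is contained in exactly $\lambda$ elements of $\mathcal B$. A *large set* $\mathrm{LS}_q[N](t,k,v)$ on $V$ is a partition of $\binom{V}{k}_q$ into $N$ sets, each of which is the block set of a $t$-$(v,k,\lambda)_q$ design (with the same $\lambda$); for $N=2$ it is called a *halving*. For the field $K=\mathrm{GF}(q^6)$, viewed as a $6$-dimensional vector space over $\mathrm{GF}(q)$, and $\alpha\in K^*$ let $\sigma(x)=\alpha x$ and $\varphi(x)=x^q$, and let $\bar\sigma,\bar\varphi$ be their images in $\mathrm{PGL}(K)$, which acts on the subspaces of $K$. **Theorem.** 1. For $q\in\{3,5\}$ there exists a halving $\mathrm{LS}_q[2](2,3,6)$ (on every $6$-dimensional vector space over $\mathrm{GF}(q)$). 2. ($q=5$.) The polynomial $X^6+X^4-X^3+X^2+2\in\mathrm{GF}(5)[X]$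 has a root in $K=\mathrm{GF}(5^6)$, and each of its roots $\alpha\in K$ is a primitive element, i.e. has multiplicative order $5^6-1$. Let $\alpha$ be such a root, let $G=\langle\bar\sigma^2,\bar\varphi\rangle$, and let $\beta_0,\dots,\beta_5$ be the basis of $K$ over $\mathrm{GF}(5)$ dual to $1,\alpha,\dots,\alpha^5$ with respect to the trace form, i.e. $\mathrm{Tr}_{K/\mathrm{GF}(5)}(\beta_i\alpha^j)=\delta_{ij}$. A number $r=\sum_{i=0}^5a_i5^i$ with $a_i\in\{0,\dots,4\}$ encodes the coordinate row $(a_5,a_4,\dots,a_0)$, that is, the vector $\sum_{j=0}^5a_{5-j}\beta_j\in K$, and a triple of numbers encodes the subspace spanned by the three encoded vectors. Let $\mathcal B$ be the union of the $G$-orbits of the subspaces encoded by the $126$ triples listed below. Then $(K,\mathcal B)$ is a $2$-$(6,3,78)_5$ design, and $\{\mathcal B,\binom{K}{3}_5\setminus\mathcal B\}$ is a halving $\mathrm{LS}_5[2](2,3,6)$. 3. ($q=3$.) The polynomial $X^6-X^4+X^2-X-1\in\mathrm{GF}(3)[X]$ has a root in $K=\mathrm{GF}(3^6)$, and each of its roots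 $\alpha\in K$ has multiplicative order $3^6-1$. For every such root $\alpha$ and $G=\langle\bar\sigma^2,\bar\varphi^2\rangle$, there exists a $G$-invariant $2$-$(6,3,20)_3$ design $(K,\mathcal B)$, and $\{\mathcal B,\binom{K}{3}_3\setminus\mathcal B\}$ is a halving $\mathrm{LS}_3[2](2,3,6)$. The triples in part 2 are: (i) $(3221,728,155)$. (ii) $(3133,898,32)$. (iii) $(3144,132,49)$, $(627,136,49)$, $(3202,631,146)$, $(3248,749,246)$, $(3157,662,229)$, $(3265,1125,44)$, $(3224,637,145)$, $(3139,647,41)$, $(3643,771,45)$, $(3226,739,239)$, $(3383,1136,43)$, $(3263,756,45)$. (iv) $(3224,714,205)$, $(3167,629,129)$, $(3174,701,242)$, $(3221,728,182)$, $(3151,639,132)$, $(3207,641,247)$, $(3220,635,202)$, $(3173,736,166)$, $(5629,146,38)$, $(3643,1017,26)$, $(3190,639,206)$, $(3227,670,157)$, $(3246,720,210)$, $(3127,137,35)$. (v) $(3262,758,27)$, $(3143,749,225)$, $(3232,659,198)$, $(3134,731,162)$, $(3209,672,165)$, $(3236,633,219)$, $(3194,748,211)$, $(3229,669,179)$, $(3381,878,35)$,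 $(3236,698,246)$, $(3157,747,138)$, $(3150,659,194)$, $(3233,719,223)$, $(3228,663,164)$, $(3207,661,237)$, $(4392,144,44)$, $(3130,774,26)$, $(3169,642,246)$, $(5012,141,41)$, $(3181,745,232)$, $(3220,717,148)$, $(3131,718,167)$, $(3233,680,196)$, $(3182,702,181)$, $(3649,1138,41)$, $(3186,629,161)$, $(3147,715,218)$, $(3156,686,198)$, $(3645,641,44)$, $(3510,880,1)$, $(3500,636,29)$, $(3244,647,129)$, $(3231,699,203)$, $(3226,717,228)$, $(3638,1014,38)$, $(3147,696,143)$, $(3245,639,197)$, $(3246,718,222)$, $(3140,143,31)$, $(3173,669,190)$, $(3221,719,161)$, $(5000,131,42)$, $(3513,1145,32)$, $(3170,721,241)$, $(3199,714,157)$, $(3232,685,201)$, $(3203,644,232)$, $(3223,649,218)$, $(3176,677,5)$, $(3167,656,228)$, $(3145,888,36)$, $(3509,629,33)$, $(3232,694,134)$, $(3211,660,207)$, $(3727,1100,8)$, $(3376,954,5)$, $(3274,752,48)$, $(3137,670,214)$, $(3201,647,210)$, $(3209,644,180)$, $(3132,697,160)$, $(3175,628,160)$, $(3154,1000,9)$,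 $(3233,745,159)$, $(3396,1012,48)$, $(3140,631,224)$, $(3153,677,171)$, $(3149,718,221)$, $(3380,1139,27)$, $(3146,665,242)$, $(3238,721,206)$, $(3225,703,182)$, $(3163,733,249)$, $(3227,711,139)$, $(3204,704,204)$, $(3201,738,163)$, $(3174,725,152)$, $(3225,648,223)$, $(3192,667,173)$, $(3140,684,140)$, $(3643,1015,46)$, $(3141,636,249)$, $(3166,667,202)$, $(3230,734,130)$, $(3160,722,218)$, $(3188,675,170)$, $(3219,681,197)$, $(3212,662,167)$, $(3230,635,210)$, $(3165,715,177)$, $(3627,627,6)$, $(3187,711,125)$, $(3478,803,8)$, $(3231,748,223)$, $(3131,690,192)$, $(3222,625,148)$, $(3504,1003,32)$, $(3242,714,226)$. -/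

import Mathlib

open Polynomial

/-! ### Subspace designs and large sets -/

section Designs

variable (F : Type*) (V : Type*) [Field F] [AddCommGroup V] [Module F V]

/-- The set of all `k`-dimensional subspaces of `V`. -/
def Grassmannian (k : ℕ) : Set (Submodule F V) :=
  {U | Module.finrank F U = k}

/-- `(V, B)` is a `t`-`(v, k, lam)_q` subspace design: `V` is a `v`-dimensional vector space over
the field `F` with `q` elements, `B` is a set of `k`-subspaces of `V`, and every `t`-subspace of
`V` is contained in exactly `lam` elements of `B`. -/
structure IsSubspaceDesign (q t v k lam : ℕ) (B : Set (Submodule F V)) : Prop where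
  card_field : Nat.card F = q
  finite : Module.Finite F V
  dim : Module.finrank F V = v
  blocks : B ⊆ Grassmannian F V k
  balanced : ∀ T ∈ Grassmannian F V t, {K ∈ B | T ≤ K}.encard = lam

/-- `L` is a large set `LS_q[N](t, k, v)` on `V`: a partition of the set of all `k`-subspaces of
`V` into `N` subspace designs, all with the same parameters `t`-`(v, k, lam)_q`. -/
structure IsLargeSet (q N t k v : ℕ) (L : Set (Set (Submodule F V))) : Prop where
  card : L.encard = N
  nonempty : ∀ B ∈ L, B.Nonempty
  disjoint : L.PairwiseDisjoint id
  cover : ⋃₀ L = Grassmannian F V k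
  designs : ∃ lam : ℕ, ∀ B ∈ L, IsSubspaceDesign F V q t v k lam B

end Designs

/-! ### Singer cycle, Frobenius, and the groups they generate -/

/-- The image of a linear automorphism `f` of `V` in `PGL(V)`, where `PGL(V)` is regarded as a
group of automorphisms of the lattice of subspaces of `V`: the map `U ↦ f(U)`. -/
def projImage {F V : Type*} [Field F] [AddCommGroup V] [Module F V] (f : V ≃ₗ[F] V) :
    Submodule F V ≃o Submodule F V :=
  Submodule.orderIsoMapComap f

section Singer

variable (F : Type*) {K : Type*} [Field F] [Fintype F] [Field K] [Algebra F K]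

/-- The map `σ : x ↦ a x` on the `F`-vector space `K`. It is a Singer cycle if `a` is a primitive
element of the finite field `K`. -/
def singer (a : Kˣ) : K ≃ₗ[F] K :=
  DistribMulAction.toLinearEquiv F K a

variable (K) in
/-- The map `φ : x ↦ x ^ q` on the `F`-vector space `K`, where `q` is the order of `F`. -/
noncomputable def frob [FiniteDimensional F K] : K ≃ₗ[F] K :=
  (FiniteField.frobeniusAlgEquivOfAlgebraic F K).toLinearEquiv

/-- The group generated by the `i`-th power of the image of `σ` and the `j`-th power of the image
of `φ` in `PGL(K)`. -/
noncomputable def singerFrobGroup [FiniteDimensional F K] (a : Kˣ) (i j : ℕ) :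
    Subgroup (Submodule F K ≃o Submodule F K) :=
  Subgroup.closure {projImage (singer F a) ^ i, projImage (frob F K) ^ j}

end Singer

/-- The orbit of the subspace `U` under a group `G` of automorphisms of the subspace lattice. -/
def subspaceOrbit {F V : Type*} [Field F] [AddCommGroup V] [Module F V]
    (G : Subgroup (Submodule F V ≃o Submodule F V)) (U : Submodule F V) :
    Set (Submodule F V) :=
  {W | ∃ g ∈ G, g U = W}

/-- The set `B` of subspaces is invariant under the group `G`. -/
def IsInvariantUnder {F V : Type*} [Field F] [AddCommGroup V] [Module F V]
    (G : Subgroup (Submodule F V ≃o Submodule F V)) (B : Set (Submodule F V)) : Prop :=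
  ∀ g ∈ G, (fun U => g U) '' B = B

/-! ### The concrete data -/

instance factPrimeFive : Fact (Nat.Prime 5) := ⟨by norm_num⟩

/-- The chosen primitive polynomial over `GF(3)`. -/
noncomputable def primPoly3 : (ZMod 3)[X] := X ^ 6 - X ^ 4 + X ^ 2 - X - 1

/-- The chosen primitive polynomial over `GF(5)`. -/
noncomputable def primPoly5 : (ZMod 5)[X] := X ^ 6 + X ^ 4 - X ^ 3 + X ^ 2 + 2

/-- The row `(a₅, a₄, a₃, a₂, a₁, a₀)` of `5`-adic digits of `r = ∑ aᵢ 5 ^ i`; the entry in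
column `j = 0, …, 5` is `a_{5 - j}`. -/
def digitRow (r : ℕ) (j : Fin 6) : ZMod 5 := ((r / 5 ^ (5 - (j : ℕ)) % 5 : ℕ) : ZMod 5)

/-- The vector whose coordinate row with respect to the basis `b` is encoded by `r`. -/
noncomputable def codedVector {V : Type*} [AddCommGroup V] [Module (ZMod 5) V]
    (b : Module.Basis (Fin 6) (ZMod 5) V) (r : ℕ) : V :=
  ∑ j, digitRow r j • b j

/-- The subspace which is the row space, with respect to the basis `b`, of the `3 × 6` matrix
whose rows are encoded by the three numbers in `t`. -/
noncomputable def codedSubspace {V : Type*} [AddCommGroup V] [Module (ZMod 5) V]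
    (b : Module.Basis (Fin 6) (ZMod 5) V) (t : ℕ × ℕ × ℕ) : Submodule (ZMod 5) V :=
  Submodule.span (ZMod 5) {codedVector b t.1, codedVector b t.2.1, codedVector b t.2.2}

/-- The encoded canonical matrices of the representatives of the selected orbits. -/
def orbitReps5 : List (ℕ × ℕ × ℕ) :=
  [
    (3221, 728, 155),
    (3133, 898, 32),
    (3144, 132, 49), (627, 136, 49), (3202, 631, 146), (3248, 749, 246), (3157, 662, 229),
    (3265, 1125, 44), (3224, 637, 145), (3139, 647, 41), (3643, 771, 45), (3226, 739, 239),
    (3383, 1136, 43), (3263, 756, 45),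
    (3224, 714, 205), (3167, 629, 129), (3174, 701, 242), (3221, 728, 182), (3151, 639, 132),
    (3207, 641, 247), (3220, 635, 202), (3173, 736, 166), (5629, 146, 38), (3643, 1017, 26),
    (3190, 639, 206), (3227, 670, 157), (3246, 720, 210), (3127, 137, 35),
    (3262, 758, 27), (3143, 749, 225), (3232, 659, 198), (3134, 731, 162), (3209, 672, 165),
    (3236, 633, 219), (3194, 748, 211), (3229, 669, 179), (3381, 878, 35), (3236, 698, 246),
    (3157, 747, 138), (3150, 659, 194), (3233, 719, 223), (3228, 663, 164), (3207, 661, 237),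
    (4392, 144, 44), (3130, 774, 26), (3169, 642, 246), (5012, 141, 41), (3181, 745, 232),
    (3220, 717, 148), (3131, 718, 167), (3233, 680, 196), (3182, 702, 181), (3649, 1138, 41),
    (3186, 629, 161), (3147, 715, 218), (3156, 686, 198), (3645, 641, 44), (3510, 880, 1),
    (3500, 636, 29), (3244, 647, 129), (3231, 699, 203), (3226, 717, 228), (3638, 1014, 38),
    (3147, 696, 143), (3245, 639, 197), (3246, 718, 222), (3140, 143, 31), (3173, 669, 190),
    (3221, 719, 161), (5000, 131, 42), (3513, 1145, 32), (3170, 721, 241), (3199, 714, 157),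
    (3232, 685, 201), (3203, 644, 232), (3223, 649, 218), (3176, 677, 5), (3167, 656, 228),
    (3145, 888, 36), (3509, 629, 33), (3232, 694, 134), (3211, 660, 207), (3727, 1100, 8),
    (3376, 954, 5), (3274, 752, 48), (3137, 670, 214), (3201, 647, 210), (3209, 644, 180),
    (3132, 697, 160), (3175, 628, 160), (3154, 1000, 9), (3233, 745, 159), (3396, 1012, 48),
    (3140, 631, 224), (3153, 677, 171), (3149, 718, 221), (3380, 1139, 27), (3146, 665, 242),
    (3238, 721, 206), (3225, 703, 182), (3163, 733, 249), (3227, 711, 139), (3204, 704, 204),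
    (3201, 738, 163), (3174, 725, 152), (3225, 648, 223), (3192, 667, 173), (3140, 684, 140),
    (3643, 1015, 46), (3141, 636, 249), (3166, 667, 202), (3230, 734, 130), (3160, 722, 218),
    (3188, 675, 170), (3219, 681, 197), (3212, 662, 167), (3230, 635, 210), (3165, 715, 177),
    (3627, 627, 6), (3187, 711, 125), (3478, 803, 8), (3231, 748, 223), (3131, 690, 192),
    (3222, 625, 148), (3504, 1003, 32), (3242, 714, 226)]

/-- The union of the selected orbits of the group `G`. -/
def selectedBlocks5 {V : Type*} [AddCommGroup V] [Module (ZMod 5) V]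
    (G : Subgroup (Submodule (ZMod 5) V ≃o Submodule (ZMod 5) V))
    (b : Module.Basis (Fin 6) (ZMod 5) V) : Set (Submodule (ZMod 5) V) :=
  ⋃ t ∈ orbitReps5, subspaceOrbit G (codedSubspace b t)

/-! A design can be recognised from two one-sided estimates. If every 2-space lies in at least λ
blocks and there are at most λ·[6 choose 2]_q / [3 choose 2]_q blocks, then counting the flags
(2-space, block) in two ways leaves no room for an excess, so every 2-space lies in exactly λ blocks
(`balanced_of_le`). A 2-space lies in (q^6 - q^2)/(q^3 - q^2) spaces of dimension 3, which is 2λ for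
λ = 20 and λ = 78; hence the complement of the block set is a design with the same λ, and the two
form a halving. What remains is an upper bound for the lengths of the chosen orbits and a lower
bound for the number of blocks above every line (2-space).

Both bounds turn into integer arithmetic through the Singer cycle. Let N = (q^6 - 1)/(q - 1). The
points of the projective space are the α^e with e modulo N, and a 3-space is presented as the
annihilator, under the trace form, of three powers of α (`traceAnn`). In this dual description σ⁻¹
adds 1 to the three exponents and φ multiplies them by q (`singer_traceAnn`, `frob_traceAnn`). If H
is the bit mask of the e with Tr(α^e) = 0, the point set of the 3-space is the bitwise conjunction
of three shifts of H (`IsFor.testBit_mask`), so equality of subspaces is equality of two integers.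

A line through α^k and α^l is determined by k and the difference l - k. Even shifts reduce k to its
parity, and the Frobenius power multiplies the difference; it preserves the parity of k because q is
odd (`IsFor.ncard_pencil_conj`). It therefore suffices that the differences of points on some
representative lines cover all nonzero residues up to conjugacy, for each parity
(`IsFor.le_ncard_pencil_of_coverCheck`). Above each representative line the certificate names λ
blocks. Two different 3-spaces above a line meet only in that line, so their distinctness is
verified against one growing union (`sunflowerCheck_spec`).

The field theory uses only the relation x^6 = r(x). Powers computed modulo this relation are valid
in every commutative ring of characteristic p where it holds; this yields both the order of a root
and its existence in K. Traces of powers satisfy the recurrence given by r, which certifies H. For q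
= 5, coordinates in the dual basis are traces against powers of α, so the encoded matrices are
compared with the same table. Halvings on arbitrary 6-spaces are transported along an isomorphism of
subspace lattices. -/

section Counting

/-! ### Counting subspaces, and the double count of flags. -/

/-- Subspaces of `V` of dimension `k` below `U` are the `k`-subspaces of `U`. -/
lemma ncard_grassmannian_le {F V : Type*} [Field F] [AddCommGroup V] [Module F V]
    (U : Submodule F V) (k : ℕ) :
    {T ∈ Grassmannian F V k | T ≤ U}.ncard = (Grassmannian F U k).ncard := by
  have : {T ∈ Grassmannian F V k | T ≤ U} =
      (fun T : Submodule F U => T.map U.subtype) '' Grassmannian F U k := by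
    ext T
    constructor
    · rintro ⟨hT, hTU⟩
      refine ⟨T.comap U.subtype, ?_, ?_⟩
      · have := (Submodule.comapSubtypeEquivOfLe hTU).finrank_eq
        exact this.trans hT
      · simpa [Submodule.map_comap_subtype] using hTU
    · rintro ⟨S, hS, rfl⟩
      refine ⟨?_, Submodule.map_subtype_le U S⟩
      exact (LinearEquiv.finrank_eq (Submodule.equivMapOfInjective _ U.injective_subtype S)).symm.trans hS
  rw [this, Set.ncard_image_of_injective _ (Submodule.map_injective_of_injective
    U.injective_subtype)]

variable {F V : Type*} [Field F] [Finite F] [AddCommGroup V] [Module F V] [FiniteDimensional F V]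

instance finite_submodule : Finite (Submodule F V) :=
  have : Finite V := Module.finite_of_finite F
  Finite.of_injective (fun U : Submodule F V => (U : Set V)) SetLike.coe_injective

/-- If every fiber over `t` has `c` elements, the number of fibers is determined. -/
lemma ncard_mul_eq_card_of_fibers {α β : Type*} [Finite α] (f : α → β) (t : Set β)
    (ht : t.Finite) (hf : ∀ a, f a ∈ t) (c : ℕ) (hc : ∀ b ∈ t, Nat.card {a // f a = b} = c) :
    t.ncard * c = Nat.card α := by
  classical
  have := Fintype.ofFinite α
  rw [Nat.card_eq_fintype_card, ← Finset.card_univ, Set.ncard_eq_toFinset_card t ht,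
    Finset.card_eq_sum_card_fiberwise (f := f) (t := ht.toFinset) (fun a _ => by simpa using hf a),
    Finset.sum_const_nat (m := c)]
  intro b hb
  rw [← hc b (by simpa using hb), Nat.card_eq_fintype_card, Fintype.card_subtype]

/-- The number of `k`-subspaces of an `n`-space, times the number of ordered bases of a
`k`-space. -/
lemma ncard_grassmannian_mul (k : ℕ) (hk : k ≤ Module.finrank F V) :
    (Grassmannian F V k).ncard * ∏ i : Fin k, (Nat.card F ^ k - Nat.card F ^ (i : ℕ)) =
      ∏ i : Fin k, (Nat.card F ^ Module.finrank F V - Nat.card F ^ (i : ℕ)) := by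
  have : Finite V := Module.finite_of_finite F
  have := Fintype.ofFinite F
  rw [Nat.card_eq_fintype_card, ← card_linearIndependent hk]
  refine ncard_mul_eq_card_of_fibers
    (fun s : {s : Fin k → V // LinearIndependent F s} => Submodule.span F (Set.range s.1)) _
    (Set.toFinite _) ?_ _ ?_
  · rintro ⟨s, hs⟩
    exact (finrank_span_eq_card hs).trans (Fintype.card_fin k)
  · intro U hU
    have hU' : Module.finrank F U = k := hU
    have := card_linearIndependent (K := F) (V := U) hU'.ge
    rw [hU'] at this
    rw [← this]
    -- Families with span `U` correspond to independent families in `U`, since `k` independent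
    -- vectors in the `k`-space `U` span it.
    refine Nat.card_congr ⟨fun s => ⟨fun i => ⟨s.1.1 i, ?_⟩, ?_⟩,
      fun s => ⟨⟨fun i => (s.1 i : V), ?_⟩, ?_⟩, fun s => rfl, fun s => rfl⟩
    · exact s.2.le (Submodule.subset_span ⟨i, rfl⟩)
    · exact LinearIndependent.of_comp U.subtype s.1.2
    · exact s.2.map' U.subtype U.ker_subtype
    · refine Submodule.eq_of_le_of_finrank_eq (Submodule.span_le.2 ?_) ?_
      · rintro _ ⟨i, rfl⟩; exact (s.1 i).2
      · exact ((finrank_span_eq_card (s.2.map' U.subtype U.ker_subtype)).trans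
          (Fintype.card_fin k)).trans hU'.symm

/-- The number of `(k + 1)`-spaces above a given `k`-space. -/
lemma ncard_grassmannian_ge_mul (T : Submodule F V) :
    {U ∈ Grassmannian F V (Module.finrank F T + 1) | T ≤ U}.ncard *
        (Nat.card F ^ (Module.finrank F T + 1) - Nat.card F ^ Module.finrank F T) =
      Nat.card F ^ Module.finrank F V - Nat.card F ^ Module.finrank F T := by
  have : Finite V := Module.finite_of_finite F
  have hcompl : ∀ S : Set V, (T : Set V) ⊆ S →
      Nat.card {w : V // w ∈ S ∧ w ∉ T} = S.ncard - Nat.card T := by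
    intro S hS
    exact Set.ncard_sdiff hS (Set.toFinite _)
  have hV : Nat.card F ^ Module.finrank F V - Nat.card F ^ Module.finrank F T =
      Nat.card {w : V // w ∉ T} := by
    have := hcompl Set.univ (Set.subset_univ _)
    simp only [Set.mem_univ, true_and, Set.ncard_univ] at this
    rw [this, Module.natCard_eq_pow_finrank (K := F) (V := V),
      Module.natCard_eq_pow_finrank (K := F) (V := T)]
  rw [hV]
  have hfr : ∀ w : V, w ∉ T →
      Module.finrank F (T ⊔ Submodule.span F {w} : Submodule F V) = Module.finrank F T + 1 := by
    intro w hw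
    have hw0 : w ≠ 0 := fun h => hw (h ▸ T.zero_mem)
    have h1 := Submodule.finrank_sup_add_finrank_inf_eq T (Submodule.span F {w})
    rw [finrank_span_singleton hw0, (Submodule.disjoint_span_singleton' hw0).2 hw |>.eq_bot] at h1
    simpa using h1
  -- The fibre of `w ↦ T ⊔ ⟨w⟩` over `U` is the set `U \ T`, whose size does not depend on `U`.
  refine ncard_mul_eq_card_of_fibers
    (fun w : {w : V // w ∉ T} => T ⊔ Submodule.span F {w.1}) _ (Set.toFinite _) ?_ _ ?_
  · rintro ⟨w, hw⟩
    exact ⟨hfr w hw, le_sup_left⟩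
  · rintro U ⟨hU, hTU⟩
    have hU' : Module.finrank F U = Module.finrank F T + 1 := hU
    have := hcompl U hTU
    rw [← Nat.card_coe_set_eq, SetLike.coe_sort_coe, Module.natCard_eq_pow_finrank (K := F) (V := U),
      Module.natCard_eq_pow_finrank (K := F) (V := T), hU'] at this
    rw [← this]
    refine Nat.card_congr ⟨fun w => ⟨w.1.1, ?_, w.1.2⟩, fun w => ⟨⟨w.1, w.2.2⟩, ?_⟩,
      fun _ => rfl, fun _ => rfl⟩
    · exact w.2.le (Submodule.mem_sup_right (Submodule.mem_span_singleton_self _))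
    · refine Submodule.eq_of_le_of_finrank_eq
        (sup_le hTU ((Submodule.span_singleton_le_iff_mem _ _).2 w.2.1)) ?_
      rw [hfr w.1 w.2.2, hU']

/-- If every `2`-space is below at least `lam` blocks and there are not too many blocks, then
every `2`-space is below exactly `lam` blocks. -/
lemma balanced_of_le (B : Set (Submodule F V)) (lam n : ℕ)
    (hn : ∀ U ∈ B, {T ∈ Grassmannian F V 2 | T ≤ U}.ncard = n)
    (hlam : ∀ T ∈ Grassmannian F V 2, lam ≤ {U ∈ B | T ≤ U}.ncard)
    (hcard : B.ncard * n ≤ (Grassmannian F V 2).ncard * lam) :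
    ∀ T ∈ Grassmannian F V 2, {U ∈ B | T ≤ U}.ncard = lam := by
  classical
  have := Fintype.ofFinite (Submodule F V)
  set A := (Grassmannian F V 2).toFinset with hA
  set C := B.toFinset with hC
  have hab : ∀ T, {U ∈ B | T ≤ U}.ncard = (C.bipartiteAbove (· ≤ ·) T).card := by
    intro T
    rw [Set.ncard_eq_toFinset_card']
    congr 1; ext U; simp [Finset.bipartiteAbove, hC]
  have hbe : ∀ U, {T ∈ Grassmannian F V 2 | T ≤ U}.ncard =
      (A.bipartiteBelow (· ≤ ·) U).card := by
    intro U
    rw [Set.ncard_eq_toFinset_card']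
    congr 1; ext T; simp [Finset.bipartiteBelow, hA]
  have hsum := Finset.sum_card_bipartiteAbove_eq_sum_card_bipartiteBelow (s := A) (t := C)
    (fun T U : Submodule F V => T ≤ U)
  have h2 : ∑ U ∈ C, (A.bipartiteBelow (· ≤ ·) U).card = B.ncard * n := by
    rw [Set.ncard_eq_toFinset_card', Finset.sum_const_nat]
    intro U hU
    rw [← hbe, hn U (by simpa [hC] using hU)]
  have h3 : ∑ T ∈ A, lam = (Grassmannian F V 2).ncard * lam := by
    rw [Set.ncard_eq_toFinset_card', Finset.sum_const, smul_eq_mul]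
  have hle : ∀ T ∈ A, lam ≤ (C.bipartiteAbove (· ≤ ·) T).card := fun T hT => by
    rw [← hab]; exact hlam T (by simpa [hA] using hT)
  -- The double count and `hcard` give the reverse inequality between the sums, so no term can be
  -- strict.
  have heq := (Finset.sum_eq_sum_iff_of_le hle).1
    (le_antisymm (Finset.sum_le_sum hle) (by rw [h3, hsum, h2]; exact hcard))
  intro T hT
  rw [hab, ← heq T (by simpa [hA] using hT)]

end Counting

/-! ### From half of the 3-spaces above every 2-space to a halving. -/

section LargeSet

variable {F V : Type*} [Field F] [Finite F] [AddCommGroup V] [Module F V] [FiniteDimensional F V]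

/-- A set of `3`-spaces which contains exactly half of the `3`-spaces above every `2`-space is a
design, and it forms a halving together with its complement. -/
lemma design_and_halving (q lam : ℕ) (hq : Nat.card F = q) (hdim : Module.finrank F V = 6)
    (hlam : 0 < lam) (h2lam : 2 * lam * (q ^ 3 - q ^ 2) = q ^ 6 - q ^ 2) (B : Set (Submodule F V))
    (hB : B ⊆ Grassmannian F V 3)
    (hbal : ∀ T ∈ Grassmannian F V 2, {U ∈ B | T ≤ U}.ncard = lam) :
    IsSubspaceDesign F V q 2 6 3 lam B ∧
      IsLargeSet F V q 2 2 3 6 {B, Grassmannian F V 3 \ B} := by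
  have hq1 : 1 < q := hq ▸ Finite.one_lt_card
  have hall : ∀ T ∈ Grassmannian F V 2, {U ∈ Grassmannian F V 3 | T ≤ U}.ncard = 2 * lam := by
    intro T hT
    have hT' : Module.finrank F T = 2 := hT
    have h := ncard_grassmannian_ge_mul T
    rw [hT', hdim, hq, ← h2lam] at h
    exact Nat.eq_of_mul_eq_mul_right
      (Nat.sub_pos_of_lt (Nat.pow_lt_pow_right hq1 (by norm_num))) h
  have hbal' : ∀ T ∈ Grassmannian F V 2,
      {U ∈ Grassmannian F V 3 \ B | T ≤ U}.ncard = lam := by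
    intro T hT
    have : {U ∈ Grassmannian F V 3 \ B | T ≤ U} =
        {U ∈ Grassmannian F V 3 | T ≤ U} \ {U ∈ B | T ≤ U} := by
      ext U; exact ⟨fun h => ⟨⟨h.1.1, h.2⟩, fun h' => h.1.2 h'.1⟩,
        fun h => ⟨⟨h.1.1, fun h' => h.2 ⟨h', h.1.2⟩⟩, h.1.2⟩⟩
    have hsub : {U ∈ B | T ≤ U} ⊆ {U ∈ Grassmannian F V 3 | T ≤ U} :=
      fun U hU => ⟨hB hU.1, hU.2⟩
    rw [this, Set.ncard_sdiff hsub (Set.toFinite _), hall T hT, hbal T hT]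
    omega
  have hd : ∀ C : Set (Submodule F V), C ⊆ Grassmannian F V 3 →
      (∀ T ∈ Grassmannian F V 2, {U ∈ C | T ≤ U}.ncard = lam) →
        IsSubspaceDesign F V q 2 6 3 lam C := fun C hC h =>
    ⟨hq, inferInstance, hdim, hC, fun T hT => by
      rw [← h T hT, Set.Finite.cast_ncard_eq (Set.toFinite _)]⟩
  -- Some 2-space is needed to see that the two parts are nonempty. Without any, the count of
  -- independent pairs would vanish, but none of its factors does.
  obtain ⟨T, hT⟩ : (Grassmannian F V 2).Nonempty := by
    by_contra h
    have := ncard_grassmannian_mul (F := F) (V := V) 2 (by omega)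
    rw [Set.not_nonempty_iff_eq_empty.1 h, Set.ncard_empty, zero_mul, eq_comm,
      Finset.prod_eq_zero_iff] at this
    obtain ⟨i, -, hi⟩ := this
    rw [hdim, Nat.sub_eq_zero_iff_le, hq] at hi
    exact absurd hi (not_le.2 (Nat.pow_lt_pow_right hq1 (by omega)))
  have hne : ∀ C : Set (Submodule F V),
      (∀ T ∈ Grassmannian F V 2, {U ∈ C | T ≤ U}.ncard = lam) → C.Nonempty := by
    intro C h
    have := h T hT
    obtain ⟨U, hU⟩ := Set.nonempty_of_ncard_ne_zero (by omega : {U ∈ C | T ≤ U}.ncard ≠ 0)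
    exact ⟨U, hU.1⟩
  have hdisj : Disjoint B (Grassmannian F V 3 \ B) := Set.disjoint_sdiff_right
  have hBne : B ≠ Grassmannian F V 3 \ B := hdisj.ne (hne B hbal).ne_empty
  refine ⟨hd B hB hbal, ⟨Set.encard_pair hBne, ?_, ?_, ?_, lam, ?_⟩⟩
  · rintro C (rfl | rfl)
    exacts [hne _ hbal, hne _ hbal']
  · exact (Set.pairwise_pair_of_symm).2 fun _ => hdisj
  · simpa using hB
  · rintro C (rfl | rfl)
    exacts [hd _ hB hbal, hd _ Set.sdiff_subset hbal']

end LargeSet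

/-! ### Arithmetic modulo a monic relation of degree 6, and primitivity. -/

section SexticArithmetic

/-- A polynomial expression of degree less than `6`, given by its coefficients. -/
structure Sextic where
  c0 : ℕ
  c1 : ℕ
  c2 : ℕ
  c3 : ℕ
  c4 : ℕ
  c5 : ℕ

namespace Sextic

/-- The value of the expression at `x`. -/
def eval {R : Type*} [CommRing R] (x : R) (v : Sextic) : R :=
  v.c0 + v.c1 * x + v.c2 * x ^ 2 + v.c3 * x ^ 3 + v.c4 * x ^ 4 + v.c5 * x ^ 5

/-- `c v + w`, with coefficients modulo `p`. -/
def axpy (p c : ℕ) (v w : Sextic) : Sextic :=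
  ⟨(c * v.c0 + w.c0) % p, (c * v.c1 + w.c1) % p, (c * v.c2 + w.c2) % p, (c * v.c3 + w.c3) % p,
    (c * v.c4 + w.c4) % p, (c * v.c5 + w.c5) % p⟩

/-- Multiplication by `x`, where `x ^ 6` is rewritten as `r`. -/
def xmul (p : ℕ) (r v : Sextic) : Sextic :=
  axpy p v.c5 r ⟨0, v.c0, v.c1, v.c2, v.c3, v.c4⟩

/-- Multiplication modulo `x ^ 6 - r`. -/
def mul (p : ℕ) (r v w : Sextic) : Sextic :=
  axpy p v.c0 w (xmul p r (axpy p v.c1 w (xmul p r (axpy p v.c2 w (xmul p r (axpy p v.c3 w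
    (xmul p r (axpy p v.c4 w (xmul p r (axpy p v.c5 w ⟨0, 0, 0, 0, 0, 0⟩))))))))))

/-- The `n`-th power for `n < 2 ^ k`, by repeated squaring. -/
def pow (p : ℕ) (r v : Sextic) : ℕ → ℕ → Sextic
  | 0, _ => ⟨1, 0, 0, 0, 0, 0⟩
  | k + 1, n => bif Nat.beq (n % 2) 0 then mul p r (pow p r v k (n / 2)) (pow p r v k (n / 2))
      else mul p r v (mul p r (pow p r v k (n / 2)) (pow p r v k (n / 2)))

/-- The sum of the `v ^ (p ^ i)` for `i < 6`. -/
def traceSum (p k : ℕ) (r v : Sextic) : Sextic :=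
  axpy p 1 (pow p r v k 1) (axpy p 1 (pow p r v k p) (axpy p 1 (pow p r v k (p ^ 2))
    (axpy p 1 (pow p r v k (p ^ 3)) (axpy p 1 (pow p r v k (p ^ 4)) (pow p r v k (p ^ 5))))))

section Eval

variable {R : Type*} [CommRing R] {p : ℕ} (hp : (p : R) = 0)

include hp

lemma cast_mod_of_cast_eq_zero (n : ℕ) : ((n % p : ℕ) : R) = n := by
  conv_rhs => rw [← Nat.mod_add_div n p, Nat.cast_add, Nat.cast_mul, hp, zero_mul, add_zero]

lemma eval_axpy (x : R) (c : ℕ) (v w : Sextic) :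
    (axpy p c v w).eval x = c * v.eval x + w.eval x := by
  simp only [eval, axpy, cast_mod_of_cast_eq_zero hp]
  push_cast
  ring

variable {r : Sextic} {x : R} (hx : x ^ 6 = r.eval x)

include hx

/-- Moving the coefficients up by one drops the top one, which re-enters as a multiple of the
relation. -/
lemma eval_xmul (v : Sextic) : (xmul p r v).eval x = x * v.eval x := by
  rw [xmul, eval_axpy hp, ← hx]
  simp only [eval]
  push_cast
  ring

/-- Horner's scheme in the coefficients of `v`. -/
lemma eval_mul (v w : Sextic) : (mul p r v w).eval x = v.eval x * w.eval x := by
  simp only [mul, eval_axpy hp, eval_xmul hp hx]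
  simp only [eval]
  push_cast
  ring

/-- The argument `k` counts the binary digits processed and drives the recursion; higher digits of
the exponent would be ignored. -/
lemma eval_pow (v : Sextic) (k n : ℕ) (hn : n < 2 ^ k) : (pow p r v k n).eval x = v.eval x ^ n := by
  induction k generalizing n with
  | zero =>
    obtain rfl : n = 0 := by simpa using hn
    simp [pow, eval]
  | succ k ih =>
    have ih' := ih (n / 2) (by omega)
    rw [pow]
    rcases Nat.mod_two_eq_zero_or_one n with h | h
    · rw [h]
      rw [show Nat.beq 0 0 = true from rfl, cond_true, eval_mul hp hx, ih', ← pow_add]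
      congr 1; omega
    · rw [h]
      rw [show Nat.beq 1 0 = false from rfl, cond_false, eval_mul hp hx, eval_mul hp hx, ih',
        ← pow_add, ← pow_succ']
      congr 1; omega

lemma eval_traceSum (v : Sextic) (k : ℕ) (hk : p ^ 5 < 2 ^ k) (hp0 : 0 < p) :
    (traceSum p k r v).eval x = ∑ i ∈ Finset.range 6, v.eval x ^ p ^ i := by
  have h : ∀ i ≤ 5, p ^ i < 2 ^ k := fun i hi => (Nat.pow_le_pow_right hp0 hi).trans_lt hk
  have h0 := h 0 (by norm_num)
  have h1 := h 1 (by norm_num)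
  rw [pow_zero] at h0
  rw [pow_one] at h1
  simp only [traceSum, eval_axpy hp, eval_pow hp hx _ _ _ h0, eval_pow hp hx _ _ _ h1,
    eval_pow hp hx _ _ _ (h 2 (by norm_num)), eval_pow hp hx _ _ _ (h 3 (by norm_num)),
    eval_pow hp hx _ _ _ (h 4 (by norm_num)), eval_pow hp hx _ _ _ hk, Finset.sum_range_succ,
    Finset.sum_range_zero]
  push_cast
  ring

end Eval

/-- Whether the expression is the constant `c`. -/
def isConst (v : Sextic) (c : ℕ) : Bool :=
  Nat.beq v.c0 c && Nat.beq v.c1 0 && Nat.beq v.c2 0 && Nat.beq v.c3 0 && Nat.beq v.c4 0 &&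
    Nat.beq v.c5 0

lemma eval_of_isConst {R : Type*} [CommRing R] (x : R) {v : Sextic} {c : ℕ}
    (h : v.isConst c = true) : v.eval x = c := by
  simp only [isConst, Bool.and_eq_true] at h
  obtain ⟨⟨⟨⟨⟨h0, h1⟩, h2⟩, h3⟩, h4⟩, h5⟩ := h
  simp [eval, Nat.eq_of_beq_eq_true h0, Nat.eq_of_beq_eq_true h1, Nat.eq_of_beq_eq_true h2,
    Nat.eq_of_beq_eq_true h3, Nat.eq_of_beq_eq_true h4, Nat.eq_of_beq_eq_true h5]

/-- A computation in `GF(p)[x] / (x ^ 6 - r)` which shows that `x` has order `p ^ 6 - 1`, where `ls`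
is the list of the prime divisors of `p ^ 6 - 1` and `p ^ 6 - 1 < 2 ^ k`. -/
def primitiveCheck (p k : ℕ) (r : Sextic) (ls : List ℕ) : Bool :=
  (pow p r ⟨0, 1, 0, 0, 0, 0⟩ k (p ^ 6 - 1)).isConst 1 &&
    ls.all fun l => (pow p r (axpy p (p - 1) ⟨1, 0, 0, 0, 0, 0⟩
      (pow p r ⟨0, 1, 0, 0, 0, 0⟩ k ((p ^ 6 - 1) / l))) k (p ^ 6 - 1)).isConst 1

lemma eval_X {R : Type*} [CommRing R] (x : R) : eval x ⟨0, 1, 0, 0, 0, 0⟩ = x := by simp [eval]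

/-- `R` is an arbitrary commutative ring because this is also applied in `AdjoinRoot P` before `P`
is known to be irreducible. -/
lemma pow_eq_one_of_primitiveCheck {R : Type*} [CommRing R] {p k : ℕ} (hp : (p : R) = 0)
    {r : Sextic} {ls : List ℕ} (h : primitiveCheck p k r ls = true) (hk : p ^ 6 - 1 < 2 ^ k)
    {x : R} (hx : x ^ 6 = r.eval x) : x ^ (p ^ 6 - 1) = 1 := by
  rw [primitiveCheck, Bool.and_eq_true] at h
  have := eval_of_isConst x h.1
  rwa [eval_pow hp hx _ _ _ hk, eval_X, Nat.cast_one] at this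

/-- That y = x^((p^6 - 1)/l) differs from 1 cannot be read off from coefficients, as the powers of
`x` are not yet known to be independent. Instead the check finds (y - 1)^(p^6 - 1) = 1, which y = 1
would turn into 0 = 1. -/
lemma orderOf_eq_of_primitiveCheck {K : Type*} [Field K] {p k : ℕ} (hp1 : 1 < p)
    (hp : (p : K) = 0) {r : Sextic} {ls : List ℕ} (h : primitiveCheck p k r ls = true)
    (hk : p ^ 6 - 1 < 2 ^ k) (hls : ∀ l, l.Prime → l ∣ p ^ 6 - 1 → l ∈ ls) {x : K}
    (hx : x ^ 6 = r.eval x) : orderOf x = p ^ 6 - 1 := by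
  have hpos : 0 < p ^ 6 - 1 := Nat.sub_pos_of_lt (Nat.one_lt_pow (by norm_num) hp1)
  refine orderOf_eq_of_pow_and_pow_div_prime hpos (pow_eq_one_of_primitiveCheck hp h hk hx) ?_
  intro l hl hdvd h1
  rw [primitiveCheck, Bool.and_eq_true, List.all_eq_true] at h
  have := eval_of_isConst x (h.2 l (hls l hl hdvd))
  rw [eval_pow hp hx _ _ _ hk, eval_axpy hp,
    eval_pow hp hx _ _ _ ((Nat.div_le_self _ _).trans_lt hk), eval_X, h1] at this
  -- The coefficient `p - 1` stands for -1.
  have h0 : ((p - 1 : ℕ) : K) * eval x ⟨1, 0, 0, 0, 0, 0⟩ + 1 = 0 := by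
    rw [Nat.cast_sub hp1.le, hp]
    simp [eval]
  rw [h0, zero_pow hpos.ne', Nat.cast_one] at this
  exact zero_ne_one this

end Sextic

end SexticArithmetic

/-! ### Trace annihilators under the Singer cycle and the Frobenius map. -/

section SingerGeometry

variable {p : ℕ} [Fact p.Prime] {K : Type*} [Field K] [Algebra (ZMod p) K]

/-- The image of `x` lies in the image of `U`. -/
lemma apply_mem_projImage_iff {F V : Type*} [Field F] [AddCommGroup V] [Module F V] (f : V ≃ₗ[F] V)
    (U : Submodule F V) (x : V) : f x ∈ projImage f U ↔ x ∈ U :=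
  f.injective.mem_set_image

lemma apply_mem_projImage_pow_iff {F V : Type*} [Field F] [AddCommGroup V] [Module F V]
    (f : V ≃ₗ[F] V) (n : ℕ) (U : Submodule F V) (x : V) :
    (f ^ n) x ∈ (projImage f ^ n) U ↔ x ∈ U := by
  induction n generalizing U x with
  | zero => rfl
  | succ n ih =>
    rw [pow_succ, pow_succ]
    exact (ih _ _).trans (apply_mem_projImage_iff f U x)

lemma projImage_pow_eq {F V : Type*} [Field F] [AddCommGroup V] [Module F V]
    (f : V ≃ₗ[F] V) (n : ℕ) (U W : Submodule F V) (h : ∀ x, x ∈ U ↔ (f ^ n) x ∈ W) :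
    (projImage f ^ n) U = W := by
  ext y
  obtain ⟨x, rfl⟩ := (f ^ n).surjective y
  rw [apply_mem_projImage_pow_iff, h]

lemma singer_pow_apply (α : Kˣ) (n : ℕ) (x : K) : (singer (ZMod p) α ^ n) x = (α : K) ^ n * x := by
  induction n generalizing x with
  | zero => simp
  | succ n ih =>
    rw [pow_succ, pow_succ, mul_assoc]
    exact ih (α * x)

variable [FiniteDimensional (ZMod p) K]

lemma frob_pow_apply (n : ℕ) (x : K) : (frob (ZMod p) K ^ n) x = x ^ p ^ n := by
  induction n generalizing x with
  | zero => simp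
  | succ n ih =>
    rw [pow_succ, pow_succ', pow_mul]
    refine (ih (x ^ Fintype.card (ZMod p))).trans ?_
    rw [ZMod.card]

/-- The Frobenius map is an automorphism over `ZMod p`, and conjugate elements have the same trace.
-/
lemma trace_pow_card_pow (n : ℕ) (x : K) :
    Algebra.trace (ZMod p) K (x ^ p ^ n) = Algebra.trace (ZMod p) K x := by
  have h := Algebra.trace_eq_of_algEquiv
    (FiniteField.frobeniusAlgEquivOfAlgebraic (ZMod p) K)
  induction n generalizing x with
  | zero => simp
  | succ n ih =>
    rw [pow_succ', pow_mul, ih]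
    have := h x
    rwa [FiniteField.coe_frobeniusAlgEquivOfAlgebraic, ZMod.card] at this

/-- The subspace of the `x` with `Tr (x α ^ s k) = 0` for `k = 0, 1, 2`. -/
noncomputable def traceAnn (α : Kˣ) (s : ℕ → ℕ) : Submodule (ZMod p) K :=
  LinearMap.ker (LinearMap.pi fun k : Fin 3 =>
    Algebra.trace (ZMod p) K ∘ₗ LinearMap.mulRight (ZMod p) ((α : K) ^ s k))

omit [FiniteDimensional (ZMod p) K] in
lemma mem_traceAnn {α : Kˣ} {s : ℕ → ℕ} {x : K} :
    x ∈ traceAnn (p := p) α s ↔ ∀ k < 3, Algebra.trace (ZMod p) K (x * (α : K) ^ s k) = 0 := by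
  rw [traceAnn, LinearMap.mem_ker, funext_iff]
  exact ⟨fun h k hk => h ⟨k, hk⟩, fun h k => h k k.2⟩

lemma three_le_finrank_traceAnn (hK : Module.finrank (ZMod p) K = 6) (α : Kˣ) (s : ℕ → ℕ) :
    3 ≤ Module.finrank (ZMod p) (traceAnn (p := p) α s) := by
  have h := LinearMap.finrank_range_add_finrank_ker (LinearMap.pi fun k : Fin 3 =>
    Algebra.trace (ZMod p) K ∘ₗ LinearMap.mulRight (ZMod p) ((α : K) ^ s k))
  have h2 := Submodule.finrank_le (LinearMap.range (LinearMap.pi fun k : Fin 3 =>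
    Algebra.trace (ZMod p) K ∘ₗ LinearMap.mulRight (ZMod p) ((α : K) ^ s k)))
  rw [Module.finrank_fin_fun] at h2
  rw [traceAnn]
  omega

/-- If no nonzero element of `traceAnn α s` satisfies three further equations, then it has
dimension `3`. -/
lemma finrank_traceAnn (hK : Module.finrank (ZMod p) K = 6) (α : Kˣ) (s t : ℕ → ℕ)
    (h : traceAnn (p := p) α s ⊓ traceAnn α t = ⊥) :
    Module.finrank (ZMod p) (traceAnn (p := p) α s) = 3 := by
  -- Both annihilators have dimension at least 3, and disjoint subspaces of a 6-space leave no room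
  -- for more.
  have h1 := Submodule.finrank_sup_add_finrank_inf_eq (traceAnn (p := p) α s) (traceAnn α t)
  have h2 := Submodule.finrank_le (traceAnn (p := p) α s ⊔ traceAnn α t)
  have h3 := three_le_finrank_traceAnn hK α s
  have h4 := three_le_finrank_traceAnn hK α t
  rw [h, finrank_bot] at h1
  omega

-- Multiplication by α^n is self-adjoint for the trace form. In the exponents it subtracts `n`, so
-- it is the inverse of σ that shifts upwards.
omit [FiniteDimensional (ZMod p) K] in
lemma singer_traceAnn (α : Kˣ) (s : ℕ → ℕ) (n : ℕ) :
    (projImage (singer (ZMod p) α) ^ n) (traceAnn α fun k => s k + n) = traceAnn α s := by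
  refine projImage_pow_eq _ _ _ _ fun x => ?_
  rw [mem_traceAnn, mem_traceAnn, singer_pow_apply]
  refine forall₂_congr fun k _ => ?_
  rw [pow_add, show x * ((α : K) ^ s k * (α : K) ^ n) = (α : K) ^ n * x * (α : K) ^ s k by ring]

/-- The trace is invariant under Frobenius, so Tr(x α^s) = 0 exactly when Tr(x^(p^n) α^(p^n s)) = 0.
-/
lemma frob_traceAnn (α : Kˣ) (s : ℕ → ℕ) (n : ℕ) :
    (projImage (frob (ZMod p) K) ^ n) (traceAnn α s) = traceAnn α fun k => p ^ n * s k := by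
  refine projImage_pow_eq _ _ _ _ fun x => ?_
  rw [mem_traceAnn, mem_traceAnn, frob_pow_apply]
  refine forall₂_congr fun k _ => ?_
  rw [mul_comm (p ^ n), pow_mul, ← mul_pow, trace_pow_card_pow]

section Group

variable (α : Kˣ) (j : ℕ)

lemma singer_sq_mem : projImage (singer (ZMod p) α) ^ 2 ∈ singerFrobGroup (ZMod p) α 2 j :=
  Subgroup.subset_closure (Or.inl rfl)

lemma frob_pow_mem : projImage (frob (ZMod p) K) ^ j ∈ singerFrobGroup (ZMod p) α 2 j :=
  Subgroup.subset_closure (Or.inr rfl)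

variable {α j}

/-- A finite set which the inverse of `σ ^ 2` and `φ ^ j` map to itself is invariant. -/
lemma image_eq_of_mem_singerFrobGroup (O : Set (Submodule (ZMod p) K)) (hO : O.Finite)
    (h1 : ∀ W ∈ O, (projImage (singer (ZMod p) α) ^ 2)⁻¹ W ∈ O)
    (h2 : ∀ W ∈ O, (projImage (frob (ZMod p) K) ^ j) W ∈ O)
    {g : Submodule (ZMod p) K ≃o Submodule (ZMod p) K} (hg : g ∈ singerFrobGroup (ZMod p) α 2 j) :
    ∀ W, g W ∈ O ↔ W ∈ O := by
  have key : ∀ f : Submodule (ZMod p) K ≃o Submodule (ZMod p) K, (∀ W ∈ O, f W ∈ O) →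
      ∀ W, f W ∈ O ↔ W ∈ O := by
    intro f hf W
    refine ⟨fun hW => ?_, hf W⟩
    -- An injective map of a finite set into itself is onto.
    have himg : f '' O = O := Set.eq_of_subset_of_ncard_le (by rintro _ ⟨W, hW, rfl⟩; exact hf W hW)
      (by rw [Set.ncard_image_of_injective _ f.injective]) hO
    rw [← himg] at hW
    obtain ⟨W', hW', h⟩ := hW
    rwa [← f.injective h]
  have hinv : ∀ f : Submodule (ZMod p) K ≃o Submodule (ZMod p) K, (∀ W, f W ∈ O ↔ W ∈ O) →
      ∀ W, f⁻¹ W ∈ O ↔ W ∈ O := by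
    intro f hf W
    rw [← hf (f⁻¹ W)]
    exact iff_of_eq (congrArg (· ∈ O) (f.apply_symm_apply W))
  induction hg using Subgroup.closure_induction with
  | mem f hf =>
    rcases hf with rfl | rfl
    · have := hinv _ (key _ h1)
      rwa [inv_inv] at this
    · exact key _ h2
  | one => exact fun W => Iff.rfl
  | mul f g _ _ hf hg => exact fun W => (hf (g W)).trans (hg W)
  | inv f _ hf => exact hinv f hf

/-- Apply the Frobenius power `b` times, then the inverse of σ² `a` times. -/
lemma traceAnn_mem_orbit (s : ℕ → ℕ) (a b : ℕ) :
    (traceAnn (p := p) α fun k => (p ^ j) ^ b * s k + 2 * a) ∈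
      subspaceOrbit (singerFrobGroup (ZMod p) α 2 j) (traceAnn α s) := by
  induction a with
  | zero =>
    induction b with
    | zero => exact ⟨1, one_mem _, by simp⟩
    | succ b ih =>
      obtain ⟨g, hg, h⟩ := ih
      refine ⟨projImage (frob (ZMod p) K) ^ j * g, mul_mem (frob_pow_mem α j) hg, ?_⟩
      refine (congrArg (⇑(projImage (frob (ZMod p) K) ^ j)) h).trans ?_
      rw [frob_traceAnn]
      congr 1; funext k; ring
  | succ a ih =>
    obtain ⟨g, hg, h⟩ := ih
    refine ⟨(projImage (singer (ZMod p) α) ^ 2)⁻¹ * g, mul_mem (inv_mem (singer_sq_mem α j)) hg, ?_⟩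
    refine (congrArg (⇑(projImage (singer (ZMod p) α) ^ 2)⁻¹) h).trans ?_
    exact (OrderIso.symm_apply_eq _).2 (singer_traceAnn α (fun k => (p ^ j) ^ b * s k + 2 * a) 2).symm

-- The shift by `n` is undone by σ^n, which is injective on subspaces.
omit [FiniteDimensional (ZMod p) K] in
lemma traceAnn_add_congr {s t : ℕ → ℕ} (h : traceAnn (p := p) α s = traceAnn α t) (n : ℕ) :
    traceAnn (p := p) α (fun k => s k + n) = traceAnn α (fun k => t k + n) := by
  apply (projImage (singer (ZMod p) α) ^ n).injective
  rw [singer_traceAnn, singer_traceAnn, h]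

/-- The orbit of a subspace, in terms of a shift `2 A` which fixes the subspace and its conjugates,
and of a power of the Frobenius automorphism which acts on it as a shift. -/
lemma orbit_traceAnn_subset {s : ℕ → ℕ} {A b₀ c : ℕ} (hA : 0 < A)
    (hb₀ : 0 < b₀)
    (h1 : ∀ b < b₀, traceAnn (p := p) α (fun k => (p ^ j) ^ b * s k + 2 * A) =
      traceAnn α fun k => (p ^ j) ^ b * s k)
    (h2 : traceAnn (p := p) α (fun k => (p ^ j) ^ b₀ * s k) = traceAnn α fun k => s k + 2 * c) :
    subspaceOrbit (singerFrobGroup (ZMod p) α 2 j) (traceAnn α s) ⊆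
      (fun x : ℕ × ℕ => traceAnn (p := p) α fun k => (p ^ j) ^ x.2 * s k + 2 * x.1) ''
        (Set.Iio A ×ˢ Set.Iio b₀) := by
  set O := (fun x : ℕ × ℕ => traceAnn (p := p) α fun k => (p ^ j) ^ x.2 * s k + 2 * x.1) ''
        (Set.Iio A ×ˢ Set.Iio b₀) with hO
  have hfin : O.Finite := ((Set.finite_Iio A).prod (Set.finite_Iio b₀)).image _
  -- By `h1` the shift matters only modulo `A`, so every shift may be reduced below `A`.
  have hmem : ∀ b < b₀, ∀ a, (traceAnn (p := p) α fun k => (p ^ j) ^ b * s k + 2 * a) ∈ O := by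
    intro b hb a
    induction a using Nat.strong_induction_on with
    | _ a ih =>
      rcases lt_or_ge a A with ha | ha
      · exact ⟨(a, b), ⟨ha, hb⟩, rfl⟩
      · have := traceAnn_add_congr (h1 b hb) (2 * (a - A))
        have e : (fun k => (p ^ j) ^ b * s k + 2 * A + 2 * (a - A)) =
            fun k => (p ^ j) ^ b * s k + 2 * a := by funext k; omega
        rw [e] at this
        rw [this]
        exact ih _ (by omega)
  have hs1 : ∀ W ∈ O, (projImage (singer (ZMod p) α) ^ 2)⁻¹ W ∈ O := by
    rintro _ ⟨⟨a, b⟩, ⟨-, hb⟩, rfl⟩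
    have : (projImage (singer (ZMod p) α) ^ 2)⁻¹
        (traceAnn (p := p) α fun k => (p ^ j) ^ b * s k + 2 * a) =
        traceAnn (p := p) α fun k => (p ^ j) ^ b * s k + 2 * (a + 1) :=
      (OrderIso.symm_apply_eq _).2
        (singer_traceAnn α (fun k => (p ^ j) ^ b * s k + 2 * a) 2).symm
    exact this ▸ hmem b hb (a + 1)
  have hs2 : ∀ W ∈ O, (projImage (frob (ZMod p) K) ^ j) W ∈ O := by
    rintro _ ⟨⟨a, b⟩, ⟨-, hb⟩, rfl⟩
    simp only
    rw [frob_traceAnn]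
    have e : (fun k => p ^ j * ((p ^ j) ^ b * s k + 2 * a)) =
        fun k => (p ^ j) ^ (b + 1) * s k + 2 * (p ^ j * a) := by funext k; ring
    rw [e]
    -- When the Frobenius power reaches `b₀`, `h2` exchanges it for an even shift, and the index
    -- returns to `b = 0`.
    rcases Nat.lt_or_ge (b + 1) b₀ with hb' | hb'
    · exact hmem _ hb' _
    · obtain rfl : b + 1 = b₀ := le_antisymm hb hb'
      have e' : (fun k => s k + 2 * c + 2 * (p ^ j * a)) =
        fun k => (p ^ j) ^ 0 * s k + 2 * (c + p ^ j * a) := by funext k; ring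
      rw [traceAnn_add_congr h2, e']
      exact hmem 0 hb₀ _
  rintro W ⟨g, hg, rfl⟩
  rw [image_eq_of_mem_singerFrobGroup O hfin hs1 hs2 hg]
  simpa using hmem 0 hb₀ 0

/-- Only this upper bound is used: that the `A * b₀` listed subspaces are distinct never has to be
checked. -/
lemma ncard_orbit_traceAnn_le {s : ℕ → ℕ} {A b₀ c : ℕ} (hA : 0 < A)
    (hb₀ : 0 < b₀)
    (h1 : ∀ b < b₀, traceAnn (p := p) α (fun k => (p ^ j) ^ b * s k + 2 * A) =
      traceAnn α fun k => (p ^ j) ^ b * s k)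
    (h2 : traceAnn (p := p) α (fun k => (p ^ j) ^ b₀ * s k) = traceAnn α fun k => s k + 2 * c) :
    (subspaceOrbit (singerFrobGroup (ZMod p) α 2 j) (traceAnn α s)).ncard ≤ A * b₀ := by
  have hfin : (Set.Iio A ×ˢ Set.Iio b₀).Finite := (Set.finite_Iio A).prod (Set.finite_Iio b₀)
  refine (Set.ncard_le_ncard (orbit_traceAnn_subset hA hb₀ h1 h2) (hfin.image _)).trans ?_
  refine (Set.ncard_image_le hfin).trans ?_
  rw [Set.ncard_prod, ← Nat.card_coe_set_eq, ← Nat.card_coe_set_eq]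
  simp

end Group

end SingerGeometry

/-! ### Point sets as bit masks, and the Boolean checks on them. -/

section Masks

/-- The `n`-th bit of `M`. -/
def bitAt (M n : ℕ) : Bool := Nat.beq (Nat.land 1 (Nat.shiftRight M n)) 1

lemma bitAt_eq_testBit (M n : ℕ) : bitAt M n = M.testBit n := by
  have h : Nat.land 1 (Nat.shiftRight M n) = 1 &&& (M >>> n) := rfl
  rw [bitAt, h, Nat.one_and_eq_mod_two, Nat.testBit, Nat.one_and_eq_mod_two]
  rcases Nat.mod_two_eq_zero_or_one (M >>> n) with h | h <;> rw [h] <;> rfl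

/-- The points of the subspace given by three exponents, as a bit mask. Here `H` is the mask of the
points of trace zero, and `full` is the mask of all the `N` points. -/
def annMask (N H full : ℕ) (s : ℕ → ℕ) : ℕ :=
  Nat.land (Nat.land (Nat.shiftRight H (s 0 % N)) (Nat.shiftRight H (s 1 % N)))
    (Nat.land (Nat.shiftRight H (s 2 % N)) full)

/-- The shift is reduced modulo `N` but the sum with `e` is not, so bits up to `2 N` are consulted;
this is why `H` covers two periods. -/
lemma testBit_annMask (N H : ℕ) (s : ℕ → ℕ) (e : ℕ) :
    (annMask N H (2 ^ N - 1) s).testBit e = true ↔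
      e < N ∧ ∀ k < 3, H.testBit (s k % N + e) = true := by
  have h : annMask N H (2 ^ N - 1) s =
      ((H >>> (s 0 % N)) &&& (H >>> (s 1 % N))) &&& ((H >>> (s 2 % N)) &&& (2 ^ N - 1)) := rfl
  rw [h]
  simp only [Nat.testBit_and, Nat.testBit_shiftRight, Nat.testBit_two_pow_sub_one,
    Bool.and_eq_true, decide_eq_true_eq]
  constructor
  · rintro ⟨⟨h0, h1⟩, h2, h3⟩
    refine ⟨h3, fun k hk => ?_⟩
    interval_cases k <;> assumption
  · rintro ⟨h3, h⟩
    exact ⟨⟨h 0 (by norm_num), h 1 (by norm_num)⟩, h 2 (by norm_num), h3⟩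

/-- The mask with the bits in a list. -/
def maskOfList (l : List ℕ) : ℕ := l.foldr (fun k acc => Nat.lor (Nat.shiftLeft 1 k) acc) 0

lemma testBit_maskOfList (l : List ℕ) (e : ℕ) : (maskOfList l).testBit e = true ↔ e ∈ l := by
  induction l with
  | nil => simp [maskOfList]
  | cons k l ih =>
    have h : maskOfList (k :: l) = (1 <<< k) ||| maskOfList l := rfl
    rw [h, Nat.testBit_or, Bool.or_eq_true, ih, Nat.shiftLeft_eq, one_mul, Nat.testBit_two_pow,
      List.mem_cons, decide_eq_true_eq, eq_comm]

/-- The masks meet the union of the earlier masks and `acc` exactly in `M`, and they are not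
contained in `M`. -/
def sunflowerCheck (M : ℕ) (f : ℕ → ℕ) : List ℕ → ℕ → Bool
  | [], _ => true
  | c :: cs, acc => Nat.beq (Nat.land (f c) acc) M && (!Nat.beq (f c) M &&
      sunflowerCheck M f cs (Nat.lor acc (f c)))

/-- Each mask contains the core `M` and has a bit outside the union of all earlier ones. So one
conjunction per mask replaces pairwise comparisons. -/
lemma sunflowerCheck_spec {M : ℕ} {f : ℕ → ℕ} : ∀ {l : List ℕ} {acc : ℕ},
    sunflowerCheck M f l acc = true →
      (∀ c ∈ l, (∀ e, M.testBit e = true → (f c).testBit e = true) ∧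
        ∃ e, (f c).testBit e = true ∧ acc.testBit e = false) ∧ (l.map f).Nodup
  | [], _, _ => by simp
  | c :: cs, acc, h => by
    rw [sunflowerCheck, Bool.and_eq_true, Bool.and_eq_true, Bool.not_eq_true'] at h
    obtain ⟨h1, h2, h3⟩ := h
    have h1 : f c &&& acc = M := Nat.eq_of_beq_eq_true h1
    have h2 : f c ≠ M := Nat.ne_of_beq_eq_false h2
    obtain ⟨ih, hnd⟩ := sunflowerCheck_spec h3
    refine ⟨?_, ?_⟩
    · intro d hd
      rcases List.mem_cons.1 hd with rfl | hd
      · refine ⟨fun e he => ?_, ?_⟩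
        · rw [← h1, Nat.testBit_and, Bool.and_eq_true] at he
          exact he.1
        -- If every bit of the mask were in `acc`, the mask would equal its conjunction with `acc`,
        -- which is `M`.
        · by_contra hcon
          push Not at hcon
          refine h2 ?_
          rw [← h1]
          refine Nat.eq_of_testBit_eq fun e => ?_
          rw [Nat.testBit_and]
          rcases hb : (f d).testBit e
          · rfl
          · rw [Bool.true_and]
            exact (Bool.eq_true_of_not_eq_false (hcon e hb)).symm
      · refine ⟨(ih d hd).1, ?_⟩
        obtain ⟨e, he, hacc⟩ := (ih d hd).2
        refine ⟨e, he, ?_⟩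
        have : (acc ||| f c).testBit e = false := hacc
        rw [Nat.testBit_or, Bool.or_eq_false_iff] at this
        exact this.1
    · rw [List.map_cons, List.nodup_cons]
      refine ⟨?_, hnd⟩
      rintro hmem
      obtain ⟨d, hd, hdc⟩ := List.mem_map.1 hmem
      obtain ⟨e, he, hacc⟩ := (ih d hd).2
      have : (acc ||| f c).testBit e = false := hacc
      rw [Nat.testBit_or, Bool.or_eq_false_iff, ← hdc, he] at this
      exact absurd this.2 (by decide)

/-- Whether `f` holds on the interval from `lo` of length `2 ^ k`. -/
def allRange (f : ℕ → Bool) : ℕ → ℕ → Bool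
  | 0, lo => f lo
  | k + 1, lo => allRange f k lo && allRange f k (lo + 2 ^ k)

lemma allRange_spec {f : ℕ → Bool} : ∀ {k lo : ℕ}, allRange f k lo = true →
    ∀ d, lo ≤ d → d < lo + 2 ^ k → f d = true
  | 0, lo, h, d, h1, h2 => by
    obtain rfl : d = lo := by rw [pow_zero] at h2; omega
    exact h
  | k + 1, lo, h, d, h1, h2 => by
    rw [allRange, Bool.and_eq_true] at h
    rcases lt_or_ge d (lo + 2 ^ k) with h3 | h3
    · exact allRange_spec h.1 d h1 h3
    · exact allRange_spec h.2 d h3 (by rw [pow_succ] at h2; omega)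

/-- Whether one of the bits `d, m d, m ^ 2 d, …` (modulo `N`) of `D` is set. -/
def anyConj (N m D : ℕ) : ℕ → ℕ → Bool
  | 0, _ => false
  | k + 1, d => bitAt D d || anyConj N m D k (m * d % N)

lemma anyConj_spec {N m D : ℕ} : ∀ {k d : ℕ}, anyConj N m D k (d % N) = true →
    ∃ b, D.testBit (m ^ b * d % N) = true
  | 0, d, h => by simp [anyConj] at h
  | k + 1, d, h => by
    rw [anyConj, Bool.or_eq_true, bitAt_eq_testBit] at h
    rcases h with h | h
    · exact ⟨0, by simpa using h⟩
    · rw [Nat.mul_mod_mod] at h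
      obtain ⟨b, hb⟩ := anyConj_spec h
      exact ⟨b + 1, by rwa [pow_succ, mul_assoc]⟩

end Masks

/-! ### The certificate format and its checks. -/

/-- A certificate for a halving which consists of orbits of subspaces. -/
structure HalvingCert where
  /-- The number of points. -/
  N : ℕ
  /-- The multiplier by which the power of the Frobenius automorphism acts on exponents. -/
  m : ℕ
  /-- The mask of the points of trace zero, for exponents below `2 N`. -/
  H : ℕ
  /-- The mask of all points. -/
  full : ℕ
  /-- The packed exponents of the representatives of the orbits. -/
  reps : ℕ
  /-- For each orbit, a shift and a Frobenius power which bound its length, the shift by which that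
  Frobenius power acts, and three exponents which separate the points of the representative. -/
  orbs : List ((ℕ × ℕ × ℕ) × (ℕ × ℕ × ℕ))
  /-- The points of representatives of the lines, and codes of blocks above them. -/
  lines : List (List ℕ × List ℕ)
  /-- The number of blocks above a line. -/
  lam : ℕ

namespace HalvingCert

variable (C : HalvingCert)

/-- The `k`-th exponent of the `i`-th representative. -/
def rep (i k : ℕ) : ℕ := Nat.shiftRight C.reps (36 * i + 12 * k) % 4096

/-- The exponents of the block with the given code. -/
def block (c k : ℕ) : ℕ := C.m ^ (c / 2048 % 8) * C.rep (c / 16384) k + 2 * (c % 2048)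

/-- The mask of the subspace with the given exponents. -/
def mask (s : ℕ → ℕ) : ℕ := annMask C.N C.H C.full s

/-- The exponents in a triple. -/
def ofTriple (t : ℕ × ℕ × ℕ) : ℕ → ℕ
  | 0 => t.1
  | 1 => t.2.1
  | _ => t.2.2

/-- The dimension of a representative and the length of its orbit. -/
def orbCheck (i : ℕ) (o : (ℕ × ℕ × ℕ) × (ℕ × ℕ × ℕ)) : Bool :=
  Nat.blt 0 o.1.1 && Nat.blt 0 o.1.2.1 &&
    Nat.beq (Nat.land (C.mask (C.rep i)) (C.mask (ofTriple o.2))) 0 &&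
    ((List.range o.1.2.1).all fun b =>
      Nat.beq (C.mask fun k => C.m ^ b * C.rep i k + 2 * o.1.1)
        (C.mask fun k => C.m ^ b * C.rep i k)) &&
    Nat.beq (C.mask fun k => C.m ^ o.1.2.1 * C.rep i k) (C.mask fun k => C.rep i k + 2 * o.1.2.2)

/-- The checks for all orbits, starting with the orbit of number `i`. -/
def orbsCheck : List ((ℕ × ℕ × ℕ) × (ℕ × ℕ × ℕ)) → ℕ → Bool
  | [], _ => true
  | o :: os, i => C.orbCheck i o && orbsCheck os (i + 1)

/-- The upper bound for the number of blocks. -/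
def size : List ((ℕ × ℕ × ℕ) × (ℕ × ℕ × ℕ)) → ℕ
  | [] => 0
  | o :: os => o.1.1 * o.1.2.1 + size os

/-- There are `lam` different blocks above the given points. -/
def lineCheck (L : List ℕ × List ℕ) : Bool :=
  Nat.beq L.2.length C.lam && (L.2.all fun c => Nat.blt (c / 16384) C.orbs.length) &&
    sunflowerCheck (maskOfList L.1) (fun c => C.mask (C.block c)) L.2 (maskOfList L.1)

/-- The differences of points on the lines, where the first point has parity `x`. -/
def diffs (x : ℕ) : List ℕ :=
  C.lines.flatMap fun L => L.1.flatMap fun k =>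
    bif Nat.beq (k % 2) x then L.1.map fun l => (l + C.N - k) % C.N else []

/-- All lines arise from the representatives, up to conjugacy. -/
def coverCheck (x : ℕ) : Bool :=
  allRange (fun d => Nat.beq d 0 || (Nat.ble C.N d ||
    anyConj C.N C.m (maskOfList (C.diffs x)) 6 d)) 12 0

end HalvingCert

/-! ### Soundness: a valid certificate yields a design and a halving. -/

section Soundness

variable {p : ℕ} [Fact p.Prime] {K : Type*} [Field K] [Algebra (ZMod p) K]

/-- Every nonzero element of `K` is a power of `α`, and `α ^ N` is a scalar. -/
structure IsSingerGenerator (p : ℕ) [Fact p.Prime] {K : Type*} [Field K] [Algebra (ZMod p) K]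
    (α : Kˣ) (N : ℕ) : Prop where
  pos : 0 < N
  exists_pow_eq : ∀ x : K, x ≠ 0 → ∃ n : ℕ, x = (α : K) ^ n
  exists_scalar : ∃ c : ZMod p, algebraMap (ZMod p) K c = (α : K) ^ N

namespace IsSingerGenerator

variable {α : Kˣ} {N : ℕ} (hα : IsSingerGenerator p α N)

include hα

/-- As α^N is a nonzero scalar, an exponent matters projectively only modulo `N`; the next three
lemmas are its uses. -/
lemma exists_smul_pow_mod (e : ℕ) : ∃ c : ZMod p, c ≠ 0 ∧ (α : K) ^ e = c • (α : K) ^ (e % N) := by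
  obtain ⟨c, hc⟩ := hα.exists_scalar
  have hc0 : c ≠ 0 := by
    rintro rfl
    rw [map_zero] at hc
    exact pow_ne_zero N α.ne_zero hc.symm
  refine ⟨c ^ (e / N), pow_ne_zero _ hc0, ?_⟩
  rw [Algebra.smul_def, map_pow, hc, ← pow_mul, ← pow_add, Nat.div_add_mod]

lemma pow_mod_mem_iff (W : Submodule (ZMod p) K) (e : ℕ) :
    (α : K) ^ (e % N) ∈ W ↔ (α : K) ^ e ∈ W := by
  obtain ⟨c, hc, h⟩ := hα.exists_smul_pow_mod e
  rw [h, W.smul_mem_iff hc]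

lemma pow_mem_congr (W : Submodule (ZMod p) K) {e e' : ℕ} (h : e % N = e' % N) :
    (α : K) ^ e ∈ W ↔ (α : K) ^ e' ∈ W := by
  rw [← hα.pow_mod_mem_iff, h, hα.pow_mod_mem_iff]

lemma trace_pow_mod (e : ℕ) (x : K) : Algebra.trace (ZMod p) K (x * (α : K) ^ (e % N)) = 0 ↔
    Algebra.trace (ZMod p) K (x * (α : K) ^ e) = 0 := by
  obtain ⟨c, hc, h⟩ := hα.exists_smul_pow_mod e
  rw [h, mul_smul_comm, map_smul, smul_eq_mul, mul_eq_zero, or_iff_right hc]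

lemma traceAnn_mod (s : ℕ → ℕ) :
    traceAnn (p := p) α (fun k => s k % N) = traceAnn α s := by
  ext x
  rw [mem_traceAnn, mem_traceAnn]
  exact forall₂_congr fun k _ => hα.trace_pow_mod (s k) x

/-- A subspace is determined by its projective points, and these are the α^e with `e < N`. -/
lemma submodule_ext {U W : Submodule (ZMod p) K}
    (h : ∀ e < N, (α : K) ^ e ∈ U ↔ (α : K) ^ e ∈ W) : U = W := by
  ext x
  by_cases hx : x = 0
  · simp [hx]
  · obtain ⟨n, rfl⟩ := hα.exists_pow_eq x hx
    rw [← hα.pow_mod_mem_iff, h _ (Nat.mod_lt _ hα.pos), hα.pow_mod_mem_iff]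

end IsSingerGenerator

section Pencil

variable {F V : Type*} [Field F] [AddCommGroup V] [Module F V]

/-- The members of `B` which contain two given vectors. -/
def pencil (B : Set (Submodule F V)) (x y : V) : Set (Submodule F V) := {W ∈ B | x ∈ W ∧ y ∈ W}

/-- `g` itself is the bijection between the two pencils. It is applied to the generators of the
group, for which the action on points is explicit. -/
lemma ncard_pencil_eq (B : Set (Submodule F V)) {x y x' y' : V}
    (g : Submodule F V ≃o Submodule F V) (hB : ∀ W, g W ∈ B ↔ W ∈ B)
    (hx : ∀ W, x' ∈ g W ↔ x ∈ W) (hy : ∀ W, y' ∈ g W ↔ y ∈ W) :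
    (pencil B x' y').ncard = (pencil B x y).ncard := by
  rw [← Set.ncard_image_of_injective (pencil B x y) g.injective]
  congr 1
  ext W
  constructor
  · rintro ⟨h1, h2, h3⟩
    refine ⟨g.symm W, ⟨?_, ?_, ?_⟩, g.apply_symm_apply W⟩
    · rwa [← hB, g.apply_symm_apply]
    · rwa [← hx, g.apply_symm_apply]
    · rwa [← hy, g.apply_symm_apply]
  · rintro ⟨W, ⟨h1, h2, h3⟩, rfl⟩
    exact ⟨(hB W).2 h1, (hx W).2 h2, (hy W).2 h3⟩

lemma isInvariantUnder_iff {G : Subgroup (Submodule F V ≃o Submodule F V)}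
    {B : Set (Submodule F V)} : IsInvariantUnder G B ↔ ∀ g ∈ G, ∀ W, g W ∈ B ↔ W ∈ B := by
  constructor
  · intro h g hg W
    conv_lhs => rw [← h g hg]
    exact g.injective.mem_set_image
  · intro h g hg
    ext W
    constructor
    · rintro ⟨W, hW, rfl⟩
      exact (h g hg W).2 hW
    · intro hW
      refine ⟨g.symm W, ?_, g.apply_symm_apply W⟩
      rwa [← h g hg, g.apply_symm_apply]

/-- The union of a family of orbits is invariant. -/
lemma isInvariantUnder_of_orbits (G : Subgroup (Submodule F V ≃o Submodule F V))
    (S : Set (Submodule F V)) : IsInvariantUnder G {W | ∃ U ∈ S, W ∈ subspaceOrbit G U} := by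
  have key : ∀ g ∈ G, ∀ W, W ∈ {W | ∃ U ∈ S, W ∈ subspaceOrbit G U} →
      g W ∈ {W | ∃ U ∈ S, W ∈ subspaceOrbit G U} := by
    rintro g hg W ⟨U, hU, f, hf, rfl⟩
    exact ⟨U, hU, g * f, mul_mem hg hf, rfl⟩
  rw [isInvariantUnder_iff]
  refine fun g hg W => ⟨fun h => ?_, key g hg W⟩
  have := key g⁻¹ (inv_mem hg) _ h
  rwa [show g⁻¹ (g W) = W from g.symm_apply_apply W] at this

end Pencil

lemma finrank_projImage {F V : Type*} [Field F] [AddCommGroup V] [Module F V] (f : V ≃ₗ[F] V)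
    (n : ℕ) (U : Submodule F V) :
    Module.finrank F ((projImage f ^ n) U : Submodule F V) = Module.finrank F U := by
  induction n generalizing U with
  | zero => rfl
  | succ n ih =>
    rw [pow_succ]
    exact (ih (projImage f U)).trans (LinearEquiv.finrank_map_eq f U)

lemma finrank_apply_of_mem_singerFrobGroup [FiniteDimensional (ZMod p) K] {α : Kˣ} {i j : ℕ}
    {g : Submodule (ZMod p) K ≃o Submodule (ZMod p) K}
    (hg : g ∈ singerFrobGroup (ZMod p) α i j) (U : Submodule (ZMod p) K) :
    Module.finrank (ZMod p) (g U) = Module.finrank (ZMod p) U := by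
  induction hg using Subgroup.closure_induction generalizing U with
  | mem f hf =>
    rcases hf with rfl | rfl
    exacts [finrank_projImage _ _ U, finrank_projImage _ _ U]
  | one => rfl
  | mul f g _ _ hf hg => exact (hf (g U)).trans (hg U)
  | inv f _ hf =>
    rw [← hf (f⁻¹ U)]
    exact congrArg (fun W : Submodule (ZMod p) K => Module.finrank (ZMod p) W)
      (f.apply_symm_apply U)

namespace HalvingCert

variable [FiniteDimensional (ZMod p) K] (C : HalvingCert) (α : Kˣ) (j : ℕ)

/-- The union of the orbits given by the certificate. -/
def blocks : Set (Submodule (ZMod p) K) :=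
  {W | ∃ U ∈ {U | ∃ i < C.orbs.length, U = traceAnn α (C.rep i)},
    W ∈ subspaceOrbit (singerFrobGroup (ZMod p) α 2 j) U}

/-- The data of the certificate describe the trace form of `K` and the group. -/
structure IsFor : Prop where
  gen : IsSingerGenerator p α C.N
  full_eq : C.full = 2 ^ C.N - 1
  trace_eq_zero : ∀ e < 2 * C.N,
    C.H.testBit e = true ↔ Algebra.trace (ZMod p) K ((α : K) ^ e) = 0
  mult : C.m = p ^ j
  odd : p % 2 = 1
  dim : Module.finrank (ZMod p) K = 6
  le : C.N ≤ 4096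
  lam_pos : 0 < C.lam

namespace IsFor

variable {C α j} (h : C.IsFor (p := p) α j)

include h

-- The link between integers and geometry: the mask is the point set of the annihilator.
omit [FiniteDimensional (ZMod p) K] in
lemma testBit_mask (s : ℕ → ℕ) (e : ℕ) : (C.mask s).testBit e = true ↔
    e < C.N ∧ (α : K) ^ e ∈ traceAnn (p := p) α s := by
  rw [mask, h.full_eq, testBit_annMask]
  refine and_congr_right fun he => ?_
  rw [← h.gen.traceAnn_mod, mem_traceAnn]
  refine forall₂_congr fun k _ => ?_
  have := Nat.mod_lt (s k) h.gen.pos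
  rw [h.trace_eq_zero _ (by omega), add_comm, pow_add]

-- Equality of subspaces becomes decidable by comparing two numbers.
omit [FiniteDimensional (ZMod p) K] in
lemma traceAnn_eq_iff (s t : ℕ → ℕ) :
    traceAnn (p := p) α s = traceAnn α t ↔ C.mask s = C.mask t := by
  constructor
  · intro hst
    refine Nat.eq_of_testBit_eq fun e => ?_
    rw [Bool.eq_iff_iff, h.testBit_mask, h.testBit_mask, hst]
  · intro hst
    refine h.gen.submodule_ext fun e he => ?_
    have h1 := h.testBit_mask s e
    rw [hst, h.testBit_mask t e] at h1
    simpa [he] using h1.symm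

omit [FiniteDimensional (ZMod p) K] in
lemma inf_eq_bot_of_land (s t : ℕ → ℕ) (hst : Nat.land (C.mask s) (C.mask t) = 0) :
    traceAnn (p := p) α s ⊓ traceAnn α t = ⊥ := by
  refine h.gen.submodule_ext fun e he => ?_
  rw [Submodule.mem_inf, Submodule.mem_bot]
  refine iff_of_false ?_ (pow_ne_zero _ α.ne_zero)
  rintro ⟨h1, h2⟩
  have h3 : (C.mask s &&& C.mask t).testBit e = true := by
    rw [Nat.testBit_and, (h.testBit_mask s e).2 ⟨he, h1⟩, (h.testBit_mask t e).2 ⟨he, h2⟩]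
    rfl
  rw [show C.mask s &&& C.mask t = 0 from hst, Nat.zero_testBit] at h3
  exact absurd h3 (by decide)

lemma orbCheck_spec {i : ℕ} {o : (ℕ × ℕ × ℕ) × (ℕ × ℕ × ℕ)} (ho : C.orbCheck i o = true) :
    Module.finrank (ZMod p) (traceAnn (p := p) α (C.rep i)) = 3 ∧
      (subspaceOrbit (singerFrobGroup (ZMod p) α 2 j) (traceAnn α (C.rep i))).ncard ≤
        o.1.1 * o.1.2.1 := by
  simp only [orbCheck, Bool.and_eq_true, List.all_eq_true, List.mem_range] at ho
  obtain ⟨⟨⟨⟨h1, h2⟩, h3⟩, h4⟩, h5⟩ := ho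
  refine ⟨finrank_traceAnn h.dim _ _ _ (h.inf_eq_bot_of_land _ _ (Nat.eq_of_beq_eq_true h3)), ?_⟩
  refine ncard_orbit_traceAnn_le (c := o.1.2.2) (Nat.blt_eq ▸ h1) (Nat.blt_eq ▸ h2)
    (fun b hb => ?_) ?_
  · rw [h.traceAnn_eq_iff, ← h.mult]
    exact Nat.eq_of_beq_eq_true (h4 b hb)
  · rw [h.traceAnn_eq_iff, ← h.mult]
    exact Nat.eq_of_beq_eq_true h5

/-- Bounds for the single orbits add up by subadditivity; disjointness of the orbits is not required
for an upper bound. -/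
lemma orbsCheck_spec : ∀ (l : List ((ℕ × ℕ × ℕ) × (ℕ × ℕ × ℕ))) (i : ℕ),
    C.orbsCheck l i = true →
      (∀ k, i ≤ k → k < i + l.length →
        Module.finrank (ZMod p) (traceAnn (p := p) α (C.rep k)) = 3) ∧
      {W | ∃ k, (i ≤ k ∧ k < i + l.length) ∧
        W ∈ subspaceOrbit (singerFrobGroup (ZMod p) α 2 j) (traceAnn α (C.rep k))}.ncard ≤ size l
  | [], i, _ => by
    refine ⟨fun k h1 h2 => by simp at h2; omega, ?_⟩
    rw [size, Nat.le_zero, Set.ncard_eq_zero]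
    ext W
    refine iff_of_false ?_ (Set.notMem_empty W)
    rintro ⟨k, ⟨h1, h2⟩, -⟩
    simp at h2
    omega
  | o :: os, i, hc => by
    rw [orbsCheck, Bool.and_eq_true] at hc
    have h1 := h.orbCheck_spec hc.1
    have h2 := orbsCheck_spec os (i + 1) hc.2
    rw [List.length_cons]
    refine ⟨fun k hk hk' => ?_, ?_⟩
    · rcases hk.eq_or_lt with rfl | hk
      · exact h1.1
      · exact h2.1 k hk (by omega)
    · rw [size]
      refine le_trans ?_ (Nat.add_le_add h1.2 h2.2)
      refine (Set.ncard_le_ncard ?_ (Set.toFinite _)).trans (Set.ncard_union_le _ _)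
      rintro W ⟨k, ⟨hk, hk'⟩, hW⟩
      rcases hk.eq_or_lt with rfl | hk
      · exact Or.inl hW
      · exact Or.inr ⟨k, ⟨hk, by omega⟩, hW⟩

lemma blocks_subset (hc : C.orbsCheck C.orbs 0 = true) :
    C.blocks (p := p) α j ⊆ Grassmannian (ZMod p) K 3 := by
  rintro _ ⟨_, ⟨i, hi, rfl⟩, g, hg, rfl⟩
  exact (finrank_apply_of_mem_singerFrobGroup hg _).trans
    ((h.orbsCheck_spec _ _ hc).1 i (Nat.zero_le _) (by simpa using hi))

lemma ncard_blocks_le (hc : C.orbsCheck C.orbs 0 = true) :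
    (C.blocks (p := p) α j).ncard ≤ size C.orbs := by
  refine (Set.ncard_le_ncard ?_ (Set.toFinite _)).trans (h.orbsCheck_spec _ _ hc).2
  rintro W ⟨_, ⟨i, hi, rfl⟩, hW⟩
  exact ⟨i, ⟨Nat.zero_le _, by simpa using hi⟩, hW⟩

omit h in
lemma mem_blocks_iff {g : Submodule (ZMod p) K ≃o Submodule (ZMod p) K}
    (hg : g ∈ singerFrobGroup (ZMod p) α 2 j) (W : Submodule (ZMod p) K) :
    g W ∈ C.blocks α j ↔ W ∈ C.blocks α j :=
  isInvariantUnder_iff.1 (isInvariantUnder_of_orbits _ _) g hg W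

-- σ² permutes the blocks, so only the class of the pair under simultaneous even shifts matters.
omit h in
lemma ncard_pencil_add (k l t : ℕ) :
    (pencil (C.blocks (p := p) α j) ((α : K) ^ (k + 2 * t)) ((α : K) ^ (l + 2 * t))).ncard =
      (pencil (C.blocks (p := p) α j) ((α : K) ^ k) ((α : K) ^ l)).ncard := by
  have hmem : ∀ (e : ℕ) (W : Submodule (ZMod p) K),
      (α : K) ^ (e + 2) ∈ (projImage (singer (ZMod p) α) ^ 2) W ↔ (α : K) ^ e ∈ W := by
    intro e W
    rw [← apply_mem_projImage_pow_iff (singer (ZMod p) α) 2 W, singer_pow_apply, ← pow_add,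
      add_comm]
  induction t with
  | zero => rfl
  | succ t ih =>
    rw [← ih]
    exact ncard_pencil_eq _ _ (mem_blocks_iff (singer_sq_mem α j))
      (hmem (k + 2 * t)) (hmem (l + 2 * t))

lemma ncard_pencil_mul (k l : ℕ) :
    (pencil (C.blocks (p := p) α j) ((α : K) ^ (C.m * k)) ((α : K) ^ (C.m * l))).ncard =
      (pencil (C.blocks (p := p) α j) ((α : K) ^ k) ((α : K) ^ l)).ncard := by
  have hmem : ∀ (e : ℕ) (W : Submodule (ZMod p) K),
      (α : K) ^ (C.m * e) ∈ (projImage (frob (ZMod p) K) ^ j) W ↔ (α : K) ^ e ∈ W := by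
    intro e W
    rw [← apply_mem_projImage_pow_iff (frob (ZMod p) K) j W, frob_pow_apply, h.mult, ← pow_mul,
      mul_comm]
  exact ncard_pencil_eq _ _ (mem_blocks_iff (frob_pow_mem α j)) (hmem k) (hmem l)

lemma pencil_congr (k : ℕ) {l l' : ℕ} (hl : l % C.N = l' % C.N) :
    pencil (C.blocks (p := p) α j) ((α : K) ^ k) ((α : K) ^ l) =
      pencil (C.blocks (p := p) α j) ((α : K) ^ k) ((α : K) ^ l') := by
  ext W
  exact and_congr_right fun _ => and_congr_right fun _ => h.gen.pow_mem_congr W hl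

/-- Frobenius sends the pair with exponents x, x + d to mx, mx + md. As `m` is odd, mx - x is even,
and a power of σ² moves the first point back to x: the difference has been multiplied by `m` with
the base point kept. -/
lemma ncard_pencil_conj (x d b : ℕ) :
    (pencil (C.blocks (p := p) α j) ((α : K) ^ x) ((α : K) ^ (x + C.m ^ b * d))).ncard =
      (pencil (C.blocks (p := p) α j) ((α : K) ^ x) ((α : K) ^ (x + d))).ncard := by
  induction b with
  | zero => simp
  | succ b ih =>
    have hm : C.m % 2 = 1 := by
      rw [h.mult, Nat.pow_mod, h.odd, one_pow, Nat.mod_eq_of_lt one_lt_two]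
    -- For odd `m`, `C.m / 2` is (m - 1)/2.
    have hmx : C.m * x = x + 2 * (C.m / 2 * x) := by
      conv_lhs => rw [← Nat.div_add_mod C.m 2, hm]
      ring
    rw [← ih, ← h.ncard_pencil_mul x (x + C.m ^ b * d), mul_add, hmx, add_right_comm,
      ncard_pencil_add, pow_succ', mul_assoc]

/-- The listed blocks contain all listed points and have distinct masks, so they are `lam` different
members of the pencil. -/
lemma lineCheck_spec {L : List ℕ × List ℕ} (hL : C.lineCheck L = true) {k l : ℕ}
    (hk : k ∈ L.1) (hl : l ∈ L.1) : k < C.N ∧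
      C.lam ≤ (pencil (C.blocks (p := p) α j) ((α : K) ^ k) ((α : K) ^ l)).ncard := by
  classical
  simp only [lineCheck, Bool.and_eq_true, List.all_eq_true] at hL
  obtain ⟨⟨h1, h2⟩, h3⟩ := hL
  have h1 : L.2.length = C.lam := Nat.eq_of_beq_eq_true h1
  obtain ⟨h4, h5⟩ := sunflowerCheck_spec h3
  have hmem : ∀ c ∈ L.2, ∀ e ∈ L.1, e < C.N ∧
      (α : K) ^ e ∈ traceAnn (p := p) α (C.block c) := fun c hc e he =>
    (h.testBit_mask _ _).1 ((h4 c hc).1 e ((testBit_maskOfList _ _).2 he))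
  refine ⟨?_, ?_⟩
  -- The bound on `k` is read off from any one block, since masks have no bits from `N` on;
  -- positivity of `lam` provides a block.
  · obtain ⟨c, hc⟩ := List.exists_mem_of_length_pos (h1 ▸ h.lam_pos)
    exact (hmem c hc k hk).1
  · have hnd : (L.2.map fun c => traceAnn (p := p) α (C.block c)).Nodup := by
      rw [List.Nodup, List.pairwise_map] at h5 ⊢
      exact h5.imp fun hne heq => hne ((h.traceAnn_eq_iff _ _).1 heq)
    rw [← h1, ← List.length_map (fun c => traceAnn (p := p) α (C.block c)),
      ← List.toFinset_card_of_nodup hnd, ← Set.ncard_coe_finset]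
    refine Set.ncard_le_ncard ?_ (Set.toFinite _)
    intro W hW
    obtain ⟨c, hc, rfl⟩ : ∃ c ∈ L.2, traceAnn (p := p) α (C.block c) = W := by simpa using hW
    -- A code is 2^14 i + 2^11 b + a: orbit number, Frobenius power and half the shift.
    refine ⟨⟨_, ⟨c / 16384, Nat.blt_eq ▸ (h2 c hc), rfl⟩, ?_⟩, (hmem c hc k hk).2,
      (hmem c hc l hl).2⟩
    have := traceAnn_mem_orbit (p := p) (α := α) (j := j) (C.rep (c / 16384)) (c % 2048)
      (c / 2048 % 8)
    rwa [← h.mult] at this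

/-- Some conjugate of `d` is the difference of two points of a representative line whose first point
has parity `x`. Conjugation and an even shift carry the given pair to these points. -/
lemma le_ncard_pencil_of_coverCheck (hl : C.lines.all C.lineCheck = true) {x : ℕ}
    (hcov : C.coverCheck x = true) {d : ℕ} (hd0 : d ≠ 0) (hd : d < C.N) :
    C.lam ≤ (pencil (C.blocks (p := p) α j) ((α : K) ^ x) ((α : K) ^ (x + d))).ncard := by
  -- The check runs over 2^12 = 4096 values of `d`, which includes all `d < N`.
  have h1 := allRange_spec hcov d (Nat.zero_le d) (by have := h.le; omega)
  rw [Bool.or_eq_true, Bool.or_eq_true] at h1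
  rcases h1 with h1 | h1 | h1
  · exact absurd (Nat.eq_of_beq_eq_true h1) hd0
  · exact absurd (Nat.le_of_ble_eq_true h1) (not_le.2 hd)
  rw [← Nat.mod_eq_of_lt hd] at h1
  obtain ⟨b, hb⟩ := anyConj_spec h1
  rw [testBit_maskOfList, diffs, List.mem_flatMap] at hb
  obtain ⟨L, hL, hb⟩ := hb
  obtain ⟨k, hk, hb⟩ := List.mem_flatMap.1 hb
  rcases hkx : Nat.beq (k % 2) x
  · rw [hkx] at hb
    exact absurd hb List.not_mem_nil
  rw [hkx, cond_true, List.mem_map] at hb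
  obtain ⟨l, hl', hb⟩ := hb
  obtain ⟨hkN, hle⟩ := h.lineCheck_spec (List.all_eq_true.1 hl L hL) hk hl'
  refine hle.trans_eq ?_
  have hkx : k = x + 2 * (k / 2) := by
    rw [← Nat.eq_of_beq_eq_true hkx, Nat.mod_add_div]
  have hlk : l % C.N = (x + C.m ^ b * d + 2 * (k / 2)) % C.N := by
    have h2 : (l + C.N - k + k) % C.N = (C.m ^ b * d + k) % C.N := Nat.ModEq.add_right k hb
    rw [Nat.sub_add_cancel (by omega), Nat.add_mod_right] at h2
    rw [h2]
    congr 1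
    omega
  rw [h.pencil_congr k hlk]
  conv_lhs => rw [hkx]
  -- The rewriting by `hkx` also replaced the `k` inside `k / 2`.
  have hk2 : (x + 2 * (k / 2)) / 2 = k / 2 := by omega
  rw [hk2, ncard_pencil_add, h.ncard_pencil_conj]

lemma le_ncard_above (hl : C.lines.all C.lineCheck = true)
    (hcov : (C.coverCheck 0 && C.coverCheck 1) = true) {T : Submodule (ZMod p) K}
    (hT : T ∈ Grassmannian (ZMod p) K 2) :
    C.lam ≤ {U ∈ C.blocks (p := p) α j | T ≤ U}.ncard := by
  rw [Bool.and_eq_true] at hcov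
  let b := Module.finBasisOfFinrankEq (ZMod p) T hT
  obtain ⟨k, hk⟩ := h.gen.exists_pow_eq (b 0 : K) (by simpa using b.ne_zero 0)
  obtain ⟨l, hl'⟩ := h.gen.exists_pow_eq (b 1 : K) (by simpa using b.ne_zero 1)
  have hTU : ∀ U : Submodule (ZMod p) K, T ≤ U ↔ (α : K) ^ k ∈ U ∧ (α : K) ^ l ∈ U := by
    intro U
    rw [← hk, ← hl']
    refine ⟨fun hU => ⟨hU (b 0).2, hU (b 1).2⟩, fun hU x hx => ?_⟩
    have hsum := congrArg (Subtype.val) (b.sum_repr ⟨x, hx⟩)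
    rw [Fin.sum_univ_two] at hsum
    simp only [Submodule.coe_add, Submodule.coe_smul] at hsum
    rw [← hsum]
    exact U.add_mem (U.smul_mem _ hU.1) (U.smul_mem _ hU.2)
  have hset : {U ∈ C.blocks (p := p) α j | T ≤ U} =
      pencil (C.blocks (p := p) α j) ((α : K) ^ k) ((α : K) ^ l) := by
    ext U
    exact and_congr_right fun _ => hTU U
  -- This is `l - k` modulo `N`; the multiple of `N` keeps the natural subtraction from truncating.
  set d := (l + C.N * k - k) % C.N with hd
  have hNk : k ≤ C.N * k := Nat.le_mul_of_pos_left k h.gen.pos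
  have hdk : l % C.N = (k + d) % C.N := by
    rw [hd, Nat.add_mod_mod, ← Nat.add_sub_assoc (by omega), Nat.add_sub_cancel_left,
      Nat.add_mul_mod_self_left]
  -- With difference 0 both basis vectors would represent the same point, and `T` would lie in a
  -- 1-space.
  have hd0 : d ≠ 0 := by
    intro h0
    rw [h0, add_zero] at hdk
    have h1 : T ≤ Submodule.span (ZMod p) {(α : K) ^ k} :=
      (hTU _).2 ⟨Submodule.mem_span_singleton_self _,
        (h.gen.pow_mem_congr _ hdk).2 (Submodule.mem_span_singleton_self _)⟩
    have h2 := Submodule.finrank_mono h1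
    have hT' : Module.finrank (ZMod p) T = 2 := hT
    rw [hT', finrank_span_singleton (pow_ne_zero _ α.ne_zero)] at h2
    omega
  have hcx : C.coverCheck (k % 2) = true := by
    rcases Nat.mod_two_eq_zero_or_one k with h' | h' <;> rw [h']
    exacts [hcov.1, hcov.2]
  rw [hset, h.pencil_congr k hdk]
  have := h.le_ncard_pencil_of_coverCheck hl hcx hd0 (Nat.mod_lt _ h.gen.pos)
  -- An even shift leads from the parity of `k` back to `k`.
  rw [← ncard_pencil_add _ _ (k / 2), add_right_comm, Nat.mod_add_div] at this
  exact this

/-- A valid certificate yields a design and a halving. -/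
lemma design_and_halving (h1 : C.orbsCheck C.orbs 0 = true)
    (h2 : C.lines.all C.lineCheck = true) (h3 : (C.coverCheck 0 && C.coverCheck 1) = true)
    (hsize : size C.orbs * ((p ^ 3 - 1) * (p ^ 3 - p)) ≤ (p ^ 6 - 1) * (p ^ 6 - p) * C.lam)
    (hlam : 2 * C.lam * (p ^ 3 - p ^ 2) = p ^ 6 - p ^ 2) :
    IsSubspaceDesign (ZMod p) K p 2 6 3 C.lam (C.blocks α j) ∧
      IsLargeSet (ZMod p) K p 2 2 3 6
        {C.blocks α j, Grassmannian (ZMod p) K 3 \ C.blocks α j} := by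
  have hp1 : 1 < p := (Fact.out : p.Prime).one_lt
  have hq : Nat.card (ZMod p) = p := Nat.card_zmod p
  refine _root_.design_and_halving p C.lam hq h.dim h.lam_pos hlam _ (h.blocks_subset h1) ?_
  have hP : 0 < (p ^ 2 - 1) * (p ^ 2 - p) := by
    refine Nat.mul_pos (Nat.sub_pos_of_lt (Nat.one_lt_pow (by norm_num) hp1))
      (Nat.sub_pos_of_lt ?_)
    nlinarith
  have hV := ncard_grassmannian_mul (F := ZMod p) (V := K) 2 (by rw [h.dim]; norm_num)
  rw [h.dim, hq, Fin.prod_univ_two, Fin.prod_univ_two] at hV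
  have hU : ∀ U ∈ C.blocks (p := p) α j, {T ∈ Grassmannian (ZMod p) K 2 | T ≤ U}.ncard *
      ((p ^ 2 - 1) * (p ^ 2 - p)) = (p ^ 3 - 1) * (p ^ 3 - p) := by
    intro U hU
    have hU3 : Module.finrank (ZMod p) U = 3 := h.blocks_subset h1 hU
    have := ncard_grassmannian_mul (F := ZMod p) (V := U) 2 (by rw [hU3]; norm_num)
    rw [hU3, hq, Fin.prod_univ_two, Fin.prod_univ_two] at this
    rw [ncard_grassmannian_le]
    simpa using this
  -- The quotient is the number of 2-spaces in a 3-space; the division is exact by `hU`.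
  refine balanced_of_le _ C.lam (((p ^ 3 - 1) * (p ^ 3 - p)) / ((p ^ 2 - 1) * (p ^ 2 - p)))
    (fun U hU' => ?_) (fun T hT => h.le_ncard_above h2 h3 hT) ?_
  · exact (Nat.div_eq_of_eq_mul_left hP (hU U hU').symm).symm
  -- Multiplying by the number of ordered bases of a 2-space clears the denominators and leaves
  -- `hsize`.
  · refine Nat.le_of_mul_le_mul_right ?_ hP
    have hV' : (Grassmannian (ZMod p) K 2).ncard * ((p ^ 2 - 1) * (p ^ 2 - p)) =
        (p ^ 6 - 1) * (p ^ 6 - p) := by simpa using hV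
    rw [mul_assoc, mul_right_comm _ C.lam, hV']
    refine (Nat.mul_le_mul (h.ncard_blocks_le h1) (Nat.div_mul_le_self _ _)).trans hsize

end IsFor

end HalvingCert

end Soundness

/-! ### Traces of powers, roots of the relation, and the dual basis. -/

section TraceTable

namespace Sextic

/-- The `e`-th entry of a table of numbers below `8`. -/
def entry (S e : ℕ) : ℕ := Nat.shiftRight S (3 * e) % 8

/-- The table `S` satisfies the linear recurrence with coefficients `r`, and `H` is the mask of its
zeros on two periods of length `N`. -/
def recurrenceCheck (p : ℕ) (r : Sextic) (N S H d : ℕ) : Bool :=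
  Nat.beq (entry S (d + 6)) ((r.c0 * entry S d + r.c1 * entry S (d + 1) + r.c2 * entry S (d + 2) +
    r.c3 * entry S (d + 3) + r.c4 * entry S (d + 4) + r.c5 * entry S (d + 5)) % p) &&
  (bitAt H d == Nat.beq (entry S d % p) 0 && bitAt H (d + N) == bitAt H d)

/-- The expression `x ^ i` for `i < 6`. -/
def monomial (i : ℕ) : Sextic :=
  ⟨if i = 0 then 1 else 0, if i = 1 then 1 else 0, if i = 2 then 1 else 0,
    if i = 3 then 1 else 0, if i = 4 then 1 else 0, if i = 5 then 1 else 0⟩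

lemma eval_monomial {R : Type*} [CommRing R] (x : R) {i : ℕ} (hi : i < 6) :
    eval x (monomial i) = x ^ i := by
  interval_cases i <;> simp [eval, monomial]

/-- The table `S` starts with the traces of the powers of `x`, and it satisfies the recurrence. -/
def traceCheck (p k : ℕ) (r : Sextic) (N S H : ℕ) : Bool :=
  ((List.range 6).all fun i => (traceSum p k r (monomial i)).isConst (entry S i)) &&
    allRange (fun d => Nat.ble N d || recurrenceCheck p r N S H d) 12 0

end Sextic

open Sextic

variable {p : ℕ} [Fact p.Prime] {K : Type*} [Field K] [Algebra (ZMod p) K]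
  [FiniteDimensional (ZMod p) K]

omit [FiniteDimensional (ZMod p) K] in
lemma natCast_prime_eq_zero : (p : K) = 0 := by
  rw [← map_natCast (algebraMap (ZMod p) K), CharP.cast_eq_zero, map_zero]

/-- The trace is linear and x^(d+6) = r(x) x^d, so the traces obey the recurrence with coefficients
`r`. The six initial values are sums of conjugates. Checking `d < N` settles six further entries,
which are needed when rows of six columns are read. -/
lemma trace_pow_eq_entry (hK : Module.finrank (ZMod p) K = 6) {k : ℕ} {r : Sextic} {N S H : ℕ}
    (hN : N ≤ 4096) (hk : p ^ 5 < 2 ^ k) (hc : traceCheck p k r N S H = true) {x : K}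
    (hx : x ^ 6 = r.eval x) : ∀ e < N + 6, Algebra.trace (ZMod p) K (x ^ e) = entry S e := by
  rw [traceCheck, Bool.and_eq_true, List.all_eq_true] at hc
  have hp := natCast_prime_eq_zero (p := p) (K := K)
  have : Finite K := Module.finite_of_finite (ZMod p)
  intro e
  induction e using Nat.strong_induction_on with
  | _ e ih =>
    intro he
    rcases lt_or_ge e 6 with h6 | h6
    · have h := eval_of_isConst x (hc.1 e (List.mem_range.2 h6))
      rw [eval_traceSum hp hx _ _ hk (Fact.out : p.Prime).pos, eval_monomial x h6] at h
      apply FaithfulSMul.algebraMap_injective (ZMod p) K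
      rw [FiniteField.algebraMap_trace_eq_sum_pow, hK, Nat.card_zmod, h, map_natCast]
    · obtain ⟨d, rfl⟩ := Nat.exists_eq_add_of_le' h6
      have h := allRange_spec hc.2 d (Nat.zero_le d) (by omega)
      rw [Bool.or_eq_true] at h
      replace h := h.resolve_left fun h => by have := Nat.le_of_ble_eq_true h; omega
      rw [recurrenceCheck, Bool.and_eq_true] at h
      rw [Nat.eq_of_beq_eq_true h.1, ZMod.natCast_mod]
      push_cast
      rw [← ih d (by omega) (by omega), ← ih (d + 1) (by omega) (by omega),
        ← ih (d + 2) (by omega) (by omega), ← ih (d + 3) (by omega) (by omega),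
        ← ih (d + 4) (by omega) (by omega), ← ih (d + 5) (by omega) (by omega)]
      simp only [← smul_eq_mul, ← map_smul, ← map_add]
      congr 1
      rw [pow_add, hx]
      simp only [Algebra.smul_def, map_natCast, Sextic.eval]
      ring

/-- The second period of `H` copies the first because α^N is a nonzero scalar, which does not affect
the vanishing of a trace. -/
lemma testBit_eq_true_iff_trace_eq_zero (hK : Module.finrank (ZMod p) K = 6) {k : ℕ} {r : Sextic}
    {N S H : ℕ} (hN : N ≤ 4096) (hk : p ^ 5 < 2 ^ k) (hc : traceCheck p k r N S H = true) {α : Kˣ}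
    (hx : (α : K) ^ 6 = r.eval (α : K)) (hα : IsSingerGenerator p α N) :
    ∀ e < 2 * N, H.testBit e = true ↔ Algebra.trace (ZMod p) K ((α : K) ^ e) = 0 := by
  have htr := trace_pow_eq_entry hK hN hk hc hx
  rw [traceCheck, Bool.and_eq_true] at hc
  have hrec : ∀ d < N, recurrenceCheck p r N S H d = true := by
    intro d hd
    have h := allRange_spec hc.2 d (Nat.zero_le d) (by omega)
    rw [Bool.or_eq_true] at h
    exact h.resolve_left fun h => by have := Nat.le_of_ble_eq_true h; omega
  have hlow : ∀ d < N, H.testBit d = true ↔ Algebra.trace (ZMod p) K ((α : K) ^ d) = 0 := by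
    intro d hd
    have h := hrec d hd
    rw [recurrenceCheck, Bool.and_eq_true, Bool.and_eq_true, beq_iff_eq, bitAt_eq_testBit] at h
    rw [h.2.1, htr d (by omega), ZMod.natCast_eq_zero_iff, Nat.dvd_iff_mod_eq_zero]
    exact ⟨Nat.eq_of_beq_eq_true, fun h => by rw [h]; rfl⟩
  intro e he
  rcases lt_or_ge e N with h | h
  · exact hlow e h
  · obtain ⟨d, rfl⟩ := Nat.exists_eq_add_of_le' h
    have hr := hrec d (by omega)
    rw [recurrenceCheck, Bool.and_eq_true, Bool.and_eq_true, beq_iff_eq, beq_iff_eq,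
      bitAt_eq_testBit, bitAt_eq_testBit] at hr
    rw [hr.2.2, hlow d (by omega)]
    have h1 := hα.trace_pow_mod d 1
    have h2 := hα.trace_pow_mod (d + N) 1
    rw [Nat.add_mod_right] at h2
    simpa using h1.symm.trans h2

/-- An element of order `p ^ 6 - 1` is a generator. -/
lemma isSingerGenerator_of_orderOf (hK : Module.finrank (ZMod p) K = 6) {α : Kˣ} {N : ℕ}
    (hN : N * (p - 1) = p ^ 6 - 1) (hα : orderOf α = p ^ 6 - 1) : IsSingerGenerator p α N := by
  have hp1 : 1 < p := (Fact.out : p.Prime).one_lt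
  have : Finite K := Module.finite_of_finite (ZMod p)
  have hpos : 0 < p ^ 6 - 1 := Nat.sub_pos_of_lt (Nat.one_lt_pow (by norm_num) hp1)
  have hcard : Nat.card Kˣ = p ^ 6 - 1 := by
    rw [Nat.card_units, Module.natCard_eq_pow_finrank (K := ZMod p), hK, Nat.card_zmod]
  refine ⟨Nat.pos_of_ne_zero fun h => by simp [h] at hN; omega, fun x hx => ?_, ?_⟩
  · have htop : Subgroup.zpowers α = ⊤ := by
      apply Subgroup.eq_top_of_card_eq
      rw [Nat.card_zpowers, hα, hcard]
    have hmem : Units.mk0 x hx ∈ Subgroup.zpowers α := htop ▸ Subgroup.mem_top _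
    obtain ⟨n, hn⟩ := (mem_powers_iff_mem_zpowers (x := α)).2 hmem
    exact ⟨n, by simpa using (congrArg Units.val hn).symm⟩
  · have hch : CharP K p := charP_of_injective_algebraMap
      (FaithfulSMul.algebraMap_injective (ZMod p) K) p
    -- From N p = (p^6 - 1) + N, the element α^N is fixed by Frobenius and so lies in the prime
    -- field.
    have h1 : ((α : K) ^ N) ^ p = (α : K) ^ N := by
      have : (α : K) ^ (p ^ 6 - 1) = 1 := by
        rw [← hα]
        have h := congrArg Units.val (pow_orderOf_eq_one α)
        rwa [Units.val_pow_eq_pow_val, Units.val_one] at h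
      obtain ⟨q, hq⟩ : ∃ q, p = q + 1 := ⟨p - 1, by omega⟩
      rw [← pow_mul]
      conv_lhs => rw [hq, mul_add, mul_one, pow_add, show q = p - 1 by omega, hN, this, one_mul]
    rw [← Subfield.mem_bot_iff_pow_eq_self K p, mem_bot_iff_intCast p K] at h1
    obtain ⟨n, hn⟩ := h1
    exact ⟨n, by rw [map_intCast, hn]⟩

/-- A polynomial whose root satisfies the relation `x ^ 6 = r` has a root in `K`. -/
lemma exists_aeval_eq_zero (hK : Module.finrank (ZMod p) K = 6) {k : ℕ} {r : Sextic} {ls : List ℕ}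
    (hc : primitiveCheck p k r ls = true) (hk : p ^ 6 - 1 < 2 ^ k) (P : (ZMod p)[X])
    (hdeg : P.natDegree = 6)
    (hP : ∀ (A : Type) [CommRing A] [Algebra (ZMod p) A] (x : A), aeval x P = 0 →
      x ^ 6 = r.eval x) : ∃ α : Kˣ, aeval (α : K) P = 0 := by
  have hp1 : 1 < p := (Fact.out : p.Prime).one_lt
  have : Finite K := Module.finite_of_finite (ZMod p)
  have hpos : 0 < p ^ 6 - 1 := Nat.sub_pos_of_lt (Nat.one_lt_pow (by norm_num) hp1)
  -- Computing in `AdjoinRoot P`, not known to be a field, shows that `P` divides X^(p^6 - 1) - 1.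
  -- That polynomial divides X^(p^6) - X, which splits in K.
  have hroot := hP (AdjoinRoot P) (AdjoinRoot.root P) (by simp)
  have hp0 : (p : AdjoinRoot P) = 0 := by
    rw [← map_natCast (algebraMap (ZMod p) (AdjoinRoot P)), CharP.cast_eq_zero, map_zero]
  have hone := pow_eq_one_of_primitiveCheck hp0 hc hk hroot
  have hdvd : P ∣ X ^ (p ^ 6 - 1) - 1 := by
    rw [← AdjoinRoot.mk_eq_zero, map_sub, map_pow, AdjoinRoot.mk_X, hone, map_one, sub_self]
  have hdvd' : P.map (algebraMap (ZMod p) K) ∣ X ^ (p ^ 6 - 1) - 1 := by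
    simpa using Polynomial.map_dvd (algebraMap (ZMod p) K) hdvd
  have hcard : Nat.card K = p ^ 6 := by
    rw [Module.natCard_eq_pow_finrank (K := ZMod p), hK, Nat.card_zmod]
  have hsplit := Polynomial.splits_X_pow_nat_card_sub_X (K := K)
  rw [hcard] at hsplit
  have hdvd'' : P.map (algebraMap (ZMod p) K) ∣ X ^ p ^ 6 - X := by
    refine hdvd'.trans ⟨X, ?_⟩
    rw [sub_mul, one_mul, ← pow_succ, Nat.sub_add_cancel (by omega)]
  have hne : (X ^ p ^ 6 - X : K[X]) ≠ 0 :=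
    FiniteField.X_pow_card_sub_X_ne_zero K (Nat.one_lt_pow (by norm_num) hp1)
  obtain ⟨x, hx⟩ := (hsplit.of_dvd hne hdvd'').exists_eval_eq_zero (by
    rw [degree_map, degree_eq_natDegree (by rintro rfl; simp at hdeg), hdeg]
    norm_num)
  have hx0 : x ≠ 0 := by
    rintro rfl
    have := eval_dvd (x := (0 : K)) hdvd'
    rw [hx, zero_dvd_iff] at this
    simp [hpos.ne'] at this
  exact ⟨Units.mk0 x hx0, by rw [Units.val_mk0, aeval_def, eval₂_eq_eval_map, hx]⟩

omit [FiniteDimensional (ZMod p) K] in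
/-- The basis `1, α, …, α ^ 5`. -/
lemma exists_basis_pow (hK : Module.finrank (ZMod p) K = 6) {r : Sextic} {α : Kˣ} {N : ℕ}
    (hx : (α : K) ^ 6 = r.eval (α : K)) (hα : IsSingerGenerator p α N) :
    ∃ b : Module.Basis (Fin 6) (ZMod p) K, ∀ i, b i = (α : K) ^ (i : ℕ) := by
  set W := Submodule.span (ZMod p) (Set.range fun i : Fin 6 => (α : K) ^ (i : ℕ)) with hW
  have hlow : ∀ i < 6, (α : K) ^ i ∈ W := fun i hi => Submodule.subset_span ⟨⟨i, hi⟩, rfl⟩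
  have hsmul : ∀ (n : ℕ) (x : K), x ∈ W → (n : K) * x ∈ W := fun n x hx => by
    rw [← nsmul_eq_mul]
    exact W.smul_of_tower_mem n hx
  -- The relation lowers any exponent to below 6, and powers of α exhaust the nonzero elements; so
  -- six vectors span a 6-space.
  have hpow : ∀ n, (α : K) ^ n ∈ W := by
    intro n
    induction n using Nat.strong_induction_on with
    | _ n ih =>
      rcases lt_or_ge n 6 with h | h
      · exact hlow n h
      · obtain ⟨d, rfl⟩ := Nat.exists_eq_add_of_le' h
        have e : (α : K) ^ (d + 6) = r.c0 * (α : K) ^ d + r.c1 * (α : K) ^ (d + 1) +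
            r.c2 * (α : K) ^ (d + 2) + r.c3 * (α : K) ^ (d + 3) + r.c4 * (α : K) ^ (d + 4) +
            r.c5 * (α : K) ^ (d + 5) := by
          rw [pow_add, hx, Sextic.eval]
          ring
        rw [e]
        exact W.add_mem (W.add_mem (W.add_mem (W.add_mem (W.add_mem (hsmul _ _ (ih _ (by omega)))
          (hsmul _ _ (ih _ (by omega)))) (hsmul _ _ (ih _ (by omega))))
          (hsmul _ _ (ih _ (by omega)))) (hsmul _ _ (ih _ (by omega)))) (hsmul _ _ (ih _ (by omega)))
  have htop : ⊤ ≤ W := by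
    intro x _
    by_cases h0 : x = 0
    · rw [h0]; exact W.zero_mem
    · obtain ⟨n, rfl⟩ := hα.exists_pow_eq x h0
      exact hpow n
  exact ⟨basisOfTopLeSpanOfCardEqFinrank _ htop (by rw [hK, Fintype.card_fin]), fun i => by simp⟩

/-- The basis dual to `1, α, …, α ^ 5` with respect to the trace form. -/
lemma exists_dualBasis_pow (hK : Module.finrank (ZMod p) K = 6) {r : Sextic} {α : Kˣ} {N : ℕ}
    (hx : (α : K) ^ 6 = r.eval (α : K)) (hα : IsSingerGenerator p α N) :
    ∃ β : Module.Basis (Fin 6) (ZMod p) K,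
      (∀ i j : Fin 6, Algebra.trace (ZMod p) K (β i * (α : K) ^ (j : ℕ)) = if i = j then 1 else 0) ∧
      ∀ x i, β.repr x i = Algebra.trace (ZMod p) K (x * (α : K) ^ (i : ℕ)) := by
  obtain ⟨b, hb⟩ := exists_basis_pow hK hx hα
  have hnd := traceForm_nondegenerate (ZMod p) K
  refine ⟨LinearMap.BilinForm.dualBasis _ hnd b, fun i j => ?_, fun x i => ?_⟩
  · have := LinearMap.BilinForm.apply_dualBasis_left hnd b i j
    rw [Algebra.traceForm_apply, hb] at this
    simpa only [eq_comm] using this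
  · have := LinearMap.BilinForm.dualBasis_repr_apply hnd b x i
    rwa [Algebra.traceForm_apply, hb] at this

end TraceTable

/-! ### Transport of large sets to arbitrary 6-spaces. -/

section Transport

/-- An order isomorphism of subspace lattices which preserves dimensions preserves large sets. -/
lemma IsLargeSet.map {F V F' V' : Type*} [Field F] [AddCommGroup V] [Module F V] [Field F']
    [AddCommGroup V'] [Module F' V'] {q N t k v : ℕ} {L : Set (Set (Submodule F V))}
    (hL : IsLargeSet F V q N t k v L) (e : Submodule F V ≃o Submodule F' V')
    (he : ∀ U, Module.finrank F' (e U) = Module.finrank F U) (hF : Nat.card F' = q)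
    (hfin : Module.Finite F' V') (hdim : Module.finrank F' V' = v) :
    IsLargeSet F' V' q N t k v ((fun B => e '' B) '' L) := by
  have hinj : Function.Injective fun B : Set (Submodule F V) => e '' B :=
    Set.image_injective.2 e.injective
  have hgr : ∀ n, e '' Grassmannian F V n = Grassmannian F' V' n := by
    intro n
    ext W
    constructor
    · rintro ⟨U, hU, rfl⟩
      exact (he U).trans hU
    · intro hW
      refine ⟨e.symm W, ?_, e.apply_symm_apply W⟩
      have := he (e.symm W)
      rw [e.apply_symm_apply] at this
      exact this.symm.trans hW
  refine ⟨?_, ?_, ?_, ?_, ?_⟩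
  · rw [hinj.encard_image, hL.card]
  · rintro _ ⟨B, hB, rfl⟩
    exact (hL.nonempty B hB).image e
  · rintro _ ⟨B, hB, rfl⟩ _ ⟨B', hB', rfl⟩ hne
    exact (Set.disjoint_image_iff e.injective).2 (hL.disjoint hB hB' fun h => hne (by rw [h]))
  · rw [Set.sUnion_image, ← Set.image_iUnion₂, ← Set.sUnion_eq_biUnion, hL.cover, hgr]
  · obtain ⟨lam, hlam⟩ := hL.designs
    refine ⟨lam, ?_⟩
    rintro _ ⟨B, hB, rfl⟩
    have hD := hlam B hB
    refine ⟨hF, hfin, hdim, ?_, fun T hT => ?_⟩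
    · rw [← hgr]
      exact Set.image_mono hD.blocks
    · rw [← hgr] at hT
      obtain ⟨T, hT, rfl⟩ := hT
      rw [← hD.balanced T hT, ← e.injective.encard_image]
      congr 1
      ext W
      constructor
      · rintro ⟨⟨U, hU, rfl⟩, hTU⟩
        exact ⟨U, ⟨hU, e.le_iff_le.1 hTU⟩, rfl⟩
      · rintro ⟨U, ⟨hU, hTU⟩, rfl⟩
        exact ⟨⟨U, hU, rfl⟩, e.le_iff_le.2 hTU⟩

/-- Vector spaces of equal dimension over finite fields of equal prime order have isomorphic
subspace lattices. -/
lemma exists_orderIso_submodule {p : ℕ} [Fact p.Prime] {F V W : Type*} [Field F]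
    [AddCommGroup V] [Module F V] [AddCommGroup W] [Module (ZMod p) W] [FiniteDimensional F V]
    [FiniteDimensional (ZMod p) W] (hF : Nat.card F = p)
    (hVW : Module.finrank (ZMod p) W = Module.finrank F V) :
    ∃ e : Submodule (ZMod p) W ≃o Submodule F V,
      ∀ U, Module.finrank F (e U) = Module.finrank (ZMod p) U := by
  have hp1 : 1 < p := (Fact.out : p.Prime).one_lt
  have : Finite F := Nat.finite_of_card_ne_zero (by omega)
  have := Fintype.ofFinite F
  have hF' : Fintype.card F = p := by rw [← Nat.card_eq_fintype_card, hF]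
  let σ : ZMod p ≃+* F := ZMod.ringEquivOfPrime F Fact.out hF'
  -- A field of prime order is `ZMod p` up to isomorphism, so `V` keeps its subspaces as sets when
  -- the scalars are renamed.
  let : Module (ZMod p) V := Module.compHom V σ.toRingHom
  have hsmul : ∀ (c : ZMod p) (x : V), c • x = σ c • x := fun _ _ => rfl
  have : Finite V := Module.finite_of_finite F
  have : FiniteDimensional (ZMod p) V := Module.Finite.of_finite
  have hcard : Module.finrank (ZMod p) V = Module.finrank F V := by
    have h1 := Module.natCard_eq_pow_finrank (K := ZMod p) (V := V)
    rw [Module.natCard_eq_pow_finrank (K := F) (V := V), hF, Nat.card_zmod] at h1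
    exact (Nat.pow_right_injective hp1 h1).symm
  let f : W ≃ₗ[ZMod p] V := LinearEquiv.ofFinrankEq W V (hVW.trans hcard.symm)
  let e₁ : Submodule (ZMod p) V ≃o Submodule F V :=
    { toFun := fun U => { U with
        smul_mem' := fun c x hx => by
          have := U.smul_mem (σ.symm c) hx
          rwa [hsmul, σ.apply_symm_apply] at this }
      invFun := fun U => { U with smul_mem' := fun c x hx => U.smul_mem (σ c) hx }
      left_inv := fun U => rfl
      right_inv := fun U => rfl
      map_rel_iff' := Iff.rfl }
  refine ⟨(Submodule.orderIsoMapComap f).trans e₁, fun U => ?_⟩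
  have h1 : Module.finrank (ZMod p) (Submodule.orderIsoMapComap f U : Submodule (ZMod p) V) =
      Module.finrank (ZMod p) U := LinearEquiv.finrank_map_eq f U
  rw [← h1]
  -- The underlying sets agree and both fields have p elements, so cardinality determines the
  -- dimension on either side.
  have h2 : ∀ U : Submodule (ZMod p) V, Nat.card (e₁ U) = Nat.card U := fun U => rfl
  have h3 := h2 (Submodule.orderIsoMapComap f U)
  rw [Module.natCard_eq_pow_finrank (K := F) (V := e₁ (Submodule.orderIsoMapComap f U)),
    Module.natCard_eq_pow_finrank (K := ZMod p)
      (V := (Submodule.orderIsoMapComap f U : Submodule (ZMod p) V)), hF, Nat.card_zmod] at h3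
  exact Nat.pow_right_injective hp1 h3

end Transport

/-! ### The encoded matrices for q = 5. -/

section CodedSubspaces

variable {K : Type*} [Field K]

/-- A subspace which is given by three equations is spanned by three of its vectors, if these are
dual to three functionals which separate the points of the subspace. -/
lemma span_eq_traceAnn {p : ℕ} [Fact p.Prime] [Algebra (ZMod p) K] {α : Kˣ} {s t : ℕ → ℕ}
    (hst : traceAnn (p := p) α s ⊓ traceAnn α t = ⊥) {v₀ v₁ v₂ : K}
    (h₀ : v₀ ∈ traceAnn (p := p) α s) (h₁ : v₁ ∈ traceAnn (p := p) α s)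
    (h₂ : v₂ ∈ traceAnn (p := p) α s)
    (h : ∀ k < 3, Algebra.trace (ZMod p) K (v₀ * (α : K) ^ t k) = (if k = 0 then 1 else 0) ∧
      Algebra.trace (ZMod p) K (v₁ * (α : K) ^ t k) = (if k = 1 then 1 else 0) ∧
      Algebra.trace (ZMod p) K (v₂ * (α : K) ^ t k) = if k = 2 then 1 else 0) :
    Submodule.span (ZMod p) {v₀, v₁, v₂} = traceAnn α s := by
  apply le_antisymm
  · rw [Submodule.span_le]
    rintro x (rfl | rfl | rfl) <;> assumption
  · intro x hx
    set f : ℕ → ZMod p := fun k => Algebra.trace (ZMod p) K (x * (α : K) ^ t k) with hf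
    -- Subtracting the combination with the same three functional values leaves a vector killed by
    -- all six functionals.
    have hy : x - (f 0 • v₀ + f 1 • v₁ + f 2 • v₂) ∈ traceAnn (p := p) α s ⊓ traceAnn α t := by
      refine ⟨sub_mem hx (add_mem (add_mem (Submodule.smul_mem _ _ h₀) (Submodule.smul_mem _ _ h₁))
        (Submodule.smul_mem _ _ h₂)), ?_⟩
      refine mem_traceAnn.2 fun k hk => ?_
      obtain ⟨e₀, e₁, e₂⟩ := h k hk
      rw [sub_mul, add_mul, add_mul, smul_mul_assoc, smul_mul_assoc, smul_mul_assoc, map_sub,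
        map_add, map_add, map_smul, map_smul, map_smul, e₀, e₁, e₂]
      interval_cases k <;> simp [hf]
    rw [hst, Submodule.mem_bot, sub_eq_zero] at hy
    rw [hy]
    refine add_mem (add_mem (Submodule.smul_mem _ _ ?_) (Submodule.smul_mem _ _ ?_))
      (Submodule.smul_mem _ _ ?_) <;> exact Submodule.subset_span (by simp)

variable [Algebra (ZMod 5) K]

/-- The digit in column `j` of the row encoded by `r`. -/
def digit (r j : ℕ) : ℕ := r / 5 ^ (5 - j) % 5

lemma repr_codedVector (β : Module.Basis (Fin 6) (ZMod 5) K) (r : ℕ) (i : Fin 6) :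
    β.repr (codedVector β r) i = (digit r i : ZMod 5) := by
  rw [codedVector, Module.Basis.repr_sum_self]
  rfl

namespace HalvingCert

/-- The vector with the code `r` is a multiple of a power of the generator which belongs to the
`i`-th representative, and its entries in the columns `t` are as given. -/
def rowCheck (C : HalvingCert) (S i r x : ℕ) (t d : ℕ × ℕ × ℕ) : Bool :=
  ((List.range 6).all fun j => Nat.beq (digit r j) (x % 8 * Sextic.entry S (x / 8 + j) % 5)) &&
    bitAt (C.mask (C.rep i)) (x / 8) && Nat.beq (digit r t.1) d.1 &&
    Nat.beq (digit r t.2.1) d.2.1 && Nat.beq (digit r t.2.2) d.2.2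

/-- The `i`-th representative is the subspace encoded by the triple `t`. -/
def codedCheckAt (C : HalvingCert) (S i : ℕ) (t x : ℕ × ℕ × ℕ) (o : ℕ × ℕ × ℕ) : Bool :=
  (Nat.blt o.1 6 && Nat.blt o.2.1 6 && Nat.blt o.2.2 6) &&
    (Nat.beq (Nat.land (C.mask (C.rep i)) (C.mask (ofTriple o))) 0 &&
    (C.rowCheck S i t.1 x.1 o (1, 0, 0) &&
      (C.rowCheck S i t.2.1 x.2.1 o (0, 1, 0) && C.rowCheck S i t.2.2 x.2.2 o (0, 0, 1))))

/-- The representatives are the subspaces encoded by a list of triples. -/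
def codedCheck (C : HalvingCert) (S : ℕ) : List (ℕ × ℕ × ℕ) → List (ℕ × ℕ × ℕ) →
    List ((ℕ × ℕ × ℕ) × (ℕ × ℕ × ℕ)) → ℕ → Bool
  | [], _, _, _ => true
  | t :: ts, x :: xs, o :: os, i => C.codedCheckAt S i t x o.2 && codedCheck C S ts xs os (i + 1)
  | _ :: _, _, _, _ => false

namespace IsFor

variable {C : HalvingCert} {α : Kˣ} {j : ℕ}
  (h : C.IsFor (p := 5) α j)
  {β : Module.Basis (Fin 6) (ZMod 5) K}
  (hβ : ∀ x i, β.repr x i = Algebra.trace (ZMod 5) K (x * (α : K) ^ (i : ℕ)))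
  {S : ℕ} (hS : ∀ e < C.N + 6, Algebra.trace (ZMod 5) K ((α : K) ^ e) = Sextic.entry S e)

-- Digits are coordinates in the dual basis, hence traces against powers of α.
include hβ in
lemma trace_codedVector (r : ℕ) {i : ℕ} (hi : i < 6) :
    Algebra.trace (ZMod 5) K (codedVector β r * (α : K) ^ i) = digit r i := by
  rw [← repr_codedVector β r ⟨i, hi⟩, hβ]

include h hβ hS

/-- The number `x` is 8e + c, and the row of c α^e has entries c·Tr(α^(e+j)). Agreement in all six
columns identifies the encoded vector with c α^e, whose membership is one bit of the mask. -/
lemma rowCheck_spec {i r x : ℕ} {t d : ℕ × ℕ × ℕ} (hc : C.rowCheck S i r x t d = true)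
    (h0 : t.1 < 6) (h1 : t.2.1 < 6) (h2 : t.2.2 < 6) :
    codedVector β r ∈ traceAnn (p := 5) α (C.rep i) ∧
      Algebra.trace (ZMod 5) K (codedVector β r * (α : K) ^ t.1) = d.1 ∧
      Algebra.trace (ZMod 5) K (codedVector β r * (α : K) ^ t.2.1) = d.2.1 ∧
      Algebra.trace (ZMod 5) K (codedVector β r * (α : K) ^ t.2.2) = d.2.2 := by
  simp only [rowCheck, Bool.and_eq_true, List.all_eq_true, List.mem_range] at hc
  obtain ⟨⟨⟨⟨hrow, hmask⟩, e0⟩, e1⟩, e2⟩ := hc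
  rw [bitAt_eq_testBit, h.testBit_mask] at hmask
  have hv : codedVector β r = ((x % 8 : ℕ) : ZMod 5) • (α : K) ^ (x / 8) := by
    refine β.ext_elem fun k => ?_
    rw [repr_codedVector, Nat.eq_of_beq_eq_true (hrow k k.2), ZMod.natCast_mod, map_smul,
      Finsupp.smul_apply, hβ, ← pow_add, hS _ (by have := k.2; have := hmask.1; omega),
      Nat.cast_mul, smul_eq_mul]
  refine ⟨?_, ?_, ?_, ?_⟩
  · rw [hv]
    exact Submodule.smul_mem _ _ hmask.2
  · rw [trace_codedVector hβ r h0, Nat.eq_of_beq_eq_true e0]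
  · rw [trace_codedVector hβ r h1, Nat.eq_of_beq_eq_true e1]
  · rw [trace_codedVector hβ r h2, Nat.eq_of_beq_eq_true e2]

/-- The columns `o` are pivots of the matrix: its rows restrict there to the identity, so they are
dual to the functionals Tr(· α^o). -/
lemma codedCheckAt_spec {i : ℕ} {t x o : ℕ × ℕ × ℕ} (hc : C.codedCheckAt S i t x o = true) :
    codedSubspace β t = traceAnn α (C.rep i) := by
  simp only [codedCheckAt, Bool.and_eq_true, Nat.blt_eq] at hc
  obtain ⟨⟨⟨h0, h1⟩, h2⟩, hland, r0, r1, r2⟩ := hc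
  have s0 := h.rowCheck_spec hβ hS r0 h0 h1 h2
  have s1 := h.rowCheck_spec hβ hS r1 h0 h1 h2
  have s2 := h.rowCheck_spec hβ hS r2 h0 h1 h2
  refine span_eq_traceAnn (h.inf_eq_bot_of_land _ _ (Nat.eq_of_beq_eq_true hland))
    s0.1 s1.1 s2.1 fun k hk => ?_
  interval_cases k
  · exact ⟨by simpa [ofTriple] using s0.2.1, by simpa [ofTriple] using s1.2.1, by simpa [ofTriple] using s2.2.1⟩
  · exact ⟨by simpa [ofTriple] using s0.2.2.1, by simpa [ofTriple] using s1.2.2.1, by simpa [ofTriple] using s2.2.2.1⟩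
  · exact ⟨by simpa [ofTriple] using s0.2.2.2, by simpa [ofTriple] using s1.2.2.2, by simpa [ofTriple] using s2.2.2.2⟩

lemma codedCheck_spec : ∀ (ts xs : List (ℕ × ℕ × ℕ)) (os : List ((ℕ × ℕ × ℕ) × (ℕ × ℕ × ℕ)))
    (i : ℕ), C.codedCheck S ts xs os i = true →
    ts.map (codedSubspace β) = (List.range' i ts.length).map fun k => traceAnn α (C.rep k)
  | [], _, _, _, _ => rfl
  | t :: ts, x :: xs, o :: os, i, hc => by
    rw [codedCheck, Bool.and_eq_true] at hc
    rw [List.map_cons, List.length_cons, List.range'_succ, List.map_cons,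
      h.codedCheckAt_spec hβ hS hc.1, codedCheck_spec ts xs os (i + 1) hc.2]
  | _ :: _, [], _, _, hc => by simp [codedCheck] at hc
  | _ :: _, _ :: _, [], _, hc => by simp [codedCheck] at hc

/-- Equal lengths are needed because `codedCheck` stops with the triples and would ignore surplus
orbits. -/
lemma selectedBlocks_eq [FiniteDimensional (ZMod 5) K] {xs : List (ℕ × ℕ × ℕ)}
    (hc : C.codedCheck S orbitReps5 xs C.orbs 0 = true)
    (hlen : orbitReps5.length = C.orbs.length) :
    selectedBlocks5 (singerFrobGroup (ZMod 5) α 2 j) β = C.blocks α j := by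
  have hlist := h.codedCheck_spec hβ hS _ _ _ _ hc
  have hmem : ∀ U : Submodule (ZMod 5) K, (∃ t ∈ orbitReps5, codedSubspace β t = U) ↔
      ∃ i < C.orbs.length, U = traceAnn α (C.rep i) := by
    intro U
    rw [← List.mem_map, hlist, List.mem_map, hlen]
    simp [List.mem_range'_1, eq_comm]
  ext W
  rw [selectedBlocks5, Set.mem_iUnion₂]
  constructor
  · rintro ⟨t, ht, hW⟩
    exact ⟨_, (hmem _).1 ⟨t, ht, rfl⟩, hW⟩
  · rintro ⟨U, hU, hW⟩
    obtain ⟨t, ht, rfl⟩ := (hmem U).2 hU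
    exact ⟨t, ht, hW⟩

end IsFor

end HalvingCert

end CodedSubspaces

/-! ### The certificate data. -/

/-- The trace zero points for `q = 5`. -/
def traceZero5 : ℕ :=
  0x882408e00000020204c000900092000942e802100010000b044020804100848041422000800401240000820e4899510003400010040052880815000420108002082c003c00201208040200b00800c24304c0242128084a04e00052882000303218190012008020024200341018400084041a8006844a99332328000580414104100c152fa0020808004100802044052001840d8000081b08021458c82044000e17488840c9314c02182a11a620180042018001040980086002030108041a800000000180028114004004004210000860200828000808280001018738915804a0081b0458bb110050100001000c20001815000811a37454221204e110484004052054010a200006044201a482000a04405040ac28a0009048150001e0460028314407022080080040204524001422445010621090001e1980c0004010848512220018228312a20201a408820021000a02065a8c400205414016102202020800a11811e22030448a8280800204500025a00920d6888248000802502246400180c004871005010c0ac00020b0224c600029201800248028640040109022002492010720000d001a04c0020100c19808007000813800b000148428c6000204420442420206501000203808008152238228130c40214c001000025a11004002120020640010a390800438a209023800000080813000240024800250ba008400040002c1100820104021201050880020010049000020839226544000d00004010014a20205400108042000820b000f000804820100802c02003090c13009084a021281380014a208000c0c860640048020080090800d04061000210106a001a112a64cc8ca0001601050410403054be8008202001040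200811014800610360000206c2008516320811000385d22210324c5300860a84698806001080600041026002180080c0420106a0000000006000a04500100100108400021808020a0002020a00004061ce245601280206c1162ec4401404000040030800060540020468dd150884813844121001014815004288000181108069208002811014102b0a280024120540007811800a0c5101c08820020010081149000508911404188424000786603000100421214488800608a0c4a8808069022080084002808196a310008150500584088080820028460478880c1122a0a020008114000968024835a22092000200940891900060300121c401404302b000082c089318000a48060009200a1900100424088009248041c8000340068130008040306602001c00204e002c0005210a31800081108110908081940400080e0200205488e08a04c310085300040000968440100084800819000428e420010e2

/-- The representatives of the orbits of blocks for `q = 5`. -/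
def orbitExponents5 : ℕ :=
  0xdb0d205214c1050a41600fa07916414d11a1260af08039b2051e71d017304d04703400321b1fd1471220d200509f06d04413e1310231870920593f40de09b2a92090d717d1640b61890a705312a0f807c09d09003111b08e01f1ad0ee02b2942870d214a0bb0b92c52480041ec1bf04e1411370d50f90a303e0d60a20351db1c017328818209e0e70480070770390102981080fa10a0bd04e1120fd0791380a50173b02a11bd1dc0790440a305403f0d203e03d1f11cb12b2ea1ed1003841690ca1250940320f40ab06d3821ec05432f05703d14013a04b1720ca0c807105900216f1421331280f80d912e0a108822619a0b22c82ae1a51b31981302962270e21781740ba2ce20917104700d0010db0a507f34709a05a2ff2fe0781e80740231170ca04912a0a003a3dc27e26e17f1610dd06500d0032081930e51c216f11c3ef30d0c914a0d90722392170f61591371183aa3690fd1101060071e016d0400f80f309c29f2502390cd0a30930700550542030810311010d10520b80a30690bd0b303918a15b0aa4231b51351f91d30cb0f508f00e1100d603816d10c0f62280c706610b0d70561f403902a0e60200141f010e00820918207a0a60280011580d407a14604e04809404701616b15e13819e1120711180f108b2490c20750a308602512903f0370f90bb0a61e217312624a2280e514b0a502a0f60e60a30840220151b81630e027b22a0990860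7700218a0fd08415d1570e22701020e42b719411f06305f0531c01b30001090290010c804501811909b01d

/-- The orbit lengths and pivots for `q = 5`. -/
def orbitData5 : List ((ℕ × ℕ × ℕ) × (ℕ × ℕ × ℕ)) :=
  -- The shift 2·1953 = N is by a scalar, hence trivial. The first representative is already fixed
  -- by the shift 2·63 = (5^6 - 1)/(5^3 - 1), so it is a GF(125)-subspace.
  [((63, 1, 58), (0, 1, 2)), ((1953, 1, 7), (0, 1, 3)), ((1953, 2, 1197), (0, 2, 3)), ((1953, 2,
  660), (1, 2, 3)), ((1953, 2, 1779), (0, 1, 2)), ((1953, 2, 1287), (0, 1, 2)), ((1953, 2, 1629),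
  (0, 1, 2)), ((1953, 2, 1443), (0, 1, 3)), ((1953, 2, 393), (0, 1, 2)), ((1953, 2, 24), (0, 1,
  3)), ((1953, 2, 366), (0, 1, 3)), ((1953, 2, 342), (0, 1, 2)), ((1953, 2, 825), (0, 1, 3)),
  ((1953, 2, 1434), (0, 1, 3)), ((1953, 3, 1643), (0, 1, 2)), ((1953, 3, 713), (0, 1, 2)), ((1953,
  3, 1705), (0, 1, 2)), ((1953, 3, 1798), (0, 1, 2)), ((1953, 3, 0), (0, 1, 2)), ((1953, 3, 341),
  (0, 1, 2)), ((1953, 3, 1705), (0, 1, 2)), ((1953, 3, 1550), (0, 1, 2)), ((1953, 3, 899), (0, 2,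
  3)), ((1953, 3, 124), (0, 1, 3)), ((1953, 3, 1364), (0, 1, 2)), ((1953, 3, 806), (0, 1, 2)),
  ((1953, 3, 651), (0, 1, 2)), ((1953, 3, 527), (0, 2, 3)), ((1953, 6, 0), (0, 1, 3)), ((1953, 6,
  0), (0, 1, 2)), ((1953, 6, 0), (0, 1, 2)), ((1953, 6, 0), (0, 1, 2)), ((1953, 6, 0), (0, 1, 2)),
  ((1953, 6, 0), (0, 1, 2)), ((1953, 6, 0), (0, 1, 2)), ((1953, 6, 0), (0, 1, 2)), ((1953, 6, 0),
  (0, 1, 3)), ((1953, 6, 0), (0, 1, 2)), ((1953, 6, 0), (0, 1, 2)), ((1953, 6, 0), (0, 1, 2)),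
  ((1953, 6, 0), (0, 1, 2)), ((1953, 6, 0), (0, 1, 2)), ((1953, 6, 0), (0, 1, 2)), ((1953, 6, 0),
  (0, 2, 3)), ((1953, 6, 0), (0, 1, 3)), ((1953, 6, 0), (0, 1, 2)), ((1953, 6, 0), (0, 2, 3)),
  ((1953, 6, 0), (0, 1, 2)), ((1953, 6, 0), (0, 1, 2)), ((1953, 6, 0), (0, 1, 2)), ((1953, 6, 0),
  (0, 1, 2)), ((1953, 6, 0), (0, 1, 2)), ((1953, 6, 0), (0, 1, 3)), ((1953, 6, 0), (0, 1, 2)),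
  ((1953, 6, 0), (0, 1, 2)), ((1953, 6, 0), (0, 1, 2)), ((1953, 6, 0), (0, 1, 3)), ((1953, 6, 0),
  (0, 1, 5)), ((1953, 6, 0), (0, 1, 3)), ((1953, 6, 0), (0, 1, 2)), ((1953, 6, 0), (0, 1, 2)),
  ((1953, 6, 0), (0, 1, 2)), ((1953, 6, 0), (0, 1, 3)), ((1953, 6, 0), (0, 1, 2)), ((1953, 6, 0),
  (0, 1, 2)), ((1953, 6, 0), (0, 1, 2)), ((1953, 6, 0), (0, 2, 3)), ((1953, 6, 0), (0, 1, 2)),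
  ((1953, 6, 0), (0, 1, 2)), ((1953, 6, 0), (0, 2, 3)), ((1953, 6, 0), (0, 1, 3)), ((1953, 6, 0),
  (0, 1, 2)), ((1953, 6, 0), (0, 1, 2)), ((1953, 6, 0), (0, 1, 2)), ((1953, 6, 0), (0, 1, 2)),
  ((1953, 6, 0), (0, 1, 2)), ((1953, 6, 0), (0, 1, 4)), ((1953, 6, 0), (0, 1, 2)), ((1953, 6, 0),
  (0, 1, 3)), ((1953, 6, 0), (0, 1, 3)), ((1953, 6, 0), (0, 1, 2)), ((1953, 6, 0), (0, 1, 2)),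
  ((1953, 6, 0), (0, 1, 4)), ((1953, 6, 0), (0, 1, 4)), ((1953, 6, 0), (0, 1, 3)), ((1953, 6, 0),
  (0, 1, 2)), ((1953, 6, 0), (0, 1, 2)), ((1953, 6, 0), (0, 1, 2)), ((1953, 6, 0), (0, 1, 2)),
  ((1953, 6, 0), (0, 1, 2)), ((1953, 6, 0), (0, 1, 4)), ((1953, 6, 0), (0, 1, 2)), ((1953, 6, 0),
  (0, 1, 3)), ((1953, 6, 0), (0, 1, 2)), ((1953, 6, 0), (0, 1, 2)), ((1953, 6, 0), (0, 1, 2)),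
  ((1953, 6, 0), (0, 1, 3)), ((1953, 6, 0), (0, 1, 2)), ((1953, 6, 0), (0, 1, 2)), ((1953, 6, 0),
  (0, 1, 2)), ((1953, 6, 0), (0, 1, 2)), ((1953, 6, 0), (0, 1, 2)), ((1953, 6, 0), (0, 1, 2)),
  ((1953, 6, 0), (0, 1, 2)), ((1953, 6, 0), (0, 1, 2)), ((1953, 6, 0), (0, 1, 2)), ((1953, 6, 0),
  (0, 1, 2)), ((1953, 6, 0), (0, 1, 2)), ((1953, 6, 0), (0, 1, 3)), ((1953, 6, 0), (0, 1, 2)),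
  ((1953, 6, 0), (0, 1, 2)), ((1953, 6, 0), (0, 1, 2)), ((1953, 6, 0), (0, 1, 2)), ((1953, 6, 0),
  (0, 1, 2)), ((1953, 6, 0), (0, 1, 2)), ((1953, 6, 0), (0, 1, 2)), ((1953, 6, 0), (0, 1, 2)),
  ((1953, 6, 0), (0, 1, 2)), ((1953, 6, 0), (0, 1, 4)), ((1953, 6, 0), (0, 1, 2)), ((1953, 6, 0),
  (0, 1, 4)), ((1953, 6, 0), (0, 1, 2)), ((1953, 6, 0), (0, 1, 2)), ((1953, 6, 0), (0, 1, 2)),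
  ((1953, 6, 0), (0, 1, 3)), ((1953, 6, 0), (0, 1, 2))]

/-- Representatives of the lines for `q = 5`, and the blocks above them. -/
noncomputable def lineData5 : List (List ℕ × List ℕ) :=
  [
    ([0, 1, 515, 2128, 2484, 2696], [68605, 183340, 282709, 298301, 315236, 331213, 393614,
    469764, 477048, 477584, 563022, 576988, 583795, 590237, 630031, 646144, 661363, 666616,
    697559, 780907, 795008, 807065, 822796, 843848, 958214, 958976, 962359, 1010845, 1024200,
    1033989, 1051708, 1058474, 1104573, 1125099, 1133662, 1139075, 1154603, 1158639, 1184763,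
    1205226, 1233434, 1236711, 1247434, 1251171, 1295194, 1319734, 1370876, 1410676, 1413814,
    1431735, 1445640, 1453724, 1461773, 1479082, 1493732, 1499650, 1501803, 1507383, 1509717,
    1577047, 1606600, 1609325, 1647660, 1678633, 1708397, 1739217, 1807363, 1810730, 1829189,
    1891650, 1936084, 1971071, 1977763, 1988664, 2002147, 2022168, 2035712, 2050814]),
    ([0, 2, 918, 2999, 3134, 3675], [35427, 85672, 115940, 132597, 300276, 344209, 393289, 446827,
    460447, 482209, 535671, 549685, 573907, 590353, 596815, 600142, 631400, 633760, 641349,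
    660904, 664354, 697056, 699971, 741622, 761372, 781971, 797025, 809175, 827931, 966746,
    1011218, 1022985, 1044176, 1053727, 1059381, 1098817, 1123349, 1149924, 1179844, 1182559,
    1215612, 1233820, 1253819, 1278762, 1286350, 1299284, 1327566, 1329531, 1331528, 1345996,
    1354523, 1420624, 1468760, 1468761, 1469219, 1470327, 1480430, 1514571, 1593172, 1627760,
    1630079, 1728936, 1754174, 1761694, 1795439, 1822196, 1846721, 1862838, 1879870, 1918978,
    1921033, 1949865, 1974808, 1977052, 2008138, 2019877, 2035616, 2037878]),
    ([0, 3, 1182, 1996, 2026, 2262], [66962, 99029, 117479, 147662, 184097, 232612, 265147,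
    280593, 299263, 444142, 469697, 485045, 515815, 527093, 547139, 577232, 583906, 630861,
    631268, 631283, 631401, 632223, 633170, 674954, 712139, 715643, 745788, 829330, 830187,
    844321, 861013, 871464, 920580, 989672, 1007323, 1007710, 1043178, 1069243, 1072045, 1119853,
    1122352, 1134606, 1141134, 1154603, 1157337, 1240260, 1247663, 1281099, 1297119, 1298612,
    1331987, 1333895, 1336739, 1367373, 1401435, 1414769, 1445035, 1453013, 1482895, 1498966,
    1594241, 1598765, 1631335, 1632768, 1740281, 1745386, 1852390, 1856004, 1891906, 1917025,
    1935193, 1952010, 1966656, 1969548, 1974084, 2007126, 2038700, 2057607]),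
    ([0, 4, 11, 595, 2903, 3037], [16868, 65598, 83040, 164992, 360675, 363578, 414913, 426138,
    428331, 500061, 674130, 680342, 693518, 714054, 732166, 738472, 759247, 774333, 808127,
    872991, 886116, 910639, 921171, 923276, 973953, 992719, 1000752, 1026509, 1035249, 1051960,
    1070900, 1073041, 1101655, 1166518, 1168632, 1174893, 1205661, 1206835, 1255543, 1278763,
    1305349, 1312239, 1314526, 1329512, 1350229, 1370836, 1377893, 1397423, 1402433, 1426288,
    1468760, 1485513, 1501801, 1509420, 1558427, 1611886, 1614149, 1617505, 1639718, 1650423,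
    1662989, 1676698, 1709639, 1729395, 1759058, 1808539, 1820700, 1859746, 1877824, 1879482,
    1923237, 1937559, 1960821, 2019756, 2026315, 2037660, 2056785, 2059252]),
    ([0, 8, 1835, 2914, 3632, 3818], [33119, 36347, 181085, 182735, 231716, 246207, 267042,
    281228, 281587, 281680, 281724, 281728, 296231, 327993, 331885, 381907, 430118, 447409,
    541692, 547867, 560254, 562913, 566925, 569181, 658055, 660518, 664850, 666042, 691260,
    697559, 789630, 796301, 857862, 862859, 886650, 892360, 934395, 941407, 954833, 960543,
    1034337, 1036290, 1041287, 1043178, 1114959, 1121165, 1132773, 1140467, 1229178, 1235818,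
    1250778, 1255682, 1327176, 1331528, 1334932, 1337827, 1346134, 1352712, 1543573, 1549686,
    1560972, 1567891, 1625219, 1630557, 1705036, 1711366, 1737172, 1743254, 1822870, 1830533,
    1921492, 1927574, 1950362, 1957560, 1967806, 1973640, 2004750, 2010739]),
    ([0, 9, 2360, 2715, 3191, 3442], [115844, 234637, 330113, 468715, 475263, 509723, 547371,
    549299, 581151, 591585, 595416, 597589, 615025, 634533, 640089, 656894, 662928, 678747,
    695115, 709653, 762206, 775780, 790266, 836703, 853516, 875643, 935168, 956876, 986395,
    1009956, 1050221, 1065317, 1196424, 1207608, 1222437, 1240857, 1252971, 1271887, 1301612,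
    1334668, 1346138, 1360369, 1366418, 1370397, 1381715, 1385554, 1385792, 1386154, 1396283,
    1412401, 1430021, 1447006, 1459919, 1468761, 1475975, 1502035, 1517364, 1549246, 1595767,
    1646949, 1660443, 1663282, 1671223, 1674252, 1694611, 1763450, 1786853, 1819710, 1854527,
    1870100, 1886695, 1895622, 1940211, 2026317, 2035496, 2038111, 2048930, 2057440]),
    ([0, 12, 830, 1001, 3560, 3700], [36764, 51388, 65592, 230507, 231893, 278734, 443202, 476028,
    529422, 563016, 564193, 566510, 598687, 629423, 632399, 641523, 697057, 706139, 713639,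
    738474, 794422, 814385, 820951, 821670, 853284, 854840, 872496, 934072, 936471, 944614,
    993801, 1000925, 1003240, 1033278, 1049574, 1055274, 1072039, 1089095, 1121338, 1135204,
    1152055, 1181383, 1200368, 1240851, 1315907, 1348267, 1352716, 1385554, 1402020, 1411986,
    1414872, 1415186, 1442025, 1447179, 1464484, 1516694, 1526162, 1540918, 1550885, 1562373,
    1590789, 1594935, 1632099, 1724427, 1739320, 1746511, 1760963, 1795226, 1825641, 1921033,
    1950318, 1960924, 1969049, 1970460, 1975267, 1977047, 2010775, 2018928]),
    ([0, 13, 534, 1629, 2760, 3248], [34967, 84293, 115941, 131103, 231579, 266731, 344152,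
    442762, 476772, 477552, 479279, 498031, 524968, 548152, 563016, 563926, 575608, 606209,
    609631, 628159, 645877, 648733, 664927, 708843, 739768, 744677, 795805, 814879, 829938,
    830182, 830511, 830778, 845663, 852914, 872328, 912719, 923959, 926912, 954789, 1033175,
    1035886, 1067169, 1135604, 1140471, 1141865, 1154221, 1215346, 1248827, 1252472, 1278762,
    1304298, 1305922, 1331720, 1392928, 1397425, 1417364, 1508447, 1551220, 1576288, 1584983,
    1623358, 1709372, 1711695, 1727936, 1731079, 1739468, 1742382, 1747810, 1771933, 1869576,
    1893552, 1928151, 1940211, 1943367, 1969055, 1975493, 2019491, 2026315]),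
    ([0, 14, 2443, 3029, 3097, 3490], [32975, 85881, 247529, 300261, 426348, 470496, 492476,
    494435, 496732, 512761, 517565, 526221, 547579, 606476, 614793, 634376, 647518, 664806,
    697056, 698477, 710919, 725970, 738882, 777130, 796250, 804690, 839028, 839321, 839355,
    846392, 869339, 938049, 990663, 1021142, 1065398, 1086152, 1089130, 1093302, 1103968, 1116509,
    1135197, 1157743, 1202854, 1239313, 1289453, 1335917, 1360345, 1362701, 1450585, 1476111,
    1492086, 1493335, 1509717, 1534501, 1556704, 1567754, 1608068, 1623618, 1624915, 1639711,
    1674245, 1694372, 1697199, 1724433, 1771604, 1795440, 1814314, 1827513, 1836530, 1842719,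
    1875020, 1923140, 1934579, 1938003, 1952594, 1967877, 1976874, 2005518]),
    ([0, 16, 404, 1747, 2250, 2640], [35226, 52631, 65592, 280312, 281724, 300268, 333693, 482842,
    487143, 495110, 567861, 575668, 578436, 590354, 597644, 616495, 626106, 629415, 640573,
    662688, 716471, 728051, 738472, 745676, 765695, 779937, 863643, 888685, 907912, 962298,
    984325, 985420, 1000552, 1009536, 1038041, 1040117, 1050213, 1050835, 1054969, 1057577,
    1086500, 1188223, 1236509, 1239305, 1248296, 1250282, 1252971, 1280159, 1336537, 1368990,
    1395849, 1418192, 1448452, 1485311, 1500478, 1541643, 1584975, 1595565, 1617497, 1627094,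
    1628585, 1646320, 1675378, 1706885, 1721172, 1726178, 1739139, 1741515, 1745386, 1748443,
    1791500, 1795439, 1818929, 1869239, 1878174, 1892979, 1935828, 2059254]),
    ([0, 17, 2202, 2858, 3400, 3719], [51538, 116464, 184192, 234405, 262524, 332794, 396153,
    459019, 470288, 561316, 580631, 600395, 615317, 649537, 660905, 666251, 694511, 698484,
    730761, 739448, 781001, 793137, 812935, 824891, 860925, 870642, 890434, 943349, 960547,
    978610, 984780, 1003569, 1021673, 1041767, 1053367, 1075749, 1103660, 1124912, 1133581,
    1139038, 1142671, 1167531, 1203498, 1300511, 1300839, 1301110, 1301363, 1329509, 1346134,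
    1392879, 1396381, 1397423, 1417559, 1420238, 1428213, 1466264, 1484161, 1525356, 1533582,
    1535816, 1542631, 1576567, 1592530, 1622524, 1625175, 1665623, 1707611, 1713243, 1732459,
    1844660, 1873293, 1875065, 1983605, 1991540, 2009314, 2019415, 2039698, 2057176]),
    ([0, 19, 1031, 1538, 3046, 3069], [66022, 360677, 361105, 361611, 442433, 443187, 443617,
    463198, 477039, 508181, 544364, 617127, 660904, 662055, 677540, 691694, 753804, 763048,
    780907, 796990, 808843, 820188, 844321, 846829, 863999, 905816, 934399, 944260, 956169,
    959224, 975972, 989901, 1051193, 1065085, 1115647, 1116489, 1183994, 1231989, 1262434,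
    1280167, 1282114, 1295773, 1306352, 1347318, 1394760, 1410418, 1452835, 1485513, 1534293,
    1542808, 1558209, 1584214, 1609044, 1622849, 1661724, 1666554, 1674675, 1704899, 1744711,
    1756233, 1763445, 1790672, 1803519, 1811160, 1844407, 1846722, 1854160, 1861683, 1908028,
    1911513, 1920545, 1940211, 1944143, 1999501, 2002823, 2035153, 2043040, 2054693]),
    ([0, 21, 495, 1123, 2306, 2561], [148675, 150465, 234952, 378616, 412792, 414357, 429602,
    465070, 481515, 493450, 496080, 508950, 558142, 561316, 581696, 663653, 673657, 678379,
    706913, 707713, 724834, 726630, 727223, 779945, 803724, 811258, 892316, 909656, 920020,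
    942497, 989663, 1027399, 1072045, 1099617, 1121828, 1140467, 1158335, 1187656, 1200265,
    1205899, 1223989, 1237456, 1240851, 1250282, 1266326, 1271887, 1319023, 1333118, 1344380,
    1346934, 1369992, 1380562, 1425843, 1477464, 1492093, 1497813, 1499845, 1516521, 1568561,
    1627296, 1638969, 1676186, 1678623, 1711229, 1760225, 1770619, 1779950, 1838727, 1839553,
    1846721, 1855982, 1859917, 1874961, 1889576, 1983264, 2002058, 2032397, 2048011]),
    ([0, 22, 599, 1699, 2034, 3576], [85662, 132763, 216606, 247859, 267841, 296352, 348572,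
    361611, 476199, 487308, 492433, 579944, 581644, 591290, 595416, 609596, 611793, 629415,
    632388, 648733, 678515, 694120, 714821, 724034, 761373, 774335, 793302, 794073, 794238,
    794249, 809175, 809725, 814550, 824880, 893452, 940346, 950612, 958976, 999908, 1003137,
    1083769, 1092077, 1124659, 1152050, 1186845, 1207773, 1222426, 1230114, 1240249, 1249443,
    1337895, 1351381, 1388150, 1394541, 1419295, 1425554, 1427678, 1467609, 1512590, 1549179,
    1580489, 1628776, 1691188, 1708355, 1715078, 1729101, 1753777, 1781268, 1792658, 1820414,
    1836519, 1927044, 1952601, 2005683, 2009226, 2022499, 2026480, 2051750]),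
    ([0, 24, 624, 655, 775, 3775], [16546, 16558, 16858, 34102, 99620, 181675, 462511, 466646,
    469764, 510870, 515503, 519353, 573464, 578124, 582649, 690948, 695983, 700118, 756400,
    761372, 763932, 839016, 843115, 847286, 871743, 874858, 879818, 1081810, 1087313, 1091430,
    1147002, 1152061, 1156796, 1212947, 1218057, 1222114, 1248782, 1252959, 1257127, 1314514,
    1317536, 1322124, 1411871, 1415601, 1420312, 1441840, 1447076, 1450377, 1576555, 1579058,
    1584342, 1673479, 1678016, 1681419, 1739147, 1742946, 1747429, 1753476, 1759060, 1761296,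
    1803519, 1807051, 1810718, 1871308, 1875854, 1879482, 1886312, 1890939, 1894639, 1920620,
    1923147, 1929031, 1952589, 1957423, 1960439, 1983340, 1986965, 1991004]),
    ([0, 27, 365, 963, 2525, 3260], [51538, 167094, 199730, 246942, 344784, 363767, 395301,
    467085, 502469, 509995, 528106, 577232, 593721, 643937, 656885, 664354, 676793, 683560,
    722611, 760437, 763320, 792392, 812411, 854859, 873687, 887257, 906908, 909656, 927235,
    934395, 942876, 958794, 968102, 1010832, 1024200, 1033765, 1104291, 1152373, 1165068, 1169919,
    1198534, 1222437, 1266154, 1273363, 1300834, 1322045, 1436147, 1449772, 1464381, 1466646,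
    1468276, 1528401, 1541333, 1567546, 1580857, 1617497, 1644569, 1646771, 1677922, 1680429,
    1694702, 1696454, 1697876, 1761931, 1776992, 1822874, 1838807, 1873092, 1886324, 1891084,
    1936159, 1940544, 1966176, 1969049, 1985661, 2021194, 2023503, 2025867]),
    ([0, 29, 183, 2384, 2664, 2945], [117160, 197306, 215285, 311372, 311867, 311944, 329741,
    329881, 330502, 494477, 518333, 531962, 535285, 558689, 590975, 658180, 714260, 726591,
    741148, 748910, 791687, 813193, 829853, 878733, 940357, 954837, 978379, 989471, 1070374,
    1071866, 1092849, 1119792, 1137869, 1142486, 1154513, 1168039, 1183320, 1184495, 1207598,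
    1252959, 1268262, 1273153, 1288630, 1322136, 1336545, 1348715, 1364696, 1400279, 1401917,
    1420625, 1426571, 1430144, 1445626, 1461773, 1495715, 1573255, 1584975, 1592627, 1611886,
    1631322, 1674252, 1681655, 1697876, 1722031, 1723732, 1795232, 1844897, 1863203, 1872101,
    1904395, 1920463, 1928151, 1937473, 1958456, 1988680, 2004613, 2022334, 2041019]),
    ([0, 32, 481, 2654, 2877, 3794], [50221, 134942, 231846, 300261, 327977, 397835, 481515,
    502710, 509475, 527149, 529249, 533175, 557342, 557912, 557968, 557984, 574366, 609286,
    627925, 648144, 649910, 666672, 679141, 680422, 710279, 774346, 777186, 797265, 855881,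
    872055, 921949, 927235, 942553, 954004, 978413, 985678, 1006439, 1033749, 1049385, 1050819,
    1056289, 1057763, 1070225, 1075009, 1123349, 1132161, 1137232, 1222261, 1304282, 1378972,
    1403709, 1417615, 1447163, 1448516, 1461152, 1468817, 1475959, 1478504, 1549246, 1562429,
    1584410, 1593156, 1605945, 1624707, 1633985, 1689399, 1777048, 1791702, 1805450, 1827931,
    1829206, 1836514, 1857058, 1921432, 1960807, 1988664, 2007752, 2043024]),
    ([0, 34, 1696, 1935, 2671, 2848], [51215, 167725, 197811, 233864, 349857, 445270, 448377,
    464193, 512744, 569168, 615047, 624436, 632388, 680325, 690368, 716656, 731318, 746407,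
    748289, 757320, 777130, 811258, 829037, 837035, 891516, 927162, 958794, 961648, 1040013,
    1073041, 1131434, 1137777, 1172058, 1223934, 1232518, 1263697, 1272515, 1279294, 1300154,
    1301363, 1329514, 1360352, 1402549, 1433959, 1451690, 1492076, 1508714, 1551996, 1557025,
    1560955, 1593156, 1608597, 1608965, 1612370, 1629693, 1674020, 1689415, 1721155, 1722488,
    1725545, 1740264, 1741792, 1748434, 1796110, 1796686, 1797215, 1797232, 1818630, 1829189,
    1905927, 1918721, 1953141, 1971946, 1977053, 1985644, 1988382, 2004750, 2031677]),
    ([0, 37, 286, 1541, 1812, 3861], [16415, 200193, 251631, 314204, 380957, 467577, 518447,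
    529106, 535987, 573476, 590219, 606927, 614411, 649284, 674811, 695940, 748231, 779937,
    806922, 820045, 846392, 853181, 875268, 888542, 890291, 921450, 954833, 969016, 992721,
    1056801, 1147171, 1188231, 1206692, 1219127, 1255543, 1269594, 1278290, 1320176, 1328633,
    1344609, 1367598, 1387214, 1387255, 1388007, 1417488, 1445127, 1475975, 1494831, 1497604,
    1500892, 1527624, 1540745, 1566335, 1591061, 1599907, 1612935, 1628787, 1655472, 1660211,
    1692878, 1723769, 1740264, 1746241, 1775763, 1778368, 1830253, 1859774, 1908525, 1912051,
    1925202, 1927387, 1939638, 1944912, 2018028, 2022191, 2023503, 2039688, 2049204]),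
    ([0, 41, 318, 426, 1539, 3525], [65794, 99461, 118492, 132843, 147662, 149772, 251588, 265525,
    311654, 349430, 377101, 499902, 509491, 529106, 545991, 559198, 582448, 595038, 601496,
    612713, 616205, 699971, 765799, 779145, 780748, 814391, 826580, 853111, 886393, 893942,
    911127, 925180, 928060, 938828, 975383, 991515, 992508, 992719, 1011293, 1025442, 1033969,
    1050054, 1088882, 1107313, 1165068, 1183994, 1235663, 1282609, 1300352, 1350911, 1352509,
    1447594, 1475959, 1477665, 1491334, 1497813, 1527865, 1543573, 1562270, 1576555, 1592627,
    1622410, 1648511, 1662280, 1690252, 1742427, 1742958, 1775420, 1795226, 1824327, 1843977,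
    1911300, 1922600, 1925370, 1935871, 1959731, 1986333, 1994444]),
    ([0, 43, 2221, 2374, 2480, 2779], [49595, 51998, 232612, 248876, 264905, 297169, 298356,
    298409, 332655, 364344, 366058, 399252, 509995, 516325, 542458, 548137, 609335, 615231,
    709036, 716234, 791185, 797484, 853763, 858605, 922753, 928060, 954789, 961119, 984527,
    990237, 1018775, 1024361, 1066164, 1071936, 1084317, 1090647, 1102177, 1109840, 1229891,
    1234534, 1235322, 1239438, 1249454, 1256404, 1261963, 1268975, 1282397, 1289564, 1296945,
    1303058, 1331391, 1338496, 1360352, 1366186, 1376655, 1384163, 1442791, 1448532, 1513356,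
    1517609, 1545559, 1552013, 1674245, 1679800, 1707598, 1713432, 1822197, 1828713, 1870068,
    1877886, 1917005, 1923645, 1937835, 1944909, 1987743, 1992864, 2017688, 2024359]),
    ([0, 44, 601, 1369, 2401, 2633], [101133, 180686, 214477, 399162, 410610, 446118, 460848,
    508827, 566407, 579955, 592587, 597630, 615025, 648382, 680344, 738674, 740527, 761372,
    789586, 789608, 794238, 804866, 805382, 805498, 806435, 859310, 879461, 887835, 921965,
    978357, 990663, 1071223, 1083013, 1086500, 1117757, 1166836, 1171825, 1181389, 1213259,
    1215591, 1278376, 1314504, 1329509, 1387985, 1447163, 1481740, 1532172, 1534508, 1558427,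
    1559278, 1577047, 1593397, 1612653, 1645687, 1646717, 1682443, 1690721, 1726497, 1758763,
    1779023, 1807063, 1812898, 1824540, 1838807, 1840200, 1845921, 1855982, 1860680, 1872101,
    1890966, 1893552, 1895326, 1904186, 1986311, 2016344, 2025133, 2049325, 2050792]),
    ([0, 47, 2027, 2152, 2419, 3111], [101155, 312821, 331789, 347462, 426140, 495312, 497233,
    498031, 509704, 513066, 549685, 590214, 613266, 643644, 726854, 728901, 729685, 742958,
    797903, 805143, 862567, 875643, 877325, 891864, 918196, 928937, 971049, 991515, 1027386,
    1034337, 1103685, 1123293, 1163274, 1169909, 1180134, 1215894, 1220033, 1266403, 1272532,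
    1297710, 1315804, 1318413, 1345330, 1352716, 1362367, 1368998, 1371274, 1381819, 1464961,
    1502075, 1524832, 1527454, 1548473, 1557902, 1559385, 1590276, 1631390, 1708631, 1728937,
    1740218, 1780358, 1788700, 1791164, 1808240, 1810718, 1820054, 1851905, 1854929, 1855982,
    1872092, 1877787, 1893223, 1923479, 1934117, 1958868, 2003691, 2022334, 2039445]),
    ([0, 49, 1810, 2219, 3213, 3608], [66007, 68952, 279679, 283553, 295542, 331889, 347908,
    366426, 377965, 410759, 462511, 467942, 541841, 548419, 595691, 600750, 640089, 645582,
    657043, 662908, 705061, 710926, 737368, 744659, 841396, 847447, 870524, 878373, 934548,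
    940506, 968462, 973955, 1070374, 1075898, 1182708, 1189348, 1215166, 1222426, 1228986,
    1236711, 1246403, 1251369, 1267479, 1272135, 1295343, 1301363, 1426437, 1433232, 1626197,
    1633116, 1642729, 1650423, 1656663, 1661443, 1688773, 1693987, 1722637, 1728936, 1742735,
    1748600, 1758970, 1763936, 1769757, 1773094, 1776087, 1779114, 1804973, 1812078, 1856153,
    1862731, 1869003, 1874961, 1983801, 1987743, 1989728, 1994104, 2036049, 2042968]),
    ([0, 54, 317, 1263, 2325, 2890], [51388, 148793, 167725, 251239, 251747, 251774, 466422,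
    479935, 502654, 527657, 576383, 600143, 617011, 626106, 633013, 655905, 693184, 706036,
    728024, 737812, 755110, 774335, 776533, 839328, 856373, 859818, 869131, 871972, 904731,
    936341, 958056, 1026484, 1041042, 1065163, 1069834, 1099325, 1116489, 1147171, 1168039,
    1182681, 1191099, 1200195, 1220426, 1253545, 1255682, 1269454, 1273040, 1285841, 1355032,
    1385527, 1394552, 1395529, 1428186, 1466646, 1480404, 1481740, 1549522, 1551220, 1560928,
    1598318, 1711878, 1713940, 1725350, 1739120, 1755183, 1809047, 1851536, 1878349, 1890939,
    1907451, 1950733, 1954226, 1977389, 1984512, 1994051, 2002147, 2020844, 2054236]),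
    ([0, 58, 1582, 1703, 2567, 3509], [66762, 85888, 117450, 132211, 149743, 279902, 316501,
    330502, 394065, 396153, 502681, 540764, 541196, 541667, 551898, 606414, 624488, 643099,
    672150, 678350, 711184, 729486, 754573, 762206, 774333, 873658, 910336, 917926, 944511,
    952131, 977758, 989872, 1016610, 1037408, 1058673, 1082984, 1086522, 1089101, 1109840,
    1116269, 1132636, 1153752, 1182560, 1204308, 1219127, 1221635, 1223160, 1268946, 1282793,
    1354268, 1403709, 1409179, 1432405, 1434075, 1452044, 1534501, 1548399, 1557873, 1584946,
    1592840, 1594912, 1614384, 1617476, 1625146, 1656634, 1659164, 1675712, 1688624, 1726178,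
    1764630, 1824457, 1888383, 1974891, 1991287, 2003963, 2006181, 2037850, 2059456]),
    ([0, 62, 1354, 1543, 2682, 3302], [17170, 33425, 35010, 181010, 182598, 231862, 278561,
    329273, 395603, 444710, 491799, 499307, 508150, 515472, 546452, 552410, 562745, 569137,
    578105, 584466, 609898, 614554, 660022, 666011, 820951, 822282, 825452, 827713, 855148,
    861013, 922599, 929549, 1003215, 1003871, 1008677, 1010542, 1038049, 1043790, 1066466,
    1070225, 1071835, 1076772, 1115217, 1121640, 1183320, 1184176, 1189650, 1191126, 1233821,
    1239407, 1392928, 1399599, 1447076, 1452073, 1461096, 1467922, 1509724, 1516023, 1541945,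
    1546880, 1593142, 1597705, 1610991, 1617476, 1691023, 1695865, 1708366, 1714882, 1771604,
    1778368, 1789995, 1797534, 1872092, 1878143, 1934555, 1940513, 1999593, 2006295]),
    ([0, 68, 461, 877, 891, 3320], [131103, 248163, 284224, 460413, 480659, 481317, 531746,
    643937, 645548, 657559, 708619, 713829, 724000, 727516, 787444, 811275, 829330, 839113,
    839321, 839328, 853290, 895643, 903495, 907920, 925473, 934365, 976707, 978379, 1003206,
    1041443, 1067538, 1081822, 1121637, 1142132, 1149891, 1164643, 1170951, 1183613, 1237236,
    1247434, 1280452, 1328958, 1337749, 1352509, 1367930, 1368162, 1395849, 1397389, 1411813,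
    1420278, 1434481, 1441997, 1461062, 1498144, 1500680, 1524832, 1550940, 1580500, 1595205,
    1605961, 1657047, 1663282, 1672403, 1691797, 1797215, 1807051, 1822826, 1825761, 1871012,
    1925495, 1970841, 1973640, 1989872, 2002174, 2035230, 2042819, 2051878, 2058587]),
    ([0, 74, 241, 2866, 3353, 3526], [32813, 231862, 265425, 267425, 279112, 379857, 462325,
    487308, 500635, 541745, 581151, 610371, 628389, 664813, 689586, 698667, 708843, 713499,
    713829, 714019, 714056, 749100, 755327, 761887, 763932, 790150, 794428, 825673, 827931,
    860711, 878414, 888015, 908440, 925583, 953766, 960543, 974475, 1009544, 1041477, 1053304,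
    1059145, 1123483, 1139038, 1156759, 1213222, 1278953, 1304245, 1354487, 1361739, 1367893,
    1368877, 1383876, 1396571, 1410307, 1453604, 1466227, 1500998, 1513319, 1527987, 1530104,
    1548184, 1564347, 1584946, 1589362, 1598345, 1694892, 1710833, 1723732, 1756628, 1763408,
    1838447, 1877787, 1890951, 1922949, 1923122, 1943228, 1953121, 1999501]),
    ([0, 77, 773, 1478, 1862, 2399], [83007, 180948, 197282, 230621, 328971, 394962, 409711,
    469764, 483366, 496255, 529837, 532622, 536130, 641985, 728538, 730508, 761373, 775384,
    795425, 820951, 842496, 852585, 855881, 938056, 977618, 989524, 989872, 990685, 999821,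
    1020934, 1041287, 1052989, 1093302, 1107084, 1114963, 1164350, 1168632, 1169919, 1185517,
    1187656, 1199301, 1218346, 1230200, 1278290, 1318995, 1332742, 1365464, 1370838, 1413947,
    1477878, 1509207, 1512425, 1530936, 1549642, 1551996, 1616768, 1625937, 1649535, 1665623,
    1672437, 1680056, 1746408, 1748451, 1763145, 1764659, 1780172, 1835583, 1894651, 1908157,
    1955350, 1957937, 1994078, 1999978, 2018412, 2023478, 2042878, 2054236, 2056245]),
    ([0, 79, 1701, 2063, 2492, 2926], [231111, 267109, 297527, 311813, 398486, 426845, 430122,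
    445387, 493140, 499005, 524639, 529837, 531341, 536477, 557358, 563843, 576383, 582186,
    672857, 678350, 692492, 698667, 723588, 729515, 740877, 745750, 753864, 761372, 870509,
    878451, 886606, 888542, 892223, 893942, 952557, 958794, 1001994, 1004578, 1008417, 1011063,
    1115312, 1121828, 1148251, 1154488, 1248794, 1255279, 1280851, 1287057, 1329999, 1335709,
    1397389, 1404432, 1425554, 1432225, 1525356, 1530291, 1640210, 1646199, 1723212, 1728550,
    1823316, 1829150, 1838257, 1844897, 1885355, 1891251, 1905398, 1911790, 1937559, 1944850,
    1950852, 1954818, 1957771, 1961241, 1999471, 2006700, 2017688, 2023646]),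
    ([0, 83, 361, 379, 2257, 2361], [164377, 213799, 216716, 315047, 429602, 431934, 501822,
    517119, 549528, 609596, 662381, 676875, 682614, 731335, 780727, 839362, 840372, 861604,
    874858, 878354, 879572, 901908, 902047, 902056, 902995, 903047, 904758, 944614, 973070,
    975972, 978429, 1022986, 1025282, 1071866, 1085672, 1106933, 1109840, 1147761, 1150295,
    1185909, 1198211, 1219918, 1222261, 1305739, 1312577, 1344752, 1369822, 1385969, 1427689,
    1436119, 1484026, 1500680, 1526473, 1530141, 1542348, 1564157, 1567847, 1581815, 1608436,
    1613664, 1625956, 1643634, 1698168, 1707578, 1760283, 1769757, 1787630, 1837927, 1843808,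
    1857002, 1884211, 1904306, 1905120, 1921492, 2015527, 2022168, 2039526, 2055167]),
    ([0, 84, 1056, 2047, 2579, 3143], [99632, 147662, 182629, 200294, 314204, 330685, 344419,
    349832, 431543, 464193, 478648, 494435, 511140, 549685, 549951, 550233, 577608, 580919,
    582607, 610329, 643086, 691264, 730719, 744468, 747213, 859290, 907912, 910599, 935949,
    1008375, 1020892, 1040915, 1059798, 1070374, 1089095, 1109840, 1114873, 1117934, 1134989,
    1197604, 1198773, 1234634, 1248254, 1270029, 1282355, 1306310, 1315794, 1328992, 1345610,
    1381739, 1460484, 1463044, 1481767, 1512601, 1578395, 1593100, 1644964, 1658415, 1662397,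
    1708355, 1714354, 1731079, 1763408, 1787187, 1789387, 1802335, 1809964, 1824285, 1860174,
    1874499, 1893181, 1895348, 1923117, 1938494, 1950324, 1976524, 2010739, 2059414]),
    ([0, 89, 2111, 2371, 2465, 2644], [17201, 67630, 85917, 167725, 246207, 316599, 344210,
    377945, 470919, 480049, 516250, 528690, 541424, 543694, 545991, 563508, 564830, 578124,
    665727, 679157, 681749, 697515, 705966, 728682, 773158, 808413, 828375, 843127, 845090,
    857725, 859394, 892364, 893918, 896771, 902995, 961174, 967060, 993698, 1009354, 1018009,
    1083035, 1087670, 1102808, 1185484, 1207608, 1216735, 1256269, 1279029, 1295220, 1338700,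
    1345996, 1393655, 1410418, 1465115, 1479082, 1513708, 1518849, 1544951, 1546268, 1563282,
    1581711, 1609245, 1645006, 1649535, 1675378, 1771933, 1781279, 1788679, 1805394, 1836519,
    1859748, 1893181, 1895582, 1910011, 1940513, 1958696, 1991287, 2059252]),
    ([0, 97, 407, 983, 1789, 2961], [100027, 101230, 248110, 313136, 345217, 364599, 380639,
    430122, 725711, 731173, 754847, 761208, 774290, 780961, 839355, 844321, 886154, 892360,
    920533, 927235, 1018991, 1025259, 1087325, 1092849, 1103660, 1108967, 1150281, 1156239,
    1163393, 1169909, 1197733, 1203877, 1218241, 1223951, 1262458, 1263697, 1269594, 1270120,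
    1314927, 1321164, 1329990, 1336537, 1343899, 1350229, 1376564, 1383793, 1396940, 1402991,
    1411995, 1417364, 1479082, 1485319, 1510447, 1516591, 1526162, 1533329, 1611022, 1617476,
    1641189, 1644287, 1647426, 1649873, 1755854, 1763145, 1788254, 1794832, 1803831, 1810006,
    1835888, 1841784, 1888412, 1896323, 1901966, 1906715, 2032596, 2039174, 2048731, 2055681]),
    ([0, 109, 258, 949, 1377, 2735], [101343, 132598, 213670, 216477, 299134, 377816, 395900,
    414357, 502597, 512615, 533361, 551798, 582529, 609302, 633170, 645304, 680293, 682181,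
    699971, 716656, 722150, 741253, 773702, 820649, 843848, 872502, 908311, 918717, 941141,
    943303, 954075, 992803, 1008579, 1016773, 1101186, 1140423, 1149796, 1182044, 1189890,
    1197604, 1207598, 1263714, 1270557, 1297581, 1317419, 1364313, 1385322, 1409988, 1433471,
    1484161, 1496315, 1509207, 1518667, 1527895, 1533058, 1557744, 1564678, 1605711, 1641978,
    1646199, 1659541, 1666595, 1696413, 1706252, 1723769, 1760096, 1805394, 1825518, 1877433,
    1884865, 1906715, 1907135, 1907349, 1908028, 1936030, 1938536, 1957435, 1984986]),
    ([0, 116, 364, 618, 1185, 1488], [115554, 118183, 249754, 251057, 262524, 263733, 263791,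
    263915, 264042, 267367, 278740, 315786, 344152, 395971, 410450, 447104, 460266, 465914,
    476028, 482668, 526039, 531780, 562687, 568986, 626048, 632223, 640031, 645400, 693211,
    699913, 741622, 748231, 759249, 765703, 938678, 944202, 953766, 958794, 1003148, 1009354,
    1033384, 1036108, 1040117, 1040733, 1049271, 1054919, 1065008, 1072454, 1132177, 1137050,
    1183994, 1191099, 1199982, 1204917, 1229891, 1235818, 1328776, 1334486, 1411813, 1417306,
    1441843, 1449661, 1513298, 1518667, 1723154, 1730321, 1739159, 1746202, 1753430, 1758763,
    1760225, 1764659, 1773255, 1778965, 1824504, 1830431, 1922701, 1929031]),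
    ([0, 126, 378, 1260, 1764, 3276], [17, 148190, 149583, 230922, 231657, 234952, 262335, 265462,
    267046, 279049, 281543, 283868, 295353, 297527, 300205, 313136, 315047, 316410, 345532,
    347908, 349643, 360992, 363578, 366363, 526039, 527594, 529130, 530571, 533490, 535987,
    591290, 593658, 595353, 597589, 598624, 601466, 655932, 658630, 660022, 662696, 663968,
    666042, 1049385, 1051078, 1053304, 1056242, 1056881, 1059696, 1130905, 1132951, 1134989,
    1136987, 1138785, 1141536, 1360667, 1362304, 1364250, 1367741, 1369192, 1370208, 1704406,
    1706696, 1709954, 1710240, 1713243, 1714207, 1738106, 1740218, 1742586, 1744281, 1746517,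
    1747552, 1967247, 1968419, 1971946, 1973577, 1975493, 1976881]),
    ([0, 134, 1003, 1007, 1014, 1598], [51041, 134891, 267042, 278731, 283951, 442695, 446051,
    465847, 469697, 482977, 528623, 534873, 547072, 559411, 562776, 595184, 601588, 612365,
    614518, 642683, 697056, 742958, 756284, 792372, 864013, 877894, 925113, 936471, 960257,
    1003148, 1003871, 1016103, 1036706, 1057070, 1068726, 1087313, 1093242, 1098818, 1114848,
    1124592, 1151885, 1153714, 1172008, 1252472, 1365888, 1399297, 1434008, 1496248, 1508118,
    1518218, 1549179, 1584147, 1596623, 1598979, 1632967, 1641179, 1657908, 1672437, 1699322,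
    1706252, 1713873, 1715424, 1725478, 1760283, 1774834, 1789408, 1791441, 1793647, 1803531,
    1901668, 1928976, 1939714, 1967810, 1973577, 1984539, 1999471, 2010672, 2034723]),
    ([0, 146, 1999, 2260, 3001, 3444], [83865, 182598, 232539, 248090, 266546, 297643, 349874,
    463591, 466585, 467720, 476086, 484336, 499338, 509650, 532549, 565016, 567160, 632223,
    658242, 664854, 680293, 682541, 691191, 694810, 730508, 743189, 763932, 821907, 854767,
    927162, 928450, 978610, 988836, 1011063, 1043061, 1139898, 1158566, 1212959, 1228913, 1237236,
    1246178, 1279221, 1289453, 1335026, 1344380, 1364002, 1413334, 1430071, 1444140, 1446464,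
    1465938, 1468760, 1495185, 1509651, 1540815, 1579370, 1583224, 1593100, 1595166, 1625146,
    1704826, 1706759, 1710240, 1722003, 1788910, 1805450, 1860997, 1869234, 1901966, 1902467,
    1912282, 1955049, 1970287, 1977389, 1987853, 2038568, 2041563, 2059485]),
    ([0, 153, 259, 558, 1685, 1728], [148793, 150465, 164715, 167446, 295119, 297437, 297716,
    298301, 314246, 344668, 377101, 412673, 444523, 446549, 546204, 552410, 559838, 566881,
    593658, 598345, 628036, 633095, 641529, 647518, 770395, 776322, 807549, 814282, 871464,
    878414, 921171, 926633, 934072, 941270, 1033105, 1038908, 1151606, 1157471, 1183874, 1190235,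
    1313962, 1319455, 1395849, 1401156, 1412122, 1417336, 1475903, 1482295, 1491014, 1497747,
    1509207, 1513708, 1524553, 1526577, 1531193, 1532194, 1576288, 1578158, 1582866, 1584147,
    1658136, 1663598, 1672504, 1678028, 1689399, 1693838, 1837978, 1844897, 1856153, 1862452,
    1918978, 1927044, 1949866, 1957281, 2034658, 2040740, 2052570, 2058621]),
    ([0, 177, 1235, 1269, 2931, 3170], [100042, 115736, 182735, 246163, 363631, 366426, 380225,
    395971, 481459, 485566, 499373, 500270, 574734, 640581, 650638, 672367, 674132, 678747,
    706404, 730277, 737304, 754807, 795177, 853111, 894469, 895350, 903897, 922753, 936886,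
    969522, 985420, 1018430, 1086235, 1092280, 1103775, 1119266, 1166886, 1200265, 1266799,
    1270397, 1314526, 1331900, 1348641, 1367741, 1385922, 1420082, 1430982, 1431647, 1476111,
    1497972, 1512425, 1529750, 1580857, 1607860, 1608436, 1608965, 1608982, 1678016, 1699208,
    1746706, 1756660, 1757922, 1771117, 1773313, 1781279, 1789776, 1797565, 1797933, 1861070,
    1863206, 1888672, 1908525, 1927044, 1936084, 1950730, 1960807, 1990240, 2058662]),
    ([0, 187, 204, 2389, 3045, 3587], [99461, 167094, 197828, 315134, 349328, 379337, 410508,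
    468026, 499005, 511235, 512189, 595251, 613164, 696954, 715551, 744246, 757218, 772344,
    795425, 809634, 819929, 843602, 857716, 886552, 902995, 903840, 974410, 976312, 1017960,
    1039187, 1059696, 1065752, 1067436, 1105713, 1135517, 1147096, 1150281, 1164643, 1169596,
    1174298, 1200163, 1218351, 1235774, 1238896, 1239305, 1249649, 1284426, 1301176, 1301278,
    1315734, 1387255, 1436215, 1448460, 1450611, 1480044, 1548082, 1584654, 1594241, 1633899,
    1641144, 1660354, 1699727, 1727228, 1758970, 1774143, 1779045, 1803531, 1809964, 1830431,
    1838727, 1862629, 1894849, 1907349, 1943265, 1954226, 1959788, 2026480, 2059456]),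
    ([0, 221, 1341, 1654, 3081, 3795], [50874, 164887, 197811, 363578, 379067, 394678, 409805,
    519630, 527279, 546903, 573907, 591479, 597644, 666672, 725970, 760159, 772446, 794428,
    806955, 822796, 825452, 826279, 842772, 870183, 878451, 887495, 891533, 919081, 944202,
    971485, 988796, 1020593, 1023444, 1071936, 1082157, 1088055, 1104886, 1107526, 1117060,
    1142418, 1151885, 1186154, 1221378, 1245615, 1314504, 1344683, 1354297, 1377895, 1432405,
    1437443, 1445035, 1461920, 1483309, 1508509, 1519411, 1559634, 1560976, 1563797, 1657081,
    1663050, 1671283, 1696991, 1711366, 1712479, 1742649, 1761296, 1777064, 1821410, 1823677,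
    1851563, 1875027, 1886695, 1902807, 2002668, 2032820, 2034790, 2049347, 2058587]),
    ([0, 264, 1212, 1916, 2240, 2528], [32850, 32982, 33456, 33808, 33970, 34114, 52227, 166488,
    199730, 262833, 265738, 267235, 296231, 297037, 300129, 459455, 464193, 468715, 544527,
    548419, 551321, 558689, 562311, 566275, 573776, 579471, 582529, 624321, 628294, 631268,
    707602, 710711, 715521, 724702, 727418, 732168, 739429, 745343, 748017, 789002, 793302,
    798592, 821676, 825673, 831200, 953246, 957477, 961042, 1000752, 1004866, 1009412, 1034293,
    1039055, 1044177, 1049448, 1051830, 1054336, 1054969, 1058702, 1060529, 1623618, 1626496,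
    1631390, 1671283, 1675580, 1680795, 1722505, 1727330, 1732074, 1986333, 1988608, 1994051,
    2034658, 2038568, 2041920, 2050792, 2054561, 2058294]),
    ([0, 303, 2721, 2837, 3085, 3339], [197604, 200336, 213619, 216606, 262965, 327997, 349832,
    366363, 398486, 410450, 410508, 410632, 410759, 411194, 415329, 428431, 511668, 517719,
    542458, 547424, 644702, 649854, 757320, 763650, 836642, 840836, 843127, 847755, 890291,
    895722, 903529, 906585, 909518, 912574, 919758, 926057, 1019331, 1020821, 1024793, 1027399,
    1098818, 1103136, 1105365, 1109869, 1263484, 1268946, 1280159, 1286489, 1377893, 1378988,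
    1383913, 1385969, 1396571, 1401847, 1426996, 1432799, 1526059, 1532172, 1558209, 1563919,
    1573195, 1579370, 1589620, 1596973, 1639572, 1644569, 1676844, 1681655, 1690252, 1697171,
    1805219, 1808031, 1811580, 1813431, 1820249, 1824781, 1854524, 1860327]),
    ([0, 581, 747, 1293, 1321, 2927], [164184, 213698, 216606, 365292, 379667, 381863, 427216,
    468847, 485045, 501822, 515170, 516836, 518914, 533175, 591479, 643736, 721274, 756412,
    763969, 775124, 777978, 796301, 807032, 839113, 895677, 901576, 929660, 969496, 1023824,
    1092280, 1107823, 1122943, 1138785, 1197646, 1200222, 1239888, 1250782, 1263714, 1270658,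
    1284229, 1286350, 1288354, 1305273, 1313378, 1314158, 1314241, 1314514, 1314528, 1318413,
    1379702, 1432225, 1442152, 1461127, 1475333, 1486674, 1535062, 1562379, 1574447, 1590789,
    1616864, 1647660, 1650074, 1655159, 1657975, 1661443, 1664217, 1679448, 1753430, 1771604,
    1818937, 1838447, 1844276, 1874325, 1905927, 1983081, 1986333, 2004254, 2021563]),
    -- These are the points of GF(25), as 651 = (5^6 - 1)/(5^2 - 1).
    ([0, 651, 1302, 1953, 2604, 3255], [66140, 66791, 67442, 68000, 68651, 69302, 229683, 230334,
    230985, 231657, 232308, 232959, 233986, 234637, 235288, 344419, 345070, 345721, 346585,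
    347236, 347887, 348572, 349223, 349874, 377314, 377965, 378616, 379337, 379988, 380639,
    381260, 381911, 382562, 393289, 393940, 394591, 395629, 396280, 396931, 397835, 398486,
    399137, 1147314, 1147965, 1148616, 1149145, 1149796, 1150447, 1151410, 1152061, 1152712,
    1153241, 1153892, 1154543, 1155506, 1156157, 1156808, 1157337, 1157988, 1158639, 1867955,
    1868606, 1869257, 1870068, 1870719, 1871370, 1872441, 1873092, 1873743, 1874161, 1874812,
    1875463, 1876522, 1877173, 1877824, 1878182, 1878833, 1879484]),
    ([0, 997, 1197, 1959, 2703, 3539], [17847, 99632, 100680, 235015, 248110, 278734, 312065,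
    313724, 363767, 381911, 413537, 428331, 428431, 428812, 429184, 429602, 461069, 467368,
    477768, 484067, 642207, 648568, 773158, 780139, 803653, 810076, 868791, 874687, 969177,
    975383, 985420, 991719, 1019666, 1019912, 1025655, 1027048, 1098885, 1102689, 1103975,
    1108678, 1116672, 1123808, 1168039, 1174400, 1281284, 1286498, 1347235, 1353131, 1376860,
    1378641, 1383686, 1385560, 1460794, 1467310, 1478448, 1484251, 1524866, 1531537, 1577649,
    1583297, 1674868, 1680795, 1689399, 1693457, 1694117, 1699322, 1773349, 1777788, 1854715,
    1860766, 1902467, 1902935, 1906844, 1910598, 1985644, 1991540, 2004316, 2010677]),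
    ([0, 1017, 1233, 1961, 1967, 2343], [82429, 134886, 148253, 196685, 364599, 381907, 411194,
    428802, 516325, 531201, 612134, 629415, 679596, 695301, 771306, 879529, 886654, 888052,
    902056, 910639, 935991, 953378, 962000, 969159, 971087, 990455, 992508, 1021673, 1104573,
    1166520, 1171529, 1191281, 1200374, 1204975, 1219127, 1223934, 1248661, 1299950, 1318443,
    1319023, 1322136, 1371846, 1383013, 1388161, 1398401, 1419528, 1429314, 1460884, 1502776,
    1516023, 1534844, 1545498, 1557744, 1575959, 1641686, 1644198, 1675580, 1689399, 1691054,
    1698840, 1731385, 1774721, 1776025, 1802863, 1805466, 1809074, 1812078, 1835583, 1841698,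
    1868411, 1876339, 1884411, 1909380, 1941190, 1973577, 1986784, 2001639, 2040602]),
    -- The lines {0, 126, 378, …} and {0, 264, 1212, …} have only even exponents and so serve only
    -- parity 0. Their translates by α, here and in the next entry, serve parity 1.
    ([1, 127, 379, 1261, 1765, 3277], [18256, 214155, 215313, 247439, 248708, 250767, 328028,
    329832, 332613, 376988, 379977, 382824, 394937, 396374, 397320, 410412, 412119, 414415,
    427506, 428147, 430972, 443513, 444599, 447696, 672266, 674766, 677121, 678751, 680662,
    682025, 1082197, 1084068, 1087184, 1088713, 1090119, 1092863, 1164199, 1166398, 1169201,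
    1171118, 1172511, 1175190, 1262443, 1264402, 1266005, 1267781, 1270422, 1273482, 1491458,
    1493926, 1496121, 1498904, 1500721, 1501614, 1655805, 1658348, 1658965, 1661670, 1663097,
    1665946, 1803843, 1804808, 1807300, 1809615, 1811045, 1813909, 1835936, 1838107, 1840770,
    1841987, 1843786, 1846542, 2016644, 2018798, 2019423, 2022168, 2023795, 2025691]),
    ([1, 265, 1213, 1917, 2241, 2529], [83600, 118169, 133307, 410910, 412395, 414604, 491612,
    497322, 500755, 606904, 611486, 616014, 691571, 695352, 699385, 805550, 809892, 814279,
    837396, 841420, 845669, 968451, 972067, 975881, 1019753, 1023864, 1026382, 1098363, 1103434,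
    1106516, 1164130, 1166016, 1168886, 1170790, 1171905, 1174259, 1216185, 1219978, 1224311,
    1262817, 1263768, 1267000, 1268965, 1271318, 1273244, 1311198, 1316407, 1319033, 1429216,
    1431992, 1436289, 1641074, 1645929, 1649470, 1655358, 1657145, 1658965, 1662300, 1664507,
    1665529, 1855364, 1858170, 1863217, 1884433, 1888628, 1893246, 1900907, 1905309, 1909243,
    1920815, 1923534, 1928359, 1935194, 1938945, 1942228, 1952844, 1957357, 1960160])]

/-- The certificate for `q = 5`. -/
noncomputable def cert5 : HalvingCert where
  N := 3906
  m := 5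
  H := traceZero5
  full := 2 ^ 3906 - 1
  reps := orbitExponents5
  orbs := orbitData5
  lines := lineData5
  lam := 78

/-- The traces of the powers of the generator for `q = 5`. -/
def traceTable5 : ℕ :=
  0x4908368346304865b4832400d36e24e284c2a26d349a0cc45a0ca4903006db25a45c8c36194a288c90241b12431226248161844b0400c38936930a46092d99238da2134648d38616820138484605092cc10a2c168986025a8136524c34503037114906a28184da10b0494e16894448a145c26089b7224230882e330b8ca3194c28991145000603035032024106246126d471968b01028a85a9194ca22349984889b5142d08230c244349388169422081a4e152245088b0e186240a84369964a45c0d188470c08068a8524540008db6636640c991b62311c24129151831488a1092928420216d24c25248922804c906066301b85868071145305030b09b81a1026536c38d86420534d02c00535129126a08110c37046a40892938db49202348902104c60466440140b25124c21b0d289990129a91310a66390b0e09090d951a6d20082a26127112032d84544638e16444908ca6d02516030c286484c26008184868828104360222200c02305301b04391386364c91860250b64866380870a41b5186cb61989b2402e180860c04000210a90a9220d32844dc8434498d26e049980b2498c289164a0637184c831a45881c08a90b8534047104a348060325185386271b4842d940400b48148945c05260849020230088489b09c6a03088524916525000a28100106417016834a069a2808c241901a40848051b4d90dc2026a210111b6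0b8030900610497094013234d94d072305951b6034a170b71921352065c7028046898a288446009169c4dc0516dc0248d92212426e171850a80408225b2638526e150a2a46da8894d380452288b8910c269320b6202cc2992d86a431b6582a450924889304a80b4db28c25a6c12881225190d930c4448e308188a2da8d348291b28189a10172225244c6a341131b8018e00090024424224102032593183040632e24c231160401b2d02d82046c300200c41c40c5124584236d141446191c8a26db8244518e29006a10d22d490c2a360490b41842170c64a6848496232041210080102482082cc08b04a4121228d084009941a21a8909048585197224606da90860a0a32602108646a36244410930d98d14618da2500895202a085b09a6db40309850351305126450c2830c92908a025c91841c2a05234420802d30c36c205246485470240b2d04c34928102238d48538a42000d17187180923144541032890112209188948d00116da05a1144442dc4622416cc5233186e390a04c4986484130908539234a420845b0a20608c85202217248238580a10ca80a44281b90972264b80005a80380369c68069231c91948871184c4096c248844285841b20c08a1190e16919092038e409b0844cc01c62210204c0a429405c6a32030886dc6c428170b11270c8dc04921269a4515030599141248581202010812c02e08dc2db71c0634c86104638208e370c60805a22432405309a2e204a6e11118c332349c8830d161a2026e461360004a11c11c8cc01429866070424108328a08269124185b51230b0593084d821451285191c08880108964a6422241119008080c12c22826a10906822e28644538846ca45b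0604132a30e10486980d08925128934016da2402626d14d03026a00242118518988116ca20b2c069c6430406ca4da2dc68a12144301b2510610c88406a00618634a32dc10261109928b2038a244945a0888436db29c08151005865391365052168b40964321130b11a0912614d104888322312470b61b86000a09b8db88b51c84041369c49a40408a7207002da51c71b0492d342331a6806d48014038cc8c28d329c68801c6a12612c392261900225c2d42c300a4d18e18942086413082ca0c12806580546514d125b1114883184930522d08607140908d205a71b08b92004861985961b69450945b1212dc0042636c36ca51c9012dc42061c0a20e400465c0a408190941100a3002a02544530928186c02592db6da4118a331128a8d90506010a182381b4544a050b2918d40a361c0e470965109b25010865c51c6d942468112400162184186389c6904e10036c1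

/-- The exponents and scalars of the vectors encoded by `orbitReps5`. -/
def orbitVectors5 : List (ℕ × ℕ × ℕ) :=
  [(11362, 9347, 276), (6540, 7777, 1740), (3427, 3314, 13121), (30122, 20955, 13121), (993, 7540,
  22817), (25132, 13563, 23836), (6713, 5676, 26051), (1834, 28420, 26924), (500, 24417, 7513),
  (3626, 15612, 28444), (18521, 12131, 15225), (7745, 17771, 11267), (25681, 16972, 21020), (7083,
  15323, 15225), (500, 27764, 13018), (26122, 16603, 21834), (15561, 6217, 49), (11362, 9347,
  6306), (29707, 16796, 3314), (20290, 20282, 13129), (28323, 7498, 20657), (21308, 3050, 16100),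
  (2073, 22817, 3633), (18521, 3449, 16618), (5850, 16796, 26243), (16676, 16956, 2396), (21850,
  25691, 5820), (13106, 21353, 25594), (2346, 30514, 20947), (17187, 13563, 23572), (1497, 8281,
  16810), (12683, 14769, 25137), (8675, 3169, 31041), (15620, 19100, 507), (8427, 12804, 26130),
  (23299, 12908, 25602), (23458, 23633, 25594), (15620, 22100, 23836), (6713, 11825, 27043),
  (21826, 8281, 3641), (11258, 12179, 26932), (27034, 3322, 24297), (20290, 9284, 12699), (26036,
  9177, 26924), (20939, 30362, 16618), (19108, 4371, 23836), (3835, 30145, 28444), (20129, 9649,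
  4572), (28323, 7921, 7756), (1732, 31243, 3852), (11258, 23705, 28114), (5538, 14755, 17977),
  (28282, 15241, 28444), (15908, 16603, 12849), (28433, 23465, 21028), (19906, 1643, 16810),
  (23939, 20282, 26924), (15820, 22076, 22793), (22772, 10234, 22809), (17972, 15612, 21834),
  (14210, 18634, 3441), (7745, 7921, 30660), (17505, 4721, 3633), (28433, 5291, 16681), (23651,
  16796, 23978), (21850, 31243, 10249), (15531, 16681, 268), (21308, 12908, 8681), (11362, 12179,
  12849), (26898, 16626, 6548), (14763, 12154, 1740), (23564, 9185, 19516), (24993, 27764, 2396),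
  (1497, 2354, 19660), (3305, 21596, 4572), (20732, 21842, 21028), (6202, 17073, 22801), (26122,
  15473, 30660), (16611, 5409, 17236), (14857, 16603, 31033), (1497, 313, 29715), (10506, 30210,
  5545), (7354, 1476, 26916), (4243, 29050, 22801), (12796, 9668, 41), (31026, 16956, 11372),
  (21347, 15612, 5820), (8675, 21596, 2970), (2084, 6010, 1748), (16585, 15523, 1748), (9633,
  4539, 13113), (11258, 9649, 10665), (6411, 20665, 41), (15531, 7540, 21611), (9169, 17073,
  4267), (257, 31243, 19116), (9601, 25851, 20947), (4553, 27722, 49), (5809, 9185, 26243),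
  (21577, 8267, 6306), (18756, 27556, 14219), (16676, 26427, 6002), (26412, 1842, 28329), (21347,
  13978, 6721), (15561, 7521, 23658), (21577, 28099, 26932), (6785, 25460, 7556), (15531, 9362,
  6209), (18521, 27738, 4564), (25585, 10234, 14219), (26235, 25460, 20657), (26042, 22881,
  13667), (1545, 9818, 21028), (24425, 19083, 8586), (16090, 13283, 23978), (4379, 5676, 3852),
  (26042, 7498, 5820), (19652, 23465, 1553), (20275, 30122, 8570), (10658, 26427, 16595), (25426,
  1756, 26916), (14210, 12804, 26932), (1732, 7091, 18764), (21604, 22779, 7756), (979, 23546,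
  1740), (11699, 27764, 5857)]

/-- The trace zero points for `q = 3`. -/
def traceZero3 : ℕ :=
  0x5f166d0810cc46cae58126a0401510f422421e4548a4068a24a0c138040718c04ee081301d20001054619014b0b5f166d0810cc46cae58126a0401510f422421e4548a4068a24a0c138040718c04ee081301d20001054619014b0b

/-- The representatives of the orbits of blocks for `q = 3`. -/
def orbitExponents3 : ℕ :=
  0x3901d00101100b00002200800002300400000800400003600500002500800001e00200001500200001700200001400200007000100005c00100004800100004700100004000100006500300002500100000700300006600100005000200001f00200002500300002f00300001400100002900100001200100002c00100000400300000500200000b00100000900100000c00300000a00100000500100000400100001a00100001b001000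

/-- The orbit lengths and pivots for `q = 3`. -/
def orbitData3 : List ((ℕ × ℕ × ℕ) × (ℕ × ℕ × ℕ)) :=
  [((182, 3, 0), (2, 3, 4)), ((182, 3, 0), (2, 3, 4)), ((182, 1, 76), (2, 3, 5)), ((182, 1, 82),
  (2, 3, 4)), ((182, 3, 0), (2, 3, 4)), ((182, 1, 46), (1, 2, 4)), ((182, 3, 0), (2, 3, 5)),
  ((182, 3, 0), (2, 3, 5)), ((182, 3, 0), (1, 3, 4)), ((182, 1, 70), (1, 2, 5)), ((182, 3, 0), (2,
  3, 4)), ((182, 3, 0), (2, 3, 4)), ((182, 3, 0), (2, 4, 5)), ((182, 3, 0), (2, 3, 4)), ((182, 3,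
  0), (1, 2, 4)), ((182, 3, 0), (1, 2, 4)), ((182, 3, 0), (1, 3, 4)), ((182, 3, 0), (1, 3, 5)),
  ((182, 3, 0), (2, 3, 4)), ((182, 1, 64), (1, 2, 4)), ((182, 3, 0), (2, 3, 4)), ((182, 3, 0), (1,
  2, 4)), ((182, 3, 0), (2, 3, 4)), ((182, 3, 0), (2, 3, 4)), ((182, 3, 0), (2, 3, 4)), ((182, 3,
  0), (2, 3, 5)), ((182, 1, 84), (2, 3, 4)), ((182, 3, 0), (1, 3, 4)), ((182, 3, 0), (1, 3, 4)),
  ((182, 3, 0), (1, 3, 4)), ((182, 3, 0), (1, 3, 4)), ((182, 1, 132), (1, 2, 4)), ((182, 3, 0),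
  (1, 2, 3)), ((182, 3, 0), (1, 2, 5)), ((182, 3, 0), (1, 2, 5)), ((182, 1, 0), (1, 2, 4)), ((182,
  1, 0), (1, 2, 5)), ((14, 1, 4), (0, 2, 3))]

/-- Representatives of the lines for `q = 3`, and the blocks above them. -/
noncomputable def lineData3 : List (List ℕ × List ℕ) :=
  [
    ([0, 1, 221, 248], [35, 107, 16491, 65571, 82073, 133160, 135346, 147505, 163875, 196786,
    213054, 231501, 247969, 264232, 282664, 295032, 311467, 327800, 346112, 409707]),
    ([0, 2, 105, 305], [20626, 32946, 98482, 100498, 131252, 198802, 231531, 245879, 262178,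
    264372, 329830, 344245, 362674, 395366, 442547, 446484, 446584, 458878, 475262, 491539]),
    ([0, 3, 16, 299], [4201, 4235, 18602, 32939, 49201, 67733, 100499, 102449, 118784, 166058,
    184439, 198805, 213163, 297130, 327833, 364649, 380928, 397312, 409649, 426033]),
    ([0, 4, 46, 260], [159, 32817, 82067, 147627, 166043, 198803, 217207, 297107, 376881, 413713,
    426033, 491699, 493739, 540773, 540825, 540827, 540848, 544785, 557211, 559280]),
    ([0, 5, 245, 347], [20627, 49209, 100498, 168082, 182367, 184466, 229525, 245909, 247978,
    249913, 262290, 294969, 344113, 346220, 378975, 381075, 411794, 462943, 479246, 524407]),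
    ([0, 6, 187, 315], [69737, 82090, 98483, 116882, 133281, 135343, 182447, 198802, 266345,
    282799, 346236, 377011, 395443, 411794, 479337, 495777, 524434, 528441, 528559, 559225]),
    ([0, 7, 15, 313], [20593, 20622, 20626, 65707, 118930, 135343, 180395, 182355, 184466, 198803,
    217230, 247911, 249930, 311467, 395411, 397454, 411731, 444490, 458927, 477317]),
    ([0, 8, 306, 357], [20622, 82069, 98482, 114866, 116914, 163989, 233525, 245909, 266260,
    280584, 297138, 327829, 364686, 393216, 491695, 508053, 526493, 540825, 561327, 573440]),
    ([0, 10, 228, 321], [20622, 65593, 114723, 147629, 163875, 213049, 233529, 266413, 278630,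
    282732, 294969, 329898, 360483, 393288, 409657, 413804, 426056, 460919, 493687, 540843]),
    ([0, 11, 99, 163], [49301, 98453, 100419, 102457, 131253, 133293, 135269, 196665, 198805,
    200771, 213049, 215189, 217155, 327829, 329795, 331833, 360597, 362563, 364601, 589915]),
    ([0, 17, 22, 262], [32808, 69640, 131242, 180264, 198802, 217196, 282788, 294952, 294963,
    295083, 331884, 348211, 360488, 376883, 444479, 493608, 542848, 561331, 573582, 589915]),
    ([0, 19, 89, 234], [18485, 118889, 168075, 200843, 213054, 266413, 282802, 346285, 360452,
    376894, 378957, 393220, 411725, 442430, 475263, 491582, 491647, 526376, 557096, 573476]),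
    ([0, 20, 167, 185], [2195, 49301, 65598, 118841, 131242, 163989, 180385, 198803, 213153,
    217145, 231491, 280756, 327742, 376894, 442538, 442547, 462862, 479327, 507957, 524437]),
    ([0, 23, 113, 255], [161, 20622, 180275, 196659, 200831, 213153, 233496, 247969, 266264,
    344159, 364671, 381055, 458878, 462872, 462943, 463009, 477235, 524464, 528523, 589864]),
    ([0, 25, 62, 94], [67686, 69740, 116838, 147603, 168010, 215076, 231501, 264325, 282799,
    297107, 346189, 360452, 362532, 425988, 493692, 540796, 557128, 561280, 561311, 561327]),
    ([0, 28, 84, 252], [35, 2181, 4201, 147561, 262164, 264372, 266404, 278548, 280756, 282788,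
    360555, 362549, 364657, 426019, 491540, 493748, 495780, 540829, 542859, 544927]),
    ([0, 33, 125, 297], [98304, 100352, 102400, 131242, 133194, 135288, 164019, 166043, 168057,
    278562, 280700, 282648, 311379, 377011, 379035, 381049, 458786, 460924, 462872, 508024]),
    ([0, 37, 69, 339], [4215, 16504, 165991, 184439, 196728, 233534, 245913, 266404, 278590,
    299135, 327800, 331895, 376904, 395367, 411751, 442430, 444479, 475198, 508053, 561305]),
    ([0, 49, 55, 236], [4209, 65657, 102521, 163875, 168057, 217209, 229489, 233525, 249913,
    262206, 297107, 311443, 360619, 409771, 442430, 475262, 528441, 528444, 557116, 589896]),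
    ([0, 64, 265, 276], [32808, 114728, 116882, 118792, 278674, 280584, 282664, 393337, 395411,
    397329, 540689, 542841, 544915, 557096, 559250, 561160, 573444, 589832, 589864, 589970]),
    ([0, 67, 100, 192], [65657, 67667, 69737, 82040, 344245, 346189, 348211, 360569, 362579,
    364649, 409657, 411701, 413713, 507957, 508007, 508053, 540775, 542823, 544871, 573543]),
    ([0, 70, 215, 345], [0, 2195, 4243, 69787, 100499, 114688, 116803, 131218, 233643, 297107,
    329795, 344245, 348307, 381075, 395411, 397467, 463009, 491666, 491701, 542866]),
    ([0, 91, 182, 273], [327742, 327833, 329740, 329831, 331793, 331884, 409662, 409753, 411660,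
    411751, 413713, 413804, 475171, 475262, 477226, 477317, 479246, 479337, 573440, 573531]),
    ([1, 5, 47, 261], [18546, 49200, 67698, 100466, 114860, 131120, 180272, 247895, 311447,
    331890, 346199, 393264, 444464, 446613, 458800, 462997, 475284, 479289, 524345, 528468]),
    ([1, 29, 85, 253], [98352, 100424, 102506, 131208, 133256, 135304, 180272, 182344, 184426,
    229513, 231569, 233507, 245905, 247843, 249993, 475272, 477320, 479368, 573576, 606214])]

/-- The certificate for `q = 3`. -/
noncomputable def cert3 : HalvingCert where
  N := 364
  m := 9
  H := traceZero3
  full := 2 ^ 364 - 1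
  reps := orbitExponents3
  orbs := orbitData3
  lines := lineData3
  lam := 20

/-- The traces of the powers of the generator for `q = 3`. -/
def traceTable3 : ℕ :=
  0xa04020800029020240101048909145044900a01221220100908100141005248828140108144921125149041044824900020a24228121244228800241220841105104120a29120109204124121108129101245048004a49241129220024808a01145120a001002291049490240249448008441289449489450291408211202450050249290409040291080

/-! ### Evaluation of the checks. -/

section Certificates

theorem cert5_full : cert5.full = 2 ^ cert5.N - 1 := by decide +kernel

theorem cert5_orbsCheck : cert5.orbsCheck cert5.orbs 0 = true := by decide +kernel

theorem cert5_lineCheck : cert5.lines.all cert5.lineCheck = true := by decide +kernel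

theorem cert5_coverCheck : (cert5.coverCheck 0 && cert5.coverCheck 1) = true := by decide +kernel

/-- Equality holds: 63 + 1953 + 12·3906 + 14·5859 + 98·11718 = 1279278 = 78·508431/31, the number of
blocks of a 2-(6,3,78)_5 design. -/
theorem cert5_size : HalvingCert.size cert5.orbs * ((5 ^ 3 - 1) * (5 ^ 3 - 5)) ≤
    (5 ^ 6 - 1) * (5 ^ 6 - 5) * cert5.lam := by decide +kernel

theorem cert5_codedCheck :
    cert5.codedCheck traceTable5 orbitReps5 orbitVectors5 cert5.orbs 0 = true := by decide +kernel

theorem cert5_length : orbitReps5.length = cert5.orbs.length := by decide +kernel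

theorem cert3_full : cert3.full = 2 ^ cert3.N - 1 := by decide +kernel

theorem cert3_orbsCheck : cert3.orbsCheck cert3.orbs 0 = true := by decide +kernel

theorem cert3_lineCheck : cert3.lines.all cert3.lineCheck = true := by decide +kernel

theorem cert3_coverCheck : (cert3.coverCheck 0 && cert3.coverCheck 1) = true := by decide +kernel

/-- Equality holds here too: 14 + 9·182 + 28·546 = 16940 = 20·11011/13. -/
theorem cert3_size : HalvingCert.size cert3.orbs * ((3 ^ 3 - 1) * (3 ^ 3 - 3)) ≤
    (3 ^ 6 - 1) * (3 ^ 6 - 3) * cert3.lam := by decide +kernel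

/-- The relation of the roots of `primPoly5`. -/
def relation5 : Sextic := ⟨3, 0, 4, 1, 4, 0⟩

/-- The relation of the roots of `primPoly3`. -/
def relation3 : Sextic := ⟨1, 1, 2, 0, 1, 0⟩

/-- Here 5^6 - 1 = 15624 = 2^3·3^2·7·31 is below 2^14. -/
theorem relation5_primitive : Sextic.primitiveCheck 5 14 relation5 [2, 3, 7, 31] = true := by
  decide +kernel

theorem relation3_primitive : Sextic.primitiveCheck 3 10 relation3 [2, 7, 13] = true := by
  decide +kernel

/-- The conjugates in a trace need exponents up to 5^5 = 3125, below 2^12. -/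
theorem relation5_traceCheck :
    Sextic.traceCheck 5 12 relation5 3906 traceTable5 traceZero5 = true := by decide +kernel

theorem relation3_traceCheck :
    Sextic.traceCheck 3 8 relation3 364 traceTable3 traceZero3 = true := by decide +kernel

end Certificates

/-! ### The two fields, and the theorem. -/

section Main

/-- The equation is solved for x^6, with -1 and -2 written as 4 and 3 modulo 5. -/
lemma pow_six_eq_of_aeval_primPoly5 {A : Type*} [CommRing A] [Algebra (ZMod 5) A] {x : A}
    (hx : aeval x primPoly5 = 0) : x ^ 6 = relation5.eval x := by
  have h5 : (5 : A) = 0 := by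
    have := map_natCast (algebraMap (ZMod 5) A) 5
    rw [CharP.cast_eq_zero, map_zero] at this
    exact_mod_cast this.symm
  simp only [primPoly5, map_add, map_sub, map_pow, aeval_X, map_ofNat] at hx
  simp only [relation5, Sextic.eval]
  push_cast
  linear_combination hx - (1 + x ^ 2 + x ^ 4) * h5

lemma pow_six_eq_of_aeval_primPoly3 {A : Type*} [CommRing A] [Algebra (ZMod 3) A] {x : A}
    (hx : aeval x primPoly3 = 0) : x ^ 6 = relation3.eval x := by
  have h3 : (3 : A) = 0 := by
    have := map_natCast (algebraMap (ZMod 3) A) 3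
    rw [CharP.cast_eq_zero, map_zero] at this
    exact_mod_cast this.symm
  simp only [primPoly3, map_add, map_sub, map_pow, aeval_X, map_one] at hx
  simp only [relation3, Sextic.eval]
  push_cast
  linear_combination hx - x ^ 2 * h3

lemma orderOf_root_primPoly5 {K : Type*} [Field K] [Algebra (ZMod 5) K] {α : Kˣ}
    (hα : aeval (α : K) primPoly5 = 0) : orderOf α = 5 ^ 6 - 1 := by
  rw [← orderOf_units]
  refine Sextic.orderOf_eq_of_primitiveCheck (by norm_num) natCast_prime_eq_zero
    relation5_primitive (by norm_num) (fun l hl hdvd => ?_) (pow_six_eq_of_aeval_primPoly5 hα)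
  rw [show 5 ^ 6 - 1 = 2 ^ 3 * 3 ^ 2 * 7 * 31 by norm_num] at hdvd
  simp only [List.mem_cons, List.not_mem_nil, or_false]
  rcases (Nat.Prime.dvd_mul hl).1 hdvd with h | h
  · rcases (Nat.Prime.dvd_mul hl).1 h with h | h
    · rcases (Nat.Prime.dvd_mul hl).1 h with h | h
      · exact Or.inl ((Nat.prime_dvd_prime_iff_eq hl Nat.prime_two).1 (hl.dvd_of_dvd_pow h))
      · exact Or.inr (Or.inl ((Nat.prime_dvd_prime_iff_eq hl Nat.prime_three).1
          (hl.dvd_of_dvd_pow h)))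
    · exact Or.inr (Or.inr (Or.inl ((Nat.prime_dvd_prime_iff_eq hl (by norm_num)).1 h)))
  · exact Or.inr (Or.inr (Or.inr ((Nat.prime_dvd_prime_iff_eq hl (by norm_num)).1 h)))

lemma orderOf_root_primPoly3 {K : Type*} [Field K] [Algebra (ZMod 3) K] {α : Kˣ}
    (hα : aeval (α : K) primPoly3 = 0) : orderOf α = 3 ^ 6 - 1 := by
  rw [← orderOf_units]
  refine Sextic.orderOf_eq_of_primitiveCheck (by norm_num) natCast_prime_eq_zero
    relation3_primitive (by norm_num) (fun l hl hdvd => ?_) (pow_six_eq_of_aeval_primPoly3 hα)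
  rw [show 3 ^ 6 - 1 = 2 ^ 3 * 7 * 13 by norm_num] at hdvd
  simp only [List.mem_cons, List.not_mem_nil, or_false]
  rcases (Nat.Prime.dvd_mul hl).1 hdvd with h | h
  · rcases (Nat.Prime.dvd_mul hl).1 h with h | h
    · exact Or.inl ((Nat.prime_dvd_prime_iff_eq hl Nat.prime_two).1 (hl.dvd_of_dvd_pow h))
    · exact Or.inr (Or.inl ((Nat.prime_dvd_prime_iff_eq hl (by norm_num)).1 h))
  · exact Or.inr (Or.inr ((Nat.prime_dvd_prime_iff_eq hl (by norm_num)).1 h))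

lemma cert5_isFor {K : Type*} [Field K] [Algebra (ZMod 5) K] [FiniteDimensional (ZMod 5) K]
    (hK : Module.finrank (ZMod 5) K = 6) {α : Kˣ} (hα : aeval (α : K) primPoly5 = 0) :
    cert5.IsFor (p := 5) α 1 := by
  have hgen : IsSingerGenerator 5 α 3906 :=
    isSingerGenerator_of_orderOf hK (by norm_num) (orderOf_root_primPoly5 hα)
  exact ⟨hgen, cert5_full, testBit_eq_true_iff_trace_eq_zero hK (by norm_num) (by norm_num)
    relation5_traceCheck (pow_six_eq_of_aeval_primPoly5 hα) hgen, by norm_num [cert5],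
    by norm_num, hK, by norm_num [cert5], by norm_num [cert5]⟩

lemma cert3_isFor {K : Type*} [Field K] [Algebra (ZMod 3) K] [FiniteDimensional (ZMod 3) K]
    (hK : Module.finrank (ZMod 3) K = 6) {α : Kˣ} (hα : aeval (α : K) primPoly3 = 0) :
    cert3.IsFor (p := 3) α 2 := by
  have hgen : IsSingerGenerator 3 α 364 :=
    isSingerGenerator_of_orderOf hK (by norm_num) (orderOf_root_primPoly3 hα)
  exact ⟨hgen, cert3_full, testBit_eq_true_iff_trace_eq_zero hK (by norm_num) (by norm_num)
    relation3_traceCheck (pow_six_eq_of_aeval_primPoly3 hα) hgen, by norm_num [cert3],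
    by norm_num, hK, by norm_num [cert3], by norm_num [cert3]⟩

theorem halving_five (K : Type*) [Field K] [Algebra (ZMod 5) K] [FiniteDimensional (ZMod 5) K]
    (hK : Module.finrank (ZMod 5) K = 6) :
    (∃ α : Kˣ, aeval (α : K) primPoly5 = 0) ∧
      ∀ α : Kˣ, aeval (α : K) primPoly5 = 0 →
        orderOf α = 5 ^ 6 - 1 ∧
        ∃ β : Module.Basis (Fin 6) (ZMod 5) K,
          (∀ i j : Fin 6, Algebra.trace (ZMod 5) K (β i * (α : K) ^ (j : ℕ)) =
            if i = j then 1 else 0) ∧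
          IsSubspaceDesign (ZMod 5) K 5 2 6 3 78
            (selectedBlocks5 (singerFrobGroup (ZMod 5) α 2 1) β) ∧
          IsLargeSet (ZMod 5) K 5 2 2 3 6
            {selectedBlocks5 (singerFrobGroup (ZMod 5) α 2 1) β,
              Grassmannian (ZMod 5) K 3 \
                selectedBlocks5 (singerFrobGroup (ZMod 5) α 2 1) β} := by
  refine ⟨exists_aeval_eq_zero hK relation5_primitive (by norm_num) _ ?_
    (fun A _ _ x hx => pow_six_eq_of_aeval_primPoly5 hx), fun α hα => ?_⟩
  · rw [primPoly5]
    compute_degree!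
  · have h := cert5_isFor hK hα
    have hx := pow_six_eq_of_aeval_primPoly5 hα
    obtain ⟨β, hβ, hrepr⟩ := exists_dualBasis_pow hK hx h.gen
    refine ⟨orderOf_root_primPoly5 hα, β, hβ, ?_⟩
    rw [h.selectedBlocks_eq hrepr (trace_pow_eq_entry hK h.le (k := 12) (by norm_num)
      relation5_traceCheck hx) cert5_codedCheck cert5_length]
    exact h.design_and_halving cert5_orbsCheck cert5_lineCheck cert5_coverCheck cert5_size
      (by norm_num [cert5])

theorem halving_three (K : Type*) [Field K] [Algebra (ZMod 3) K] [FiniteDimensional (ZMod 3) K]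
    (hK : Module.finrank (ZMod 3) K = 6) :
    (∃ α : Kˣ, aeval (α : K) primPoly3 = 0) ∧
      ∀ α : Kˣ, aeval (α : K) primPoly3 = 0 →
        orderOf α = 3 ^ 6 - 1 ∧
        ∃ B : Set (Submodule (ZMod 3) K),
          IsInvariantUnder (singerFrobGroup (ZMod 3) α 2 2) B ∧
          IsSubspaceDesign (ZMod 3) K 3 2 6 3 20 B ∧
          IsLargeSet (ZMod 3) K 3 2 2 3 6 {B, Grassmannian (ZMod 3) K 3 \ B} := by
  refine ⟨exists_aeval_eq_zero hK relation3_primitive (by norm_num) _ ?_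
    (fun A _ _ x hx => pow_six_eq_of_aeval_primPoly3 hx), fun α hα => ?_⟩
  · rw [primPoly3]
    compute_degree!
  · have h := cert3_isFor hK hα
    exact ⟨orderOf_root_primPoly3 hα, cert3.blocks α 2, isInvariantUnder_of_orbits _ _,
      h.design_and_halving cert3_orbsCheck cert3_lineCheck cert3_coverCheck cert3_size
        (by norm_num [cert3])⟩

/-- If there is a halving on some vector space over the prime field, then there is a halving on
every vector space of the same dimension over a field of the same order. -/
lemma exists_halving {p : ℕ} [Fact p.Prime] {W : Type*} [AddCommGroup W] [Module (ZMod p) W]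
    [FiniteDimensional (ZMod p) W] (hW : Module.finrank (ZMod p) W = 6)
    {L : Set (Set (Submodule (ZMod p) W))} (hL : IsLargeSet (ZMod p) W p 2 2 3 6 L) (F : Type*)
    [Field F] (V : Type*) [AddCommGroup V] [Module F V] (hF : Nat.card F = p)
    (hV : Module.finrank F V = 6) :
    ∃ L : Set (Set (Submodule F V)), IsLargeSet F V p 2 2 3 6 L := by
  have : FiniteDimensional F V := Module.finite_of_finrank_pos (by omega)
  obtain ⟨e, he⟩ := exists_orderIso_submodule (p := p) (V := V) (W := W) hF (hW.trans hV.symm)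
  exact ⟨_, hL.map e he hF this hV⟩

end Main

theorem theorem4p2 :
    -- a halving exists on every 6-dimensional vector space over GF(3) and over GF(5)
    (∀ (F : Type*) [Field F] (V : Type*) [AddCommGroup V] [Module F V] (q : ℕ),
      (q = 3 ∨ q = 5) → Nat.card F = q → Module.finrank F V = 6 →
        ∃ L : Set (Set (Submodule F V)), IsLargeSet F V q 2 2 3 6 L) ∧
    -- the explicit design for q = 5
    (∀ (K : Type*) [Field K] [Algebra (ZMod 5) K] [FiniteDimensional (ZMod 5) K],
      Module.finrank (ZMod 5) K = 6 →
        (∃ α : Kˣ, aeval (α : K) primPoly5 = 0) ∧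
        ∀ α : Kˣ, aeval (α : K) primPoly5 = 0 →
          orderOf α = 5 ^ 6 - 1 ∧
          ∃ β : Module.Basis (Fin 6) (ZMod 5) K,
            (∀ i j : Fin 6, Algebra.trace (ZMod 5) K (β i * (α : K) ^ (j : ℕ)) =
              if i = j then 1 else 0) ∧
            IsSubspaceDesign (ZMod 5) K 5 2 6 3 78
              (selectedBlocks5 (singerFrobGroup (ZMod 5) α 2 1) β) ∧
            IsLargeSet (ZMod 5) K 5 2 2 3 6
              {selectedBlocks5 (singerFrobGroup (ZMod 5) α 2 1) β,
                Grassmannian (ZMod 5) K 3 \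
                  selectedBlocks5 (singerFrobGroup (ZMod 5) α 2 1) β}) ∧
    -- the invariant design for q = 3
    (∀ (K : Type*) [Field K] [Algebra (ZMod 3) K] [FiniteDimensional (ZMod 3) K],
      Module.finrank (ZMod 3) K = 6 →
        (∃ α : Kˣ, aeval (α : K) primPoly3 = 0) ∧
        ∀ α : Kˣ, aeval (α : K) primPoly3 = 0 →
          orderOf α = 3 ^ 6 - 1 ∧
          ∃ B : Set (Submodule (ZMod 3) K),
            IsInvariantUnder (singerFrobGroup (ZMod 3) α 2 2) B ∧
            IsSubspaceDesign (ZMod 3) K 3 2 6 3 20 B ∧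
            IsLargeSet (ZMod 3) K 3 2 2 3 6 {B, Grassmannian (ZMod 3) K 3 \ B}) := by
  refine ⟨fun F _ V _ _ q hq hF hV => ?_, fun K _ _ _ hK => halving_five K hK,
    fun K _ _ _ hK => halving_three K hK⟩
  rcases hq with rfl | rfl
  -- Any model of GF(q^6) supplies one halving, which is then transported.
  · have hK := GaloisField.finrank 3 (n := 6) (by norm_num)
    obtain ⟨⟨α, hα⟩, h⟩ := halving_three (GaloisField 3 6) hK
    obtain ⟨B, -, -, hL⟩ := (h α hα).2
    exact exists_halving hK hL F V hF hV
  · have hK := GaloisField.finrank 5 (n := 6) (by norm_num)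
    obtain ⟨⟨α, hα⟩, h⟩ := halving_five (GaloisField 5 6) hK
    obtain ⟨β, -, -, hL⟩ := (h α hα).2
    exact exists_halving hK hL F V hF hV
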